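/- Let $R=\bigoplus_{n\in\mathbb Z}R_n$ be a commutative Noetherian $\mathbb Z$-graded ring which is a local graded ring: it has a proper homogeneous ideal $\mathfrak m$ containing every proper homogeneous ideal. Write $\kappa=R/\mathfrak m$. Regard $R$ as a DG algebra with zero differential (homological grading), and let $\mathcal D(R)$ be the derived category of DG $R$-modules, i.e. the localization of the category of DG $R$-modules at the quasi-isomorphisms. A DG module $M$ is small if $\mathrm{Hom}_{\mathcal D(R)}(M,-)$ commutes with arbitrary direct sums. A finite free resolution of a (graded) module $M$ is an exact sequence $0\to F_n\to\cdots\to F_0\to M\to 0$ of (graded) modules in which every $F_i$ is (graded) free of finite rank. (1) For every finitely generated graded $R$-module $M$ the following are equivalent: (i) $M$, with zero differential, is small as a DG $R$-module; (ii) $M$ has a finite free resolution as a graded $R$-module; (iii) the ungraded localization $M_{\mathfrak m}$ has a finite free resolution over $R_{\mathfrak m}$; (iv) the completion $M_{\mathfrak m}^\wedge$ of $M_{\mathfrak m}$ with respect to the maximal ideal of $R_{\mathfrak m}$ has a finite free resolution over $R_{\mathfrak m}^\wedge$. (2) $R$ is regular as a formal DG algebra (every DG $R$-module whose homology is a finitely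 generated $R$-module is small) if and only if $R$ is regular as a local graded ring, i.e. $\mathfrak m$ is generated by $\mathrm{height}(\mathfrak m)$ homogeneous elements, and if and only if the ungraded local ring $R_{\mathfrak m}$ is regular. (3) If $\kappa$ is a field, then $R$ is regular as a formal DG algebra if and only if it is regular as a ring spectrum augmented over $\kappa$ in the sense of Dwyer, Greenlees and Iyengar, i.e. $\kappa$ is small as a DG $R$-module. (4) If $k$ is a field and $R$ is a graded $k$-algebra (with $k$ mapping to $R_0$) generated over $k$ by homogeneous elements that are all of positive degree, or all of negative degree, then the following are equivalent: $R$ is regular as a formal DG algebra; $R$ is a polynomial ring over $k$ on finitely many homogeneous generators; $R$ is isomorphic, as an ungraded $k$-algebra, to a polynomial ring $k[x_1,\dots,x_n]$ for some $n\ge 0$. -/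

import Mathlib

open CategoryTheory

universe u v

/-! ### Graded modules

A `ℤ`-graded commutative ring is a commutative ring `R` with a family of additive subgroups
`𝒜 : ℤ → AddSubgroup R` and `[GradedRing 𝒜]`. -/

/-- A `ℤ`-graded module over the graded ring `(R, 𝒜)`: an `R`-module which is the internal direct
sum of its homogeneous components, with `𝒜 i • M_j ⊆ M_{i+j}`. -/
structure GrMod {R : Type u} [CommRing R] (𝒜 : ℤ → AddSubgroup R) : Type (u + 1) where
  carrier : Type u
  [addCommGroup : AddCommGroup carrier]
  [module : Module R carrier]
  grading : ℤ → AddSubgroup carrier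
  isInternal : DirectSum.IsInternal grading
  smul_mem : ∀ {i j : ℤ} {r : R} {x : carrier},
    r ∈ 𝒜 i → x ∈ grading j → r • x ∈ grading (i + j)

attribute [instance] GrMod.addCommGroup GrMod.module

namespace GrMod

variable {R : Type u} [CommRing R] {𝒜 : ℤ → AddSubgroup R}

/-- Morphisms of graded modules: linear maps of degree zero. -/
structure Hom (M N : GrMod 𝒜) where
  toLinearMap : M.carrier →ₗ[R] N.carrier
  map_mem : ∀ {n : ℤ} {x : M.carrier}, x ∈ M.grading n → toLinearMap x ∈ N.grading n

/-- A finite free graded module: one with a finite basis of homogeneous elements, that is, a finite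
direct sum of shifts of `R`. -/
def IsFiniteFree (M : GrMod 𝒜) : Prop :=
  ∃ (r : ℕ) (b : Module.Basis (Fin r) R M.carrier), ∀ i, ∃ n : ℤ, b i ∈ M.grading n

/-- `M` has a finite free resolution as a graded module: there is an exact sequence
`0 → F n → ⋯ → F 1 → F 0 → M → 0` of graded modules with all `F i` finite free. -/
def HasFiniteFreeResolution (M : GrMod 𝒜) : Prop :=
  ∃ (n : ℕ) (F : ℕ → GrMod 𝒜) (d : ∀ i, Hom (F (i + 1)) (F i)) (ε : Hom (F 0) M),
    (∀ i, (F i).IsFiniteFree) ∧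
    (∀ i, n < i → Subsingleton (F i).carrier) ∧
    Function.Surjective ε.toLinearMap ∧
    Function.Exact (d 0).toLinearMap ε.toLinearMap ∧
    ∀ i, Function.Exact (d (i + 1)).toLinearMap (d i).toLinearMap

end GrMod

/-- An (ungraded) module `M` over a commutative ring `A` has a finite free resolution: there is an
exact sequence `0 → A ^ r n → ⋯ → A ^ r 0 → M → 0`. -/
def HasFiniteFreeResolution (A : Type*) [CommRing A] (M : Type*) [AddCommGroup M] [Module A M] :
    Prop :=
  ∃ (n : ℕ) (r : ℕ → ℕ) (d : ∀ i, (Fin (r (i + 1)) → A) →ₗ[A] (Fin (r i) → A))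
    (ε : (Fin (r 0) → A) →ₗ[A] M),
    (∀ i, n < i → r i = 0) ∧
    Function.Surjective ε ∧
    Function.Exact (d 0) ε ∧
    ∀ i, Function.Exact (d (i + 1)) (d i)

/-! ### Differential graded modules over a formal DG algebra -/

/-- A differential graded module over the DG algebra `R` with zero differential, with homological
grading. As `R` is commutative, modules are right modules, for which the Leibniz rule
`d (x r) = (d x) r + (-1)^|x| x (d r)` says, since `d r = 0`, that `d` is `R`-linear. -/
structure DGMod {R : Type u} [CommRing R] (𝒜 : ℤ → AddSubgroup R) : Type (u + 1)
    extends GrMod 𝒜 where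
  d : carrier →ₗ[R] carrier
  d_mem : ∀ {n : ℤ} {x : carrier}, x ∈ grading n → d x ∈ grading (n - 1)
  d_d : ∀ x : carrier, d (d x) = 0

namespace DGMod

variable {R : Type u} [CommRing R] {𝒜 : ℤ → AddSubgroup R}

/-- Morphisms of DG modules: linear chain maps of degree zero. -/
@[ext]
structure Hom (M N : DGMod 𝒜) where
  toLinearMap : M.carrier →ₗ[R] N.carrier
  map_mem : ∀ {n : ℤ} {x : M.carrier}, x ∈ M.grading n → toLinearMap x ∈ N.grading n
  map_d : ∀ x : M.carrier, toLinearMap (M.d x) = N.d (toLinearMap x)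

instance : Category (DGMod 𝒜) where
  Hom M N := Hom M N
  id M := ⟨LinearMap.id, fun h => h, fun _ => rfl⟩
  comp f g := ⟨g.toLinearMap ∘ₗ f.toLinearMap, fun h => g.map_mem (f.map_mem h),
    fun x => by simp [f.map_d, g.map_d]⟩

/-- The total homology `ker d / im d` of a DG module, an `R`-module. -/
abbrev Homology (M : DGMod 𝒜) : Type u :=
  LinearMap.ker M.d ⧸ (LinearMap.range M.d).submoduleOf (LinearMap.ker M.d)

/-- The map induced on cycles. -/
def cyclesMap {M N : DGMod 𝒜} (f : M ⟶ N) : LinearMap.ker M.d →ₗ[R] LinearMap.ker N.d :=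
  (Hom.toLinearMap f).restrict fun x hx => by
    rw [LinearMap.mem_ker] at hx ⊢
    rw [← Hom.map_d f x, hx, map_zero]

/-- The map induced on homology. -/
def homologyMap {M N : DGMod 𝒜} (f : M ⟶ N) : M.Homology →ₗ[R] N.Homology :=
  Submodule.mapQ _ _ (cyclesMap f) fun x hx => by
    obtain ⟨y, hy⟩ := hx
    exact ⟨Hom.toLinearMap f y, (Hom.map_d f y).symm.trans (congrArg (Hom.toLinearMap f) hy)⟩

variable (𝒜) in
/-- Quasi-isomorphisms: the morphisms inducing an isomorphism on homology. -/
def quasiIso : MorphismProperty (DGMod 𝒜) :=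
  fun _ _ f => Function.Bijective (homologyMap f)

variable (𝒜) in
/-- The derived category of DG modules: the localization at the quasi-isomorphisms. -/
abbrev Derived : Type (u + 1) := (quasiIso 𝒜).Localization

variable (𝒜) in
/-- The localization functor from DG modules to their derived category. -/
abbrev Q : DGMod 𝒜 ⥤ Derived 𝒜 := (quasiIso 𝒜).Q

open scoped DirectSum in
/-- The direct sum of a family of DG modules, with componentwise grading and differential. -/
noncomputable def directSum {ι : Type u} (X : ι → DGMod 𝒜) : DGMod 𝒜 where
  carrier := ⨁ i, (X i).carrier
  grading n :=
    { carrier := {x | ∀ i, x i ∈ (X i).grading n}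
      add_mem' := fun hx hy i => add_mem (hx i) (hy i)
      zero_mem' := fun _ => zero_mem _
      neg_mem' := fun hx i => neg_mem (hx i) }
  isInternal := by
    classical
    constructor
    · rw [injective_iff_map_eq_zero]
      intro y hy
      refine DFinsupp.ext fun n => Subtype.ext (DFinsupp.ext fun i => ?_)
      let G : ℤ → AddSubgroup (⨁ i, (X i).carrier) := fun n =>
        { carrier := {x | ∀ i, x i ∈ (X i).grading n}
          add_mem' := fun hx hy i => add_mem (hx i) (hy i)
          zero_mem' := fun _ => zero_mem _
          neg_mem' := fun hx i => neg_mem (hx i) }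
      let φ : ∀ n : ℤ, G n →+ (X i).grading n := fun n =>
        { toFun := fun z => ⟨z.1 i, z.2 i⟩, map_zero' := rfl, map_add' := fun _ _ => rfl }
      have hcomm : ∀ z : ⨁ n, G n, DirectSum.coeAddMonoidHom (X i).grading (DirectSum.map φ z) =
          (DirectSum.coeAddMonoidHom G z) i := by
        intro z
        induction z using DirectSum.induction_on with
        | zero => simp
        | of n x =>
          rw [DirectSum.map_of, DirectSum.coeAddMonoidHom_of, DirectSum.coeAddMonoidHom_of]
          rfl
        | add x y hx hy => rw [map_add, map_add, map_add, hx, hy, DirectSum.add_apply]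
      have h0 : DirectSum.map φ y = 0 := (X i).isInternal.1 (by rw [hcomm, hy, map_zero]; rfl)
      have := congrArg (fun w => (w n : (X i).carrier)) h0
      simp only [φ, DirectSum.map_apply, DirectSum.zero_apply] at this
      exact this
    · intro x
      induction x using DirectSum.induction_on with
      | zero => exact ⟨0, map_zero _⟩
      | of i x =>
        obtain ⟨z, rfl⟩ := (X i).isInternal.2 x
        induction z using DirectSum.induction_on with
        | zero => exact ⟨0, by simp⟩
        | of n x =>
          refine ⟨DirectSum.of _ n ⟨DirectSum.of (fun i => (X i).carrier) i x.1, fun j => ?_⟩, ?_⟩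
          · by_cases h : i = j
            · subst h
              rw [DirectSum.of_eq_same]
              exact x.2
            · rw [DirectSum.of_eq_of_ne _ _ _ (Ne.symm h)]
              exact zero_mem _
          · rw [DirectSum.coeAddMonoidHom_of, DirectSum.coeAddMonoidHom_of]
        | add x y hx hy =>
          obtain ⟨a, ha⟩ := hx
          obtain ⟨b, hb⟩ := hy
          exact ⟨a + b, by rw [map_add, ha, hb, map_add, map_add]⟩
      | add x y hx hy =>
        obtain ⟨a, rfl⟩ := hx
        obtain ⟨b, rfl⟩ := hy
        exact ⟨a + b, map_add _ _ _⟩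
  smul_mem hr hx i := (X i).smul_mem hr (hx i)
  d := DirectSum.lmap fun i => (X i).d
  d_mem hx i := (X i).d_mem (hx i)
  d_d x := DFinsupp.ext fun i => (X i).d_d (x i)

open scoped Classical in
/-- The inclusion of the direct sum of a finite subfamily, as a linear map. -/
noncomputable def directSumInclLinear {ι : Type u} (X : ι → DGMod 𝒜) (s : Finset ι) :
    DirectSum s (fun i => (X i).carrier) →ₗ[R] DirectSum ι (fun i => (X i).carrier) :=
  DirectSum.toModule R s _ fun i => DirectSum.lof R ι (fun i => (X i).carrier) i

open scoped Classical in
theorem directSumInclLinear_apply {ι : Type u} (X : ι → DGMod 𝒜) (s : Finset ι)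
    (x : DirectSum s fun i => (X i).carrier) (j : ι) :
    directSumInclLinear X s x j = if h : j ∈ s then x ⟨j, h⟩ else 0 := by
  induction x using DirectSum.induction_on with
  | zero => simp
  | of i y =>
    rw [directSumInclLinear, ← DirectSum.lof_eq_of R, DirectSum.toModule_lof]
    obtain ⟨i, hi⟩ := i
    by_cases hij : i = j
    · subst hij
      rw [DirectSum.lof_apply, dif_pos hi, DirectSum.lof_apply]
    · rw [DirectSum.lof_eq_of, DirectSum.of_eq_of_ne _ _ _ (Ne.symm hij)]
      split_ifs with h
      · rw [DirectSum.lof_eq_of, DirectSum.of_eq_of_ne]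
        exact fun h' => hij (congrArg Subtype.val h').symm
      · rfl
  | add x y hx hy =>
    rw [map_add, DirectSum.add_apply, hx, hy]
    split_ifs <;> simp

/-- The inclusion of the direct sum of a finite subfamily into the direct sum of a family. -/
noncomputable def directSumIncl {ι : Type u} (X : ι → DGMod 𝒜) (s : Finset ι) :
    directSum (fun i : s => X i) ⟶ directSum X where
  toLinearMap := directSumInclLinear X s
  map_mem := by
    intro n x hx j
    have h := directSumInclLinear_apply X s x j
    split_ifs at h with hj
    · exact h ▸ hx ⟨j, hj⟩
    · exact h ▸ zero_mem _
  map_d := by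
    intro x
    refine DFinsupp.ext fun j => ?_
    refine (directSumInclLinear_apply X s (DirectSum.lmap (fun i : s => (X i).d) x) j).trans ?_
    refine Eq.trans ?_ (congrArg (X j).d (directSumInclLinear_apply X s x j)).symm
    split_ifs with h
    · rfl
    · rw [map_zero]

/-- A DG module `M` is small (compact) if `Hom(M, -)` in the derived category commutes with
arbitrary direct sums: every morphism from `M` to a direct sum `⨁ i, X i` in the derived category
factors through the direct sum of finitely many of the `X i`. (Injectivity of
`⨁ i, Hom(M, X i) → Hom(M, ⨁ i, X i)` is automatic, by projecting to the summands.) -/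
def IsSmall (M : DGMod 𝒜) : Prop :=
  ∀ (ι : Type u) (X : ι → DGMod 𝒜) (f : (Q 𝒜).obj M ⟶ (Q 𝒜).obj (directSum X)),
    ∃ (s : Finset ι) (g : (Q 𝒜).obj M ⟶ (Q 𝒜).obj (directSum fun i : s => X i)),
      g ≫ (Q 𝒜).map (directSumIncl X s) = f

/-- A graded module as a DG module with zero differential. -/
def ofGrMod (M : GrMod 𝒜) : DGMod 𝒜 where
  toGrMod := M
  d := 0
  d_mem _ := zero_mem _
  d_d _ := rfl

end DGMod

/-! ### Local graded rings and regularity -/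

section LocalGraded

variable {R : Type u} [CommRing R] (𝒜 : ℤ → AddSubgroup R) [GradedRing 𝒜]

/-- `(R, m)` is a local graded ring: `m` is the unique maximal homogeneous ideal, i.e. it is proper
and contains every proper homogeneous ideal. -/
class IsLocalGraded (m : HomogeneousIdeal 𝒜) : Prop where
  ne_top : m.toIdeal ≠ ⊤
  le_of_ne_top : ∀ I : HomogeneousIdeal 𝒜, I.toIdeal ≠ ⊤ → I.toIdeal ≤ m.toIdeal

instance IsLocalGraded.isPrime (m : HomogeneousIdeal 𝒜) [hm : IsLocalGraded 𝒜 m] :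
    m.toIdeal.IsPrime := by
  refine m.isHomogeneous.isPrime_of_homogeneous_mem_or_mem hm.ne_top ?_
  intro x y hx hy hxy
  by_contra! h
  have hspan : ∀ z, SetLike.IsHomogeneousElem 𝒜 z → z ∉ m.toIdeal → Ideal.span {z} ⊔ m.toIdeal = ⊤ := by
    intro z hz hzm
    by_contra hne
    have hh : (Ideal.span {z} ⊔ m.toIdeal).IsHomogeneous 𝒜 :=
      (Ideal.homogeneous_span 𝒜 {z} (by simpa using hz)).sup m.isHomogeneous
    exact hzm (hm.le_of_ne_top ⟨_, hh⟩ hne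
      (Ideal.mem_sup_left (Ideal.mem_span_singleton_self z)))
  have h1 : (1 : R) ∈ Ideal.span {x} ⊔ m.toIdeal := by rw [hspan x hx h.1]; trivial
  obtain ⟨a, ha, b, hb, hab⟩ := Submodule.mem_sup.1 h1
  obtain ⟨c, rfl⟩ := Ideal.mem_span_singleton'.1 ha
  refine h.2 ?_
  have : y = c * (x * y) + b * y := by linear_combination (-y) * hab
  rw [this]
  exact add_mem (Ideal.mul_mem_left _ _ hxy) (Ideal.mul_mem_right _ _ hb)

/-- The grading on the quotient `R / m` by a homogeneous ideal: the images of the components. -/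
def quotientGrading (m : HomogeneousIdeal 𝒜) (n : ℤ) : AddSubgroup (R ⧸ m.toIdeal) :=
  (𝒜 n).map (Ideal.Quotient.mk m.toIdeal).toAddMonoidHom

theorem quotientGrading_isInternal (m : HomogeneousIdeal 𝒜) :
    DirectSum.IsInternal (quotientGrading 𝒜 m) := by
  classical
  let π : ∀ n : ℤ, 𝒜 n →+ quotientGrading 𝒜 m n := fun n =>
    { toFun := fun a => ⟨Ideal.Quotient.mk m.toIdeal a, ⟨a, a.2, rfl⟩⟩
      map_zero' := Subtype.ext (map_zero _)
      map_add' := fun _ _ => Subtype.ext (map_add _ _ _) }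
  have hπ : ∀ n, Function.Surjective (π n) := by
    rintro n ⟨_, a, ha, rfl⟩
    exact ⟨⟨a, ha⟩, rfl⟩
  have hcomm : ∀ y : DirectSum ℤ fun n => 𝒜 n,
      DirectSum.coeAddMonoidHom (quotientGrading 𝒜 m) (DirectSum.map π y) =
        Ideal.Quotient.mk m.toIdeal (DirectSum.coeAddMonoidHom 𝒜 y) := by
    intro y
    induction y using DirectSum.induction_on with
    | zero => simp
    | of n x =>
      rw [DirectSum.map_of, DirectSum.coeAddMonoidHom_of, DirectSum.coeAddMonoidHom_of]
      rfl
    | add x y hx hy => rw [map_add, map_add, map_add, map_add, hx, hy]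
  constructor
  · rw [injective_iff_map_eq_zero]
    intro z hz
    obtain ⟨y, rfl⟩ := (DirectSum.map_surjective π).2 hπ z
    rw [hcomm, Ideal.Quotient.eq_zero_iff_mem] at hz
    refine DFinsupp.ext fun n => Subtype.ext ?_
    have h1 := m.isHomogeneous n hz
    have h2 : DirectSum.decompose 𝒜 (DirectSum.coeAddMonoidHom 𝒜 y) = y :=
      DirectSum.Decomposition.right_inv y
    rw [h2] at h1
    rw [DirectSum.map_apply]
    exact Ideal.Quotient.eq_zero_iff_mem.2 h1
  · intro x
    obtain ⟨r, rfl⟩ := Ideal.Quotient.mk_surjective x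
    refine ⟨DirectSum.map π (DirectSum.decompose 𝒜 r), ?_⟩
    rw [hcomm]
    exact congrArg _ (DirectSum.Decomposition.left_inv r)

/-- The quotient `R / m` by a homogeneous ideal, as a graded module. -/
def GrMod.quotient (m : HomogeneousIdeal 𝒜) : GrMod 𝒜 where
  carrier := R ⧸ m.toIdeal
  grading := quotientGrading 𝒜 m
  isInternal := quotientGrading_isInternal 𝒜 m
  smul_mem := by
    rintro i j r _ hr ⟨x, hx, rfl⟩
    exact ⟨r * x, SetLike.mul_mem_graded hr hx, by simp [Algebra.smul_def]⟩

/-- `R` is regular as a formal DG algebra: every DG module with finitely generated homology is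
small. -/
def IsRegularDGAlgebra : Prop :=
  ∀ M : DGMod 𝒜, Module.Finite R M.Homology → M.IsSmall

/-- `R` is regular as a local graded ring: its maximal homogeneous ideal `m` is generated by
`height m` homogeneous elements. -/
def IsRegularLocalGraded (m : HomogeneousIdeal 𝒜) : Prop :=
  ∃ (n : ℕ) (x : Fin n → R), (∀ i, SetLike.IsHomogeneousElem 𝒜 (x i)) ∧
    Ideal.span (Set.range x) = m.toIdeal ∧ m.toIdeal.height = n

/-- Regularity of an augmented ring spectrum `R → κ` in the sense of Dwyer, Greenlees and Iyengar,
for the formal DG algebra `R` and its augmentation onto `κ = R / m`: `κ` is small over `R`. -/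
def IsRegularAugmented (m : HomogeneousIdeal 𝒜) : Prop :=
  (DGMod.ofGrMod (GrMod.quotient 𝒜 m)).IsSmall

/-- `R` is a graded polynomial ring over `k`: a polynomial algebra on finitely many homogeneous
generators. -/
def IsGradedPolynomialRing (k : Type v) [Field k] [Algebra k R] : Prop :=
  ∃ (n : ℕ) (e : MvPolynomial (Fin n) k ≃ₐ[k] R),
    ∀ i, SetLike.IsHomogeneousElem 𝒜 (e (MvPolynomial.X i))

/-- `R` is a graded `k`-algebra (the scalars have degree zero), generated over `k` by homogeneous
elements which all have positive degree, or all have negative degree. -/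
def IsGeneratedInOneSign (k : Type v) [Field k] [Algebra k R] : Prop :=
  (∀ a : k, algebraMap k R a ∈ 𝒜 0) ∧
    (Algebra.adjoin k {x : R | ∃ n : ℤ, 0 < n ∧ x ∈ 𝒜 n} = ⊤ ∨
      Algebra.adjoin k {x : R | ∃ n : ℤ, n < 0 ∧ x ∈ 𝒜 n} = ⊤)

end LocalGraded

/-! Smallness over `R` is tied to finite projective dimension over a flat local `R`-algebra `S`,
taken to be the localization at `m` or its completion.

Let `M` be a DG module whose homology `H` is finitely generated and has finite projective dimension
after tensoring with `S`. Map a free graded module `F` with zero differential onto a minimal system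
of homogeneous generators of `H`. The homology of the cone is the first syzygy of `H`, and
minimality over the local graded ring puts it inside `mF`. This inclusion survives tensoring with
`S`, so by Nakayama the projective dimension over `S` drops at each step; once the tensored homology
vanishes, minimality forces the homology itself to vanish. Gluing the free modules along the cones
gives a finitely generated homotopically projective DG module quasi-isomorphic to `M`. Derived
morphisms out of it are chain maps up to homotopy, and a finitely generated source meets only
finitely many summands of a direct sum, so `M` is small (`DGMod.isSmall_of_pdLT`).

Conversely, let a graded module be small and totalize its minimal free resolution. Reducing all
coordinates modulo `m` is a chain map to a direct sum of shifts of `R / m`, one for each basis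
element. Since the differential has entries in `m`, homotopies cannot change its values on basis
elements. Smallness makes it factor through a finite subsum, so the basis is finite
(`IsSmall.exists_bound_of_minimal`). Together with flat base change of resolutions this gives (1).

Parts (2) and (3) combine this with both directions of the Auslander-Buchsbaum-Serre theorem. If
`R_m` is regular, every finitely generated module over it has finite projective dimension; if `R /
m` is small, the residue field of `R_m` has a finite free resolution. Graded and local regularity
agree because minimal homogeneous generators of `m` stay minimal in `R_m`, whose dimension is the
height of `m`.

For (4), when the generating degrees have one sign, homogeneous generators of `m` also generate the
algebra. If there are as many of them as the height of `m`, a relation between them would make the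
dimension of `R` too small. Conversely, polynomial rings over a field have regular localizations. -/

/-! ### Projective dimension and short exact sequences -/

section ProjectiveDimension

open IsLocalRing

/-- The projective dimension of `M` over `A` is smaller than `n`. -/
abbrev PdLT (A : Type u) [CommRing A] (M : Type u) [AddCommGroup M] [Module A M] (n : ℕ) : Prop :=
  HasProjectiveDimensionLT (ModuleCat.of A M) n

variable {A : Type u} [CommRing A] {K F M N : Type u} [AddCommGroup K] [Module A K]
  [AddCommGroup F] [Module A F] [AddCommGroup M] [Module A M] [AddCommGroup N] [Module A N]

theorem PdLT.of_equiv {n : ℕ} (h : PdLT A M n) (e : M ≃ₗ[A] N) : PdLT A N n :=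
  have := h
  hasProjectiveDimensionLT_of_iso e.toModuleIso n

theorem PdLT.mono {n k : ℕ} (h : PdLT A M n) (hk : n ≤ k) : PdLT A M k :=
  have := h
  hasProjectiveDimensionLT_of_ge _ n k hk

theorem pdLT_zero_iff : PdLT A M 0 ↔ Subsingleton M := by
  rw [PdLT, hasProjectiveDimensionLT_zero_iff_isZero, ModuleCat.isZero_iff_subsingleton]

theorem pdLT_one_iff : PdLT A M 1 ↔ Module.Projective A M := by
  rw [PdLT, ← projective_iff_hasProjectiveDimensionLT_one, ← IsProjective.iff_projective]

theorem PdLT.of_retract {n : ℕ} (h : PdLT A M n) (i : N →ₗ[A] M) (r : M →ₗ[A] N)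
    (hri : r ∘ₗ i = LinearMap.id) : PdLT A N n :=
  have := h
  Retract.hasProjectiveDimensionLT (X := ModuleCat.of A N) (Y := ModuleCat.of A M)
    ⟨ModuleCat.ofHom i, ModuleCat.ofHom r, by rw [← ModuleCat.ofHom_comp, hri]; rfl⟩ n

theorem shortExact_of_exact {f : K →ₗ[A] F} {g : F →ₗ[A] M} (hf : Function.Injective f)
    (hfg : Function.Exact f g) (hg : Function.Surjective g) :
    (ShortComplex.mk (ModuleCat.ofHom f) (ModuleCat.ofHom g)
      (by rw [← ModuleCat.ofHom_comp, hfg.linearMap_comp_eq_zero]; rfl)).ShortExact where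
  exact := (ShortComplex.ShortExact.moduleCat_exact_iff_function_exact _).2 hfg
  mono_f := (ModuleCat.mono_iff_injective _).2 hf
  epi_g := (ModuleCat.epi_iff_surjective _).2 hg

theorem PdLT.left {n : ℕ} {f : K →ₗ[A] F} {g : F →ₗ[A] M} (hf : Function.Injective f)
    (hfg : Function.Exact f g) (hg : Function.Surjective g) (h₂ : PdLT A F n)
    (h₃ : PdLT A M (n + 1)) : PdLT A K n :=
  (shortExact_of_exact hf hfg hg).hasProjectiveDimensionLT_X₁ n h₂ h₃

theorem PdLT.right {n : ℕ} {f : K →ₗ[A] F} {g : F →ₗ[A] M} (hf : Function.Injective f)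
    (hfg : Function.Exact f g) (hg : Function.Surjective g) (h₁ : PdLT A K n)
    (h₂ : PdLT A F (n + 1)) : PdLT A M (n + 1) :=
  (shortExact_of_exact hf hfg hg).hasProjectiveDimensionLT_X₃ n h₁ h₂

theorem PdLT.middle {n : ℕ} {f : K →ₗ[A] F} {g : F →ₗ[A] M} (hf : Function.Injective f)
    (hfg : Function.Exact f g) (hg : Function.Surjective g) (h₁ : PdLT A K n)
    (h₂ : PdLT A M n) : PdLT A F n :=
  (shortExact_of_exact hf hfg hg).hasProjectiveDimensionLT_X₂ n h₁ h₂

/-- The kernel of a minimal cover of a module of projective dimension at most `n` has smaller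
projective dimension. -/
theorem PdLT.ker_of_minimal [IsLocalRing A] [Module.Projective A F] [Module.Finite A K] {n : ℕ}
    {f : K →ₗ[A] F} {g : F →ₗ[A] M} (hf : Function.Injective f) (hfg : Function.Exact f g)
    (hg : Function.Surjective g)
    (hmin : LinearMap.range f ≤ maximalIdeal A • (⊤ : Submodule A F))
    (h : PdLT A M (n + 1)) : PdLT A K n := by
  cases n with
  | succ n => exact PdLT.left hf hfg hg ((pdLT_one_iff.2 inferInstance).mono (by omega)) h
  -- Now `M` is projective and the claim is that `K` vanishes. The cover splits, so `K` is a retract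
  -- of `F`; as its image lies in `mF`, the retraction gives `K = mK`, and Nakayama applies.
  | zero =>
    rw [zero_add, pdLT_one_iff] at h
    obtain ⟨s, hs⟩ := Module.projective_lifting_property g LinearMap.id hg
    have hs' : ∀ x, g (s x) = x := fun x => LinearMap.congr_fun hs x
    have hmem : ∀ y, ∃ x, f x = y - s (g y) := fun y => (hfg _).1 (by rw [map_sub, hs', sub_self])
    let e := LinearEquiv.ofInjective f hf
    let r : F →ₗ[A] K := e.symm.toLinearMap ∘ₗ
      LinearMap.codRestrict (LinearMap.range f) (LinearMap.id - s ∘ₗ g) hmem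
    have hr : ∀ x, r (f x) = x := by
      intro x
      refine e.symm_apply_eq.2 (Subtype.ext ?_)
      have : g (f x) = 0 := hfg.apply_apply_eq_zero x
      change f x - s (g (f x)) = f x
      rw [this, map_zero, sub_zero]
    have htop : (⊤ : Submodule A K) ≤ maximalIdeal A • ⊤ := by
      intro x _
      have h1 : f x ∈ maximalIdeal A • (⊤ : Submodule A F) := hmin ⟨x, rfl⟩
      have h2 : r (f x) ∈ (maximalIdeal A • (⊤ : Submodule A F)).map r := ⟨_, h1, rfl⟩
      rw [hr, Submodule.map_smul''] at h2
      exact Submodule.smul_mono le_rfl le_top h2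
    have := Submodule.eq_bot_of_le_smul_of_le_jacobson_bot _ _ Module.Finite.fg_top htop
      (maximalIdeal_le_jacobson _)
    rw [pdLT_zero_iff]
    exact ⟨fun a b => by
      have ha : a ∈ (⊤ : Submodule A K) := trivial
      have hb : b ∈ (⊤ : Submodule A K) := trivial
      rw [this, Submodule.mem_bot] at ha hb
      rw [ha, hb]⟩

/-- Induction on the length: the image of `d 0` is resolved by the truncated complex, and it is the
kernel of a free cover of `M`. -/
theorem HasFiniteFreeResolution.exists_pdLT (h : HasFiniteFreeResolution A M) :
    ∃ n, PdLT A M n := by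
  obtain ⟨n, r, d, ε, hr, hε, hd0, hd⟩ := h
  induction n generalizing M r with
  | zero =>
    have : Subsingleton (Fin (r (0 + 1)) → A) := by
      rw [hr _ (by omega)]
      infer_instance
    have hinj : Function.Injective ε := by
      rw [injective_iff_map_eq_zero]
      intro x hx
      obtain ⟨y, rfl⟩ := (hd0 x).1 hx
      rw [Subsingleton.elim y 0, map_zero]
    exact ⟨1, PdLT.of_equiv (pdLT_one_iff.2 inferInstance) (LinearEquiv.ofBijective ε ⟨hinj, hε⟩)⟩
  | succ n ih =>
    obtain ⟨k, hk⟩ := ih (M := LinearMap.range (d 0)) (fun i => r (i + 1)) (fun i => d (i + 1))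
      (d 0).rangeRestrict (fun i hi => hr _ (by omega)) (d 0).surjective_rangeRestrict
      (fun x => by
        rw [← hd 0 x]
        exact Subtype.ext_iff) (fun i => hd (i + 1))
    refine ⟨k + 1, PdLT.right (f := (LinearMap.range (d 0)).subtype) Subtype.val_injective ?_ hε hk
      ((pdLT_one_iff.2 inferInstance).mono (by omega))⟩
    intro x
    rw [hd0 x]
    simp

end ProjectiveDimension

/-! ### Regular local rings: minimal generators, hypersurface quotients, integrality -/

section RegularLocalRing

open IsLocalRing

/-- A generating family of minimal length, taken from a set of generators, satisfies no relation
with an invertible coefficient. -/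
theorem exists_minimal_generators {R M : Type*} [CommRing R] [AddCommGroup M] [Module R M]
    {H : Set M} (h : ∃ (r : ℕ) (x : Fin r → M), (∀ i, x i ∈ H) ∧ Submodule.span R (Set.range x) = ⊤) :
    ∃ (r : ℕ) (x : Fin r → M), (∀ i, x i ∈ H) ∧ Submodule.span R (Set.range x) = ⊤ ∧
      ∀ a : Fin r → R, ∑ i, a i • x i = 0 → ∀ i, ¬ IsUnit (a i) := by
  classical
  obtain ⟨x, hx, hspan⟩ := Nat.find_spec h
  refine ⟨Nat.find h, x, hx, hspan, fun a ha i hu => ?_⟩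
  obtain ⟨r, hr⟩ : ∃ r, Nat.find h = r + 1 :=
    ⟨Nat.find h - 1, (Nat.succ_pred_eq_of_pos (Fin.pos i)).symm⟩
  have hmin : ¬ ∃ y : Fin r → M, (∀ i, y i ∈ H) ∧ Submodule.span R (Set.range y) = ⊤ :=
    Nat.find_min h (by omega)
  generalize Nat.find h = n at *
  subst hr
  -- A relation with an invertible `i`-th coefficient expresses `x i` through the others, so
  -- dropping it gives a shorter generating family.
  refine hmin ⟨x ∘ i.succAbove, fun j => hx _, ?_⟩
  rw [eq_top_iff, ← hspan, Submodule.span_le]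
  rintro _ ⟨j, rfl⟩
  rcases eq_or_ne j i with rfl | hj
  · obtain ⟨w, hw⟩ := hu
    rw [Fin.sum_univ_succAbove _ j, ← hw] at ha
    have hxj : x j = -∑ l, ((w⁻¹ : Rˣ) : R) • a (j.succAbove l) • x (j.succAbove l) := by
      rw [← Finset.smul_sum, ← smul_neg, ← eq_neg_of_add_eq_zero_left ha, smul_smul]
      simp
    rw [SetLike.mem_coe, hxj]
    exact neg_mem (sum_mem fun l _ => Submodule.smul_mem _ _ (Submodule.smul_mem _ _
      (Submodule.subset_span ⟨l, rfl⟩)))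
  · obtain ⟨l, rfl⟩ := Fin.exists_succAbove_eq hj
    exact Submodule.subset_span ⟨l, rfl⟩

variable {A : Type u} [CommRing A] [IsLocalRing A]

theorem isLocalRing_quotient_span_singleton {x : A} (hx : x ∈ maximalIdeal A) :
    IsLocalRing (A ⧸ Ideal.span {x}) := by
  have : Nontrivial (A ⧸ Ideal.span {x}) := Ideal.Quotient.nontrivial_iff.2 fun h =>
    (maximalIdeal.isMaximal A).ne_top
      (top_le_iff.1 (h ▸ (Ideal.span_singleton_le_iff_mem _).2 hx))
  exact IsLocalRing.of_surjective' _ Ideal.Quotient.mk_surjective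

variable [IsNoetherianRing A]

/-- Prime avoidance, which tolerates two ideals that are not prime; the square of the maximal ideal
fills both exceptional places. It does not contain the maximal ideal, by Nakayama. -/
theorem exists_mem_maximalIdeal_notMem_sq (P : Finset (Ideal A)) (hP : ∀ p ∈ P, p.IsPrime)
    (hmP : ∀ p ∈ P, ¬ maximalIdeal A ≤ p) (hm : maximalIdeal A ≠ ⊥) :
    ∃ x ∈ maximalIdeal A, x ∉ maximalIdeal A ^ 2 ∧ ∀ p ∈ P, x ∉ p := by
  classical
  have h := (Ideal.subset_union_prime (s := insert (maximalIdeal A ^ 2) P) (f := id)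
    (maximalIdeal A ^ 2) (maximalIdeal A ^ 2) (fun i hi h1 _ => hP i
      ((Finset.mem_insert.1 hi).resolve_left h1)) (I := maximalIdeal A)).not.2 (by
      rintro ⟨p, hp, hle⟩
      rcases Finset.mem_insert.1 hp with rfl | hp
      · refine hm (Submodule.eq_bot_of_le_smul_of_le_jacobson_bot (maximalIdeal A) _
          (IsNoetherian.noetherian _) ?_ (maximalIdeal_le_jacobson _))
        simpa [pow_two] using hle
      · exact hmP p hp hle)
  obtain ⟨x, hx, hxn⟩ := Set.not_subset.1 h
  simp only [Finset.coe_insert, Set.mem_iUnion, not_exists] at hxn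
  exact ⟨x, hx, hxn _ (Set.mem_insert _ _), fun p hp => hxn p (Set.mem_insert_of_mem _ hp)⟩

/-- The class of `x` in the cotangent space is nonzero, so a scaled linear functional takes the
value 1 there. This functional later splits the residue field off the reduction of the maximal ideal
modulo `x`. -/
theorem exists_linearMap_residueField {x : A} (hx : x ∈ maximalIdeal A)
    (hx2 : x ∉ maximalIdeal A ^ 2) :
    ∃ φ : maximalIdeal A →ₗ[A] ResidueField A, φ ⟨x, hx⟩ = 1 := by
  have h0 : (maximalIdeal A).toCotangent ⟨x, hx⟩ ≠ 0 := by
    rwa [Ne, Ideal.toCotangent_eq_zero]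
  obtain ⟨f, hf⟩ := not_forall.1 ((Module.forall_dual_apply_eq_zero_iff (ResidueField A)
    (V := CotangentSpace A) _).not.2 h0)
  exact ⟨((f _)⁻¹ • f).restrictScalars A ∘ₗ (maximalIdeal A).toCotangent, inv_mul_cancel₀ hf⟩

/-- Complete the class of `x` to a basis of the cotangent space and lift it with `x` itself as one
lift. The lifts generate the maximal ideal, and the image of `x` is redundant in `B`. -/
theorem spanFinrank_maximalIdeal_lt_of_surjective {B : Type*} [CommRing B] [IsLocalRing B]
    {f : A →+* B} (hf : Function.Surjective f) {x : A} (hx : x ∈ maximalIdeal A)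
    (hx2 : x ∉ maximalIdeal A ^ 2) (hfx : f x = 0) :
    (maximalIdeal B).spanFinrank + 1 ≤ (maximalIdeal A).spanFinrank := by
  classical
  have h0 : (maximalIdeal A).toCotangent ⟨x, hx⟩ ≠ 0 := by
    rwa [Ne, Ideal.toCotangent_eq_zero]
  have hli : LinearIndepOn (ResidueField A) id {(maximalIdeal A).toCotangent ⟨x, hx⟩} :=
    LinearIndepOn.singleton h0
  let b : Module.Basis _ (ResidueField A) (CotangentSpace A) := Module.Basis.extend hli
  let i₀ : ↑(hli.extend (Set.subset_univ _)) := ⟨_, hli.subset_extend _ rfl⟩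
  have hb₀ : b i₀ = (maximalIdeal A).toCotangent ⟨x, hx⟩ := Module.Basis.extend_apply_self hli i₀
  have : Fintype ↑(hli.extend (Set.subset_univ _)) := @Fintype.ofFinite _ (Module.Finite.finite_basis b)
  choose y hy using fun i => (maximalIdeal A).toCotangent_surjective (b i)
  let z := Function.update y i₀ ⟨x, hx⟩
  have hz : ∀ i, (maximalIdeal A).toCotangent (z i) = b i := by
    intro i
    by_cases h : i = i₀
    · subst h
      simp [z, hb₀]
    · simp [z, h, hy]
  have hspan : Submodule.span A (Set.range z) = ⊤ := by
    rw [← CotangentSpace.span_image_eq_top_iff, ← Set.range_comp, ← b.span_eq]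
    congr 2
    exact funext hz
  have hmA : maximalIdeal A = Ideal.span (Set.range fun i => (z i : A)) := by
    have := congrArg (Submodule.map (maximalIdeal A).subtype) hspan
    rw [Submodule.map_span, Submodule.map_subtype_top, ← Set.range_comp] at this
    exact this.symm
  have hmB : maximalIdeal B =
      Submodule.span B (((Finset.univ.erase i₀).image fun i => f (z i) : Finset B) : Set B) := by
    refine (map_maximalIdeal_of_surjective f hf).symm.trans
      ((congrArg (Ideal.map f) hmA).trans ?_)
    rw [Ideal.map_span]
    refine le_antisymm (Submodule.span_le.2 ?_) (Submodule.span_mono ?_)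
    · rintro _ ⟨_, ⟨i, rfl⟩, rfl⟩
      by_cases h : i = i₀
      · subst h
        simp [z, hfx]
      · exact Submodule.subset_span (by
          simp only [Finset.coe_image, Set.mem_image]
          exact ⟨i, by simp [h], rfl⟩)
    · intro w hw
      simp only [Finset.coe_image, Set.mem_image] at hw
      obtain ⟨i, -, rfl⟩ := hw
      exact ⟨_, ⟨i, rfl⟩, rfl⟩
  have h1 : (maximalIdeal B).spanFinrank ≤ (Finset.univ.erase i₀).card := by
    rw [hmB]
    refine (Submodule.spanFinrank_span_le_ncard_of_finite (Finset.finite_toSet _)).trans ?_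
    rw [Set.ncard_coe_finset]
    exact Finset.card_image_le
  rw [Finset.card_erase_of_mem (Finset.mem_univ _)] at h1
  rw [spanFinrank_maximalIdeal_eq_finrank_cotangentSpace A, Module.finrank_eq_card_basis b]
  have : 0 < Finset.univ.card (α := ↑(hli.extend (Set.subset_univ _))) :=
    Finset.card_pos.2 ⟨i₀, Finset.mem_univ _⟩
  rw [← Finset.card_univ]
  omega

theorem spanFinrank_maximalIdeal_le_of_surjective {B : Type*} [CommRing B] [IsLocalRing B]
    {f : A →+* B} (hf : Function.Surjective f) {x : A} (hx : RingHom.ker f = Ideal.span {x}) :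
    (maximalIdeal A).spanFinrank ≤ (maximalIdeal B).spanFinrank + 1 := by
  classical
  have := isNoetherianRing_of_surjective A B f hf
  obtain ⟨s, hs, hspan⟩ := Submodule.FG.exists_span_finset_card_eq_spanFinrank
    (IsNoetherian.noetherian (maximalIdeal B))
  have := hf.isLocalHom
  have hloc := maximalIdeal_comap f
  choose g hg using hf
  have hmap : Ideal.map f (Ideal.span (g '' s)) = maximalIdeal B := by
    rw [Ideal.map_span, ← Set.image_comp, ← hspan]
    simp [hg, Ideal.span]
  have hmA : maximalIdeal A = Submodule.span A ((insert x (s.image g) : Finset A) : Set A) := by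
    rw [← hloc, ← hmap, Ideal.comap_map_of_surjective f fun b => ⟨g b, hg b⟩,
      ← RingHom.ker_eq_comap_bot, hx, sup_comm, Finset.coe_insert, Finset.coe_image]
    exact (Submodule.span_insert _ _).symm
  rw [hmA, ← hs]
  refine (Submodule.spanFinrank_span_le_ncard_of_finite (Finset.finite_toSet _)).trans ?_
  rw [Set.ncard_coe_finset]
  exact (Finset.card_insert_le _ _).trans (Nat.add_le_add_right Finset.card_image_le 1)

/-- The embedding dimension drops by exactly one and the Krull dimension by at most one, so equality
of the two is inherited. -/
theorem isRegularLocalRing_quotient_span_singleton {B : Type u} [CommRing B] [IsRegularLocalRing B] {x : B}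
    (hx : x ∈ maximalIdeal B) (hx2 : x ∉ maximalIdeal B ^ 2)
    [IsLocalRing (B ⧸ Ideal.span {x})] :
    IsRegularLocalRing (B ⧸ Ideal.span {x}) ∧
      (maximalIdeal (B ⧸ Ideal.span {x})).spanFinrank + 1 = (maximalIdeal B).spanFinrank := by
  have h1 := spanFinrank_maximalIdeal_lt_of_surjective (B := B ⧸ Ideal.span {x})
    Ideal.Quotient.mk_surjective hx hx2
    (Ideal.Quotient.eq_zero_iff_mem.2 (Ideal.mem_span_singleton_self x))
  have h2 := spanFinrank_maximalIdeal_le_of_surjective (B := B ⧸ Ideal.span {x})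
    Ideal.Quotient.mk_surjective Ideal.mk_ker
  refine ⟨IsRegularLocalRing.of_spanFinrank_maximalIdeal_le _ ?_, by omega⟩
  have h3 := ringKrullDim_le_ringKrullDim_quotient_add_encard (R := B) {x}
    (by simpa [ringJacobson_eq_maximalIdeal] using hx)
  rw [Set.encard_singleton, ← IsRegularLocalRing.spanFinrank_maximalIdeal] at h3
  have h4 : (((maximalIdeal (B ⧸ Ideal.span {x})).spanFinrank + 1 : ℕ) : WithBot ℕ∞) ≤
      ringKrullDim (B ⧸ Ideal.span {x}) + 1 := le_trans (by exact_mod_cast h1) h3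
  rw [Nat.cast_add, Nat.cast_one] at h4
  exact (ENat.WithBot.add_le_add_one_right_iff).1 h4

/-- Induction on the embedding dimension. Choose `x` in the maximal ideal, outside its square and
outside all minimal primes. By induction `(x)` is prime, so it contains a minimal prime `p`; since
`x ∉ p`, every element of `p` is `x` times an element of `p`, and `p = 0` by Nakayama. -/
theorem IsRegularLocalRing.isDomain (B : Type u) [CommRing B] [hB : IsRegularLocalRing B] :
    IsDomain B := by
  generalize hn : (maximalIdeal B).spanFinrank = n
  induction n generalizing B with
  | zero =>
    rw [Submodule.spanFinrank_eq_zero_iff_eq_bot (IsNoetherian.noetherian _)] at hn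
    exact (isField_iff_maximalIdeal_eq.2 hn).isDomain
  | succ n ih =>
    have hm : maximalIdeal B ≠ ⊥ := fun h => by
      rw [← Submodule.spanFinrank_eq_zero_iff_eq_bot (IsNoetherian.noetherian _)] at h
      omega
    have hfin := minimalPrimes.finite_of_isNoetherianRing B
    obtain ⟨x, hx, hx2, hxP⟩ := exists_mem_maximalIdeal_notMem_sq hfin.toFinset
      (fun p hp => (hfin.mem_toFinset.1 hp).1.1) (fun p hp hle => by
        have hp := hfin.mem_toFinset.1 hp
        have := hp.1.1
        have heq := (maximalIdeal.isMaximal B).eq_of_le this.ne_top hle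
        subst heq
        have h0 := maximalIdeal_height_eq_ringKrullDim (R := B)
        rw [Ideal.height_eq_zero_iff.2 hp, ← IsRegularLocalRing.spanFinrank_maximalIdeal, hn] at h0
        exact absurd h0 (by exact_mod_cast Nat.succ_ne_zero n |>.symm)) hm
    have := isLocalRing_quotient_span_singleton hx
    obtain ⟨hreg, hrk⟩ := isRegularLocalRing_quotient_span_singleton hx hx2
    have hdom := ih (B ⧸ Ideal.span {x}) (by omega)
    rw [Ideal.Quotient.isDomain_iff_prime] at hdom
    obtain ⟨p, hp, hpx⟩ := Ideal.exists_minimalPrimes_le (bot_le (a := Ideal.span {x}))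
    have hpp := hp.1.1
    have hxp := hxP p (hfin.mem_toFinset.2 hp)
    have hpbot : p = ⊥ := by
      refine Submodule.eq_bot_of_le_smul_of_le_jacobson_bot (maximalIdeal B) _
          (IsNoetherian.noetherian _) (fun y hy => ?_) (maximalIdeal_le_jacobson _)
      obtain ⟨a, rfl⟩ := Ideal.mem_span_singleton'.1 (hpx hy)
      rw [mul_comm]
      exact Submodule.smul_mem_smul hx ((hpp.mem_or_mem hy).resolve_right hxp)
    rw [hpbot] at hpp
    exact IsDomain.of_bot_isPrime B

end RegularLocalRing

/-! ### Regularity and finite projective dimension: both directions of Serre's theorem -/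

section RegularLocalRing

open IsLocalRing TensorProduct

variable {A : Type u} [CommRing A] {M N : Type u} [AddCommGroup M] [Module A M] [AddCommGroup N]
  [Module A N]

theorem PdLT.pi {n r : ℕ} (h : PdLT A N n) : PdLT A (Fin r → N) n := by
  induction r with
  | zero => exact (pdLT_zero_iff.2 inferInstance).mono (Nat.zero_le n)
  | succ r ih =>
    exact PdLT.of_equiv (PdLT.middle LinearMap.inl_injective Function.Exact.inl_snd
      LinearMap.snd_surjective h ih : PdLT A (N × (Fin r → N)) n)
      (Fin.consLinearEquiv A fun _ => N)

/-- A module with a generating family of length `r` which is annihilated by `J` is a quotient of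
`(A / J) ^ r`. -/
theorem exists_linearMap_pi_quotient {J : Ideal A} (hJ : ∀ a ∈ J, ∀ y : M, a • y = 0) {r : ℕ}
    (x : Fin r → M) : ∃ g : (Fin r → A ⧸ J) →ₗ[A] M,
      ∀ a : Fin r → A, g (fun i => Ideal.Quotient.mk J (a i)) = ∑ i, a i • x i := by
  let f : Fin r → (A ⧸ J) →ₗ[A] M := fun i =>
    Submodule.liftQ J (LinearMap.toSpanSingleton A M (x i)) fun a ha => hJ a ha _
  refine ⟨LinearMap.lsum A _ A f, fun a => ?_⟩
  rw [LinearMap.lsum_apply, LinearMap.sum_apply]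
  rfl

/-- Dividing by a regular element of the maximal ideal raises the projective dimension by one, so a
bound on the quotient also bounds `M`. -/
theorem PdLT.of_quotSMulTop [IsLocalRing A] [IsNoetherianRing A] [Module.Finite A M] {x : A}
    (hreg : IsSMulRegular M x) (hx : x ∈ maximalIdeal A) {n : ℕ}
    (h : PdLT A (QuotSMulTop x M) n) : PdLT A M n := by
  have h1 := ModuleCat.projectiveDimension_quotSMulTop_eq_succ_of_isSMulRegular (ModuleCat.of A M)
    x hreg hx
  have h2 := projectiveDimension_lt_iff.2 h
  rw [h1] at h2
  exact projectiveDimension_lt_iff.1 (lt_of_le_of_lt (le_add_of_nonneg_right zero_le_one) h2)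

/-- Working with `A`-modules killed by `J` keeps the ring fixed while the embedding dimension of `A
/ J` is lowered by induction. If it is zero, `M` is a finite power of the field `A / J`. Otherwise
let `x` lift an element of the maximal ideal of `A / J` outside its square. The kernel `K` of a
cover of `M` by copies of the domain `A / J` is `x`-torsion-free, and `K / xK` is killed by `J +
(x)`, whose quotient is again regular. So finiteness passes from `K / xK` to `K` and then to `M`. -/
theorem exists_pdLT_of_isRegularLocalRing_quotient [IsLocalRing A] [IsNoetherianRing A]
    (J : Ideal A) [hJ : IsRegularLocalRing (A ⧸ J)] (hpd : ∃ n, PdLT A (A ⧸ J) n)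
    [Module.Finite A M] (hM : ∀ a ∈ J, ∀ y : M, a • y = 0) : ∃ n, PdLT A M n := by
  generalize hn : (maximalIdeal (A ⧸ J)).spanFinrank = n
  induction n generalizing J M with
  | zero =>
    rw [Submodule.spanFinrank_eq_zero_iff_eq_bot (IsNoetherian.noetherian _)] at hn
    obtain ⟨r, x, -, hspan, hmin⟩ := exists_minimal_generators (R := A) (M := M) (H := Set.univ) (by
      obtain ⟨r, x, hx⟩ := Module.Finite.exists_fin (R := A) (M := M)
      exact ⟨r, x, fun _ => trivial, hx⟩)
    obtain ⟨g, hg⟩ := exists_linearMap_pi_quotient hM x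
    obtain ⟨k, hk⟩ := hpd
    refine ⟨k, hk.pi.of_equiv (LinearEquiv.ofBijective g ⟨?_, ?_⟩)⟩
    · rw [injective_iff_map_eq_zero]
      intro b hb
      choose a ha using fun i => Ideal.Quotient.mk_surjective (b i)
      obtain rfl : (fun i => Ideal.Quotient.mk J (a i)) = b := funext ha
      rw [hg] at hb
      funext i
      have h1 : ¬ IsUnit (Ideal.Quotient.mk J (a i)) := fun hu =>
        hmin a hb i ((Ideal.Quotient.mk_surjective.isLocalHom).map_nonunit _ hu)
      rw [← mem_nonunits_iff, ← mem_maximalIdeal, hn] at h1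
      exact h1
    · intro y
      obtain ⟨a, rfl⟩ := (Submodule.mem_span_range_iff_exists_fun A).1
        (hspan ▸ Submodule.mem_top : y ∈ Submodule.span A (Set.range x))
      exact ⟨_, hg a⟩
  | succ n ih =>
    have hdom := IsRegularLocalRing.isDomain (A ⧸ J)
    have hm : maximalIdeal (A ⧸ J) ≠ ⊥ := fun h => by
      rw [← Submodule.spanFinrank_eq_zero_iff_eq_bot (IsNoetherian.noetherian _)] at h
      omega
    obtain ⟨y, hy, hy2, -⟩ := exists_mem_maximalIdeal_notMem_sq (A := A ⧸ J) ∅ (by simp) (by simp) hm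
    obtain ⟨x, rfl⟩ := Ideal.Quotient.mk_surjective y
    have hx : x ∈ maximalIdeal A := fun hu => hy (hu.map _)
    have hx0 : Ideal.Quotient.mk J x ≠ 0 := fun h => hy2 (h ▸ zero_mem _)
    have hreg : ∀ (b : A ⧸ J), x • b = 0 → b = 0 := fun b hb => by
      rw [Algebra.smul_def] at hb
      exact (mul_eq_zero.1 hb).resolve_left hx0
    have := isLocalRing_quotient_span_singleton hy
    obtain ⟨hreg', hrk⟩ := isRegularLocalRing_quotient_span_singleton hy hy2
    let J' := J ⊔ Ideal.span {x}
    let e : ((A ⧸ J) ⧸ Ideal.span {Ideal.Quotient.mk J x}) ≃+* A ⧸ J' :=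
      (Ideal.quotEquivOfEq (by rw [Ideal.map_span, Set.image_singleton])).trans
        (DoubleQuot.quotQuotEquivQuotSup J (Ideal.span {x}))
    have hJ' : IsRegularLocalRing (A ⧸ J') := IsRegularLocalRing.of_ringEquiv e
    have hrk' : (maximalIdeal (A ⧸ J')).spanFinrank = n := by
      have := Ideal.spanFinrank_map_eq_of_ringEquiv e
        (maximalIdeal ((A ⧸ J) ⧸ Ideal.span {Ideal.Quotient.mk J x}))
      rw [map_ringEquiv_maximalIdeal] at this
      omega
    have hpd' : ∃ n, PdLT A (A ⧸ J') n := by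
      obtain ⟨k, hk⟩ := hpd
      refine ⟨k + 1, PdLT.right (f := LinearMap.lsmul A (A ⧸ J) x)
        (g := Submodule.factor (le_sup_left : J ≤ J')) ?_ ?_ ?_ hk (hk.mono (Nat.le_succ k))⟩
      · rw [injective_iff_map_eq_zero]
        exact hreg
      · intro b
        obtain ⟨a, rfl⟩ := Ideal.Quotient.mk_surjective b
        change Ideal.Quotient.mk J' a = 0 ↔ _
        rw [Ideal.Quotient.eq_zero_iff_mem, Submodule.mem_sup]
        constructor
        · rintro ⟨j, hj, z, hz, rfl⟩
          obtain ⟨c, rfl⟩ := Ideal.mem_span_singleton'.1 hz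
          refine ⟨Ideal.Quotient.mk J c, ?_⟩
          rw [map_add, Ideal.Quotient.eq_zero_iff_mem.2 hj, zero_add, mul_comm]
          rfl
        · rintro ⟨c, hc⟩
          obtain ⟨c, rfl⟩ := Ideal.Quotient.mk_surjective c
          have hc : Ideal.Quotient.mk J (x * c) = Ideal.Quotient.mk J a := hc
          rw [Ideal.Quotient.eq] at hc
          exact ⟨a - x * c, by rw [← neg_sub]; exact neg_mem hc, x * c,
            Ideal.mem_span_singleton'.2 ⟨c, mul_comm _ _⟩, by ring⟩
      · exact Submodule.factor_surjective _
    obtain ⟨r, z, hz⟩ := Module.Finite.exists_fin (R := A) (M := M)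
    obtain ⟨g, hg⟩ := exists_linearMap_pi_quotient hM z
    have hgs : Function.Surjective g := by
      intro y
      obtain ⟨a, rfl⟩ := (Submodule.mem_span_range_iff_exists_fun A).1
        (hz ▸ Submodule.mem_top : y ∈ Submodule.span A (Set.range z))
      exact ⟨_, hg a⟩
    let K := LinearMap.ker g
    have hKreg : IsSMulRegular K x := by
      intro k l hkl
      refine Subtype.ext (funext fun i => sub_eq_zero.1 (hreg _ ?_))
      rw [smul_sub, sub_eq_zero]
      exact congrFun (congrArg Subtype.val hkl) i
    obtain ⟨k, hk⟩ := ih (M := QuotSMulTop x K) J' hpd' (by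
      intro a ha
      obtain ⟨j, hj, c, hc, rfl⟩ := Submodule.mem_sup.1 ha
      obtain ⟨c, rfl⟩ := Ideal.mem_span_singleton'.1 hc
      intro y
      obtain ⟨y, rfl⟩ := Submodule.Quotient.mk_surjective _ y
      rw [← Submodule.Quotient.mk_smul, Submodule.Quotient.mk_eq_zero, add_smul]
      refine add_mem ?_ ?_
      · have : j • y = 0 := Subtype.ext (funext fun i => by
          obtain ⟨w, hw⟩ := Ideal.Quotient.mk_surjective (y.1 i)
          change j • y.1 i = 0
          rw [← hw, Algebra.smul_def]
          change Ideal.Quotient.mk J j * _ = 0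
          rw [Ideal.Quotient.eq_zero_iff_mem.2 hj, zero_mul])
        rw [this]
        exact zero_mem _
      · rw [mul_comm, mul_smul]
        exact Submodule.smul_mem_pointwise_smul _ _ _ trivial) hrk'
    obtain ⟨l, hl⟩ := hpd
    refine ⟨max k l + 1, PdLT.right (f := K.subtype) (g := g) Subtype.val_injective
      (LinearMap.exact_subtype_ker_map g) hgs ((hk.of_quotSMulTop hKreg hx).mono (le_max_left _ _))
      (hl.pi.mono (by omega))⟩

theorem IsRegularLocalRing.exists_pdLT [IsRegularLocalRing A] [Module.Finite A M] :
    ∃ n, PdLT A M n := by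
  let e : A ≃+* A ⧸ (⊥ : Ideal A) := (RingEquiv.quotientBot A).symm
  have := IsRegularLocalRing.of_ringEquiv e
  refine exists_pdLT_of_isRegularLocalRing_quotient ⊥ ⟨1, PdLT.of_equiv (M := A)
    (pdLT_one_iff.2 inferInstance) (Submodule.quotEquivOfEqBot ⊥ rfl).symm⟩ ?_
  rintro a rfl y
  exact zero_smul _ _

theorem Module.exists_minimal_cover [IsLocalRing A] [IsNoetherianRing A] [Module.Finite A M] :
    ∃ (r : ℕ) (g : (Fin r → A) →ₗ[A] M), Function.Surjective g ∧
      LinearMap.ker g ≤ maximalIdeal A • ⊤ := by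
  obtain ⟨r, x, -, hspan, hmin⟩ := exists_minimal_generators (R := A) (M := M) (H := Set.univ) (by
    obtain ⟨r, x, hx⟩ := Module.Finite.exists_fin (R := A) (M := M)
    exact ⟨r, x, fun _ => trivial, hx⟩)
  refine ⟨r, Fintype.linearCombination A x, ?_, fun a ha => ?_⟩
  · rw [← LinearMap.range_eq_top, Fintype.range_linearCombination, hspan]
  · rw [LinearMap.mem_ker, Fintype.linearCombination_apply] at ha
    rw [← (Pi.basisFun A (Fin r)).sum_repr a]
    exact sum_mem fun i _ => Submodule.smul_mem_smul (hmin a ha i) trivial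

/-- Over a local ring of depth zero, finitely generated modules of finite projective dimension are
free. -/
theorem free_of_pdLT [IsLocalRing A] [IsNoetherianRing A] [Module.Finite A M] {s : A} (hs : s ≠ 0)
    (hsm : ∀ a ∈ maximalIdeal A, a * s = 0) {n : ℕ} (h : PdLT A M n) : Module.Free A M := by
  induction n generalizing M with
  | zero =>
    rw [pdLT_zero_iff] at h
    infer_instance
  | succ n ih =>
    obtain ⟨r, g, hg, hmin⟩ := Module.exists_minimal_cover (A := A) (M := M)
    have hK := PdLT.ker_of_minimal (f := (LinearMap.ker g).subtype) Subtype.val_injective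
      (LinearMap.exact_subtype_ker_map g) hg (by rwa [Submodule.range_subtype]) h
    have hfree := ih hK
    -- By minimality the kernel lies in `mF`, which `s` kills. The kernel is free by induction, and
    -- a nonzero free module is faithful, so it vanishes.
    have hs0 : ∀ x : Fin r → A, x ∈ maximalIdeal A • (⊤ : Submodule A (Fin r → A)) → s • x = 0 := by
      intro x hx
      induction hx using Submodule.smul_induction_on' with
      | smul a ha x _ => rw [smul_smul, mul_comm, hsm a ha, zero_smul]
      | add x _ y _ hx hy => rw [smul_add, hx, hy, add_zero]
    have hker : LinearMap.ker g = ⊥ := by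
      by_contra hne
      have := Submodule.nontrivial_iff_ne_bot.2 hne
      have hann : s ∈ Module.annihilator A (LinearMap.ker g) :=
        Module.mem_annihilator.2 fun y => Subtype.ext (hs0 _ (hmin y.2))
      rw [Module.annihilator_eq_bot.2 inferInstance] at hann
      exact hs hann
    exact Module.Free.of_equiv (LinearEquiv.ofBijective g ⟨LinearMap.ker_eq_bot.1 hker, hg⟩)

/-- Reduction modulo an element which is regular on the ring and on the module does not increase the
projective dimension. -/
theorem PdLT.quotient_tensor {x : A} (hx : IsSMulRegular A x) (hxM : IsSMulRegular M x) {n : ℕ}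
    (h : PdLT A M n) : PdLT (A ⧸ Ideal.span {x}) ((A ⧸ Ideal.span {x}) ⊗[A] M) n := by
  induction n generalizing M with
  | zero =>
    rw [pdLT_zero_iff] at h ⊢
    infer_instance
  | succ n ih =>
    -- The projective case is separate: the dimension shift to a syzygy needs the free cover to
    -- satisfy the lower bound, which must therefore be at least 1.
    cases n with
    | zero =>
      rw [zero_add, pdLT_one_iff] at h ⊢
      infer_instance
    | succ n =>
      obtain ⟨F, _, _, g, hproj, hregF, hg⟩ : ∃ (F : Type u) (_ : AddCommGroup F) (_ : Module A F)
          (g : F →ₗ[A] M), Module.Projective A F ∧ IsSMulRegular F x ∧ Function.Surjective g :=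
        ⟨M →₀ A, inferInstance, inferInstance, Finsupp.linearCombination A (id : M → M),
          inferInstance, fun a b hab => Finsupp.ext fun i => hx (DFunLike.congr_fun hab i),
          Finsupp.linearCombination_id_surjective A M⟩
      have hex := LinearMap.exact_subtype_ker_map g
      have hK := PdLT.left Subtype.val_injective hex hg
        ((pdLT_one_iff.2 inferInstance).mono (by omega)) h
      have hregK : IsSMulRegular (LinearMap.ker g) x := fun a b hab => Subtype.ext
        (hregF (congrArg Subtype.val hab))
      -- This is the vanishing of the first Tor of `A / x` with `M`, which holds because `x` is
      -- regular on `M`.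
      have hinj : Function.Injective ((LinearMap.ker g).subtype.baseChange (A ⧸ Ideal.span {x})) := by
        have h1 := QuotSMulTop.map_first_exact_on_four_term_exact_of_isSMulRegular_last
          (f₁ := (0 : PUnit →ₗ[A] LinearMap.ker g)) (f₂ := (LinearMap.ker g).subtype) (f₃ := g)
          (r := x) ?_ hex hxM
        · have h2 := QuotSMulTop.equivQuotTensor_naturality x (LinearMap.ker g).subtype
          rw [injective_iff_map_eq_zero]
          intro y hy
          obtain ⟨z, rfl⟩ := (QuotSMulTop.equivQuotTensor x (LinearMap.ker g)).surjective y
          have h3 := (LinearMap.congr_fun h2 z).trans hy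
          obtain ⟨w, rfl⟩ := (h1 z).1 ((QuotSMulTop.equivQuotTensor x F).map_eq_zero_iff.1 h3)
          rw [map_zero, LinearMap.zero_apply, map_zero]
        · exact (LinearMap.exact_zero_iff_injective PUnit _).2 Subtype.val_injective
      refine PdLT.right (g := g.baseChange (A ⧸ Ideal.span {x})) hinj ?_ (LinearMap.lTensor_surjective _ hg) (ih hregK hK)
        ((pdLT_one_iff.2 inferInstance).mono (by omega))
      exact lTensor_exact _ hex hg

/-- If the maximal ideal were contained in an associated prime, the depth would be zero and
`free_of_pdLT` would make the residue field free, hence faithful, contradicting `hm`. So prime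
avoidance applies to the associated primes. -/
theorem exists_nonZeroDivisor_of_pdLT_residueField [IsLocalRing A] [IsNoetherianRing A] {n : ℕ}
    (h : PdLT A (ResidueField A) n) (hm : maximalIdeal A ≠ ⊥) :
    ∃ x ∈ maximalIdeal A, x ∉ maximalIdeal A ^ 2 ∧ x ∈ nonZeroDivisors A := by
  have hfin := associatedPrimes.finite A A
  obtain ⟨x, hx, hx2, hxP⟩ := exists_mem_maximalIdeal_notMem_sq hfin.toFinset
    (fun p hp => (isAssociatedPrime_iff.1 (hfin.mem_toFinset.1 hp)).1) (by
      intro p hp hle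
      obtain ⟨hprime, s, rfl⟩ := isAssociatedPrime_iff.1 (hfin.mem_toFinset.1 hp)
      have hs : s ≠ 0 := by
        rintro rfl
        exact hprime.ne_top (by simp)
      have hfree := free_of_pdLT hs (fun a ha => by simpa using hle ha) h
      refine hm (eq_bot_iff.2 fun a ha => ?_)
      rw [← Module.annihilator_eq_bot.2 (inferInstance : FaithfulSMul A (ResidueField A)),
        Module.mem_annihilator]
      intro y
      rw [Algebra.smul_def, ResidueField.algebraMap_eq, (residue_eq_zero_iff a).2 ha, zero_mul]) hm
  refine ⟨x, hx, hx2, ?_⟩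
  by_contra hx0
  have : x ∈ ((nonZeroDivisors A : Set A))ᶜ := hx0
  rw [← biUnion_associatedPrimes_eq_compl_nonZeroDivisors] at this
  simp only [Set.mem_iUnion] at this
  obtain ⟨p, hp, hxp⟩ := this
  exact hxP p (hfin.mem_toFinset.2 hp) hxp

/-- Over `B = A / x` the residue field is a retract of `B ⊗ m`: it embeds by sending 1 to the class
of `x`, and the functional with value 1 at `x` splits this. The bound for `B ⊗ m` is
`PdLT.quotient_tensor`. -/
theorem PdLT.residueField_quotient [IsLocalRing A] [IsNoetherianRing A] {n : ℕ}
    (h : PdLT A (maximalIdeal A) n) {x : A} (hx : x ∈ maximalIdeal A)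
    (hx2 : x ∉ maximalIdeal A ^ 2) (hx0 : x ∈ nonZeroDivisors A)
    [IsLocalRing (A ⧸ Ideal.span {x})] :
    PdLT (A ⧸ Ideal.span {x}) (ResidueField (A ⧸ Ideal.span {x})) n := by
  let B := A ⧸ Ideal.span {x}
  have hreg : IsSMulRegular A x := fun a b hab => by
    have h1 : (a - b) * x = 0 := by
      rw [mul_comm, mul_sub, sub_eq_zero]
      exact hab
    exact sub_eq_zero.1 ((mem_nonZeroDivisors_iff_right.1 hx0) _ h1)
  have hregm : IsSMulRegular (maximalIdeal A) x := fun a b hab => Subtype.ext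
    (hreg (congrArg Subtype.val hab))
  obtain ⟨φ, hφ⟩ := exists_linearMap_residueField hx hx2
  let i₀ : B →ₗ[B] B ⊗[A] maximalIdeal A := LinearMap.toSpanSingleton B _ (1 ⊗ₜ ⟨x, hx⟩)
  -- For `a` in the maximal ideal, `a • x = x • a` inside it, and `x` acts as zero on `B`; hence the
  -- map factors through the residue field.
  let i : ResidueField B →ₗ[B] B ⊗[A] maximalIdeal A := Submodule.liftQ _ i₀ (by
    intro b hb
    obtain ⟨a, rfl⟩ := Ideal.Quotient.mk_surjective b
    have ha : a ∈ maximalIdeal A := fun hu => hb (hu.map _)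
    have h1 : Ideal.Quotient.mk (Ideal.span {x}) a = a • (1 : B) := by
      rw [Algebra.smul_def, mul_one]
      rfl
    have h2 : a • (⟨x, hx⟩ : maximalIdeal A) = x • ⟨a, ha⟩ := Subtype.ext (mul_comm _ _)
    have h3 : x • (1 : B) = 0 := by
      rw [Algebra.smul_def, mul_one]
      exact Ideal.Quotient.eq_zero_iff_mem.2 (Ideal.mem_span_singleton_self x)
    rw [LinearMap.mem_ker, LinearMap.toSpanSingleton_apply, h1, TensorProduct.smul_tmul',
      smul_eq_mul, smul_mul_assoc, mul_one, TensorProduct.smul_tmul, h2, ← TensorProduct.smul_tmul,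
      h3, TensorProduct.zero_tmul])
  let ψ : ResidueField A →ₗ[A] ResidueField B := Submodule.liftQ _
    (Algebra.linearMap A (ResidueField B)) (by
      intro a ha
      rw [LinearMap.mem_ker, Algebra.linearMap_apply,
        IsScalarTower.algebraMap_apply A B (ResidueField B)]
      have := Ideal.Quotient.mk_surjective (I := Ideal.span {x}).isLocalHom
      exact (residue_eq_zero_iff _).2 fun hu => ha (this.map_nonunit _ hu))
  have hψ : ψ 1 = 1 := map_one (algebraMap A (ResidueField B))
  refine (PdLT.quotient_tensor hreg hregm h).of_retract i
    (LinearMap.liftBaseChange B (ψ ∘ₗ φ)) (LinearMap.ext fun y => ?_)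
  obtain ⟨b, rfl⟩ := residue_surjective y
  have h1 : i (residue B b) = b ⊗ₜ ⟨x, hx⟩ := by
    change b • ((1 : B) ⊗ₜ[A] (⟨x, hx⟩ : maximalIdeal A)) = _
    rw [TensorProduct.smul_tmul', smul_eq_mul, mul_one]
  rw [LinearMap.comp_apply, h1, LinearMap.liftBaseChange_tmul, LinearMap.comp_apply, hφ, hψ,
    Algebra.smul_def, mul_one]
  rfl

/-- **Serre's theorem**: a Noetherian local ring whose residue field has finite projective dimension
is regular. -/
theorem isRegularLocalRing_of_pdLT_residueField (A : Type u) [CommRing A] [IsLocalRing A]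
    [IsNoetherianRing A] {n : ℕ} (h : PdLT A (ResidueField A) n) : IsRegularLocalRing A := by
  obtain ⟨d, hd⟩ : ∃ d : ℕ, ringKrullDim A = d := by
    rw [← maximalIdeal_height_eq_ringKrullDim]
    obtain ⟨d, hd⟩ := ENat.ne_top_iff_exists.1 (Ideal.height_ne_top
      (maximalIdeal.isMaximal A).ne_top)
    exact ⟨d, by rw [← hd]; rfl⟩
  induction d generalizing A n with
  | zero =>
    by_cases hm : maximalIdeal A = ⊥
    · refine IsRegularLocalRing.of_spanFinrank_maximalIdeal_le _ ?_
      rw [hm, Submodule.spanFinrank_bot, hd]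
    -- A nonzerodivisor in the maximal ideal would give a quotient of dimension -1, although that
    -- quotient is nontrivial.
    · obtain ⟨x, hx, -, hx0⟩ := exists_nonZeroDivisor_of_pdLT_residueField h hm
      have h1 := ringKrullDim_quotient_span_singleton_succ_eq_ringKrullDim_of_mem_nonZeroDivisors
        hx0 hx
      have := isLocalRing_quotient_span_singleton hx
      have h2 := ringKrullDim_nonneg_of_nontrivial (R := A ⧸ Ideal.span {x})
      rw [hd] at h1
      have h3 := add_le_add_left h2 1
      rw [h1, zero_add] at h3
      exact absurd h3 (by decide)
  | succ d ih =>
    have hm : maximalIdeal A ≠ ⊥ := fun hm => by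
      have := isField_iff_maximalIdeal_eq.2 hm
      rw [ringKrullDim_eq_zero_of_isField this] at hd
      exact absurd hd (by exact_mod_cast (Nat.succ_ne_zero d).symm)
    obtain ⟨x, hx, hx2, hx0⟩ := exists_nonZeroDivisor_of_pdLT_residueField h hm
    have h1 := ringKrullDim_quotient_span_singleton_succ_eq_ringKrullDim_of_mem_nonZeroDivisors
      hx0 hx
    have := isLocalRing_quotient_span_singleton hx
    -- The bound is not sharp. The induction is on the dimension, so only finiteness matters, and `n
    -- + 1` avoids treating `n = 0` apart.
    have hmpd : PdLT A (maximalIdeal A) (n + 1) := PdLT.left (f := (maximalIdeal A).subtype)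
      (g := (maximalIdeal A).mkQ) Subtype.val_injective (LinearMap.exact_subtype_mkQ _)
      (Submodule.mkQ_surjective _) ((pdLT_one_iff.2 inferInstance).mono (by omega))
      (h.mono (by omega))
    have hd' : ringKrullDim (A ⧸ Ideal.span {x}) = d := by
      rw [hd, Nat.cast_add, Nat.cast_one] at h1
      exact le_antisymm (ENat.WithBot.add_le_add_one_right_iff.1 h1.le)
        (ENat.WithBot.add_le_add_one_right_iff.1 h1.ge)
    have hreg := ih _ (hmpd.residueField_quotient hx hx2 hx0) hd'
    refine IsRegularLocalRing.of_spanFinrank_maximalIdeal_le _ ?_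
    have h2 := spanFinrank_maximalIdeal_le_of_surjective (B := A ⧸ Ideal.span {x})
      Ideal.Quotient.mk_surjective Ideal.mk_ker
    rw [hd]
    have h3 := hreg.spanFinrank_maximalIdeal
    rw [hd'] at h3
    have h3 : (maximalIdeal (A ⧸ Ideal.span {x})).spanFinrank = d := by exact_mod_cast h3
    exact_mod_cast h3 ▸ h2

end RegularLocalRing

/-! ### Graded modules: projections, constructions, minimal homogeneous generators -/

theorem DirectSum.isInternal_of_proj {X : Type*} [AddCommGroup X] {G : ℤ → AddSubgroup X}
    (p : ℤ → X →+ X) (h₁ : ∀ n, ∀ x ∈ G n, p n x = x)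
    (h₂ : ∀ m n, m ≠ n → ∀ x ∈ G m, p n x = 0) (h₃ : ∀ x, x ∈ ⨆ n, G n) :
    DirectSum.IsInternal G := by
  classical
  constructor
  · have key : ∀ (y : DirectSum ℤ fun n => G n) n, p n (DirectSum.coeAddMonoidHom G y) = y n := by
      intro y n
      induction y using DirectSum.induction_on with
      | zero => simp
      | of i x =>
        rw [DirectSum.coeAddMonoidHom_of]
        by_cases h : i = n
        · subst h
          rw [DirectSum.of_eq_same, h₁ _ _ x.2]
        · rw [DirectSum.of_eq_of_ne _ _ _ (Ne.symm h), h₂ _ _ h _ x.2]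
          rfl
      | add x y hx hy => rw [map_add, map_add, hx, hy, DirectSum.add_apply, AddSubgroup.coe_add]
    intro y z hyz
    exact DFinsupp.ext fun n => Subtype.ext (by rw [← key, ← key, hyz])
  · intro x
    have h : ⨆ n, G n ≤ (DirectSum.coeAddMonoidHom G).range :=
      iSup_le fun n x hx => ⟨DirectSum.of _ n ⟨x, hx⟩, DirectSum.coeAddMonoidHom_of _ _ _⟩
    exact h (h₃ x)

namespace GrMod

variable {R : Type u} [CommRing R] {𝒜 : ℤ → AddSubgroup R}

/-- The projection of a graded module to its component of degree `n`. -/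
noncomputable def proj (M : GrMod 𝒜) (n : ℤ) : M.carrier →+ M.carrier :=
  (M.grading n).subtype.comp ((DFinsupp.evalAddMonoidHom n).comp
    (AddEquiv.ofBijective _ M.isInternal).symm.toAddMonoidHom)

variable {M N : GrMod 𝒜}

theorem proj_mem (n : ℤ) (x : M.carrier) : M.proj n x ∈ M.grading n := SetLike.coe_mem _

theorem proj_coeAddMonoidHom (n : ℤ) (y : DirectSum ℤ fun n => M.grading n) :
    M.proj n (DirectSum.coeAddMonoidHom M.grading y) = y n :=
  congrArg (fun z : DirectSum ℤ fun n => M.grading n => (z n : M.carrier))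
    ((AddEquiv.ofBijective _ M.isInternal).symm_apply_apply y)

theorem proj_of_mem {n : ℤ} {x : M.carrier} (hx : x ∈ M.grading n) : M.proj n x = x := by
  classical
  have := proj_coeAddMonoidHom n (DirectSum.of (fun n => M.grading n) n ⟨x, hx⟩)
  rwa [DirectSum.coeAddMonoidHom_of, DirectSum.of_eq_same] at this

theorem proj_of_mem_ne {m n : ℤ} (h : m ≠ n) {x : M.carrier} (hx : x ∈ M.grading m) :
    M.proj n x = 0 := by
  classical
  have := proj_coeAddMonoidHom n (DirectSum.of (fun n => M.grading n) m ⟨x, hx⟩)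
  rwa [DirectSum.coeAddMonoidHom_of, DirectSum.of_eq_of_ne _ _ _ (Ne.symm h)] at this

theorem mem_of_proj_mem (H : AddSubgroup M.carrier) {x : M.carrier}
    (h : ∀ n, M.proj n x ∈ H) : x ∈ H := by
  classical
  obtain ⟨y, rfl⟩ := M.isInternal.2 x
  simp only [proj_coeAddMonoidHom] at h
  rw [← DirectSum.sum_support_of y, map_sum]
  exact sum_mem fun n _ => by rw [DirectSum.coeAddMonoidHom_of]; exact h n

@[elab_as_elim]
theorem induction {p : M.carrier → Prop} (x : M.carrier) (zero : p 0)
    (add : ∀ x y, p x → p y → p (x + y)) (hom : ∀ n, ∀ x ∈ M.grading n, p x) : p x := by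
  classical
  obtain ⟨y, rfl⟩ := M.isInternal.2 x
  induction y using DirectSum.induction_on with
  | zero => rwa [map_zero]
  | of n x => rw [DirectSum.coeAddMonoidHom_of]; exact hom n x x.2
  | add x y hx hy => rw [map_add]; exact add _ _ hx hy

/-- The degree `k` covers differentials (`k = -1`), multiplication by a homogeneous element, and
graded maps (`k = 0`). -/
theorem map_proj {f : M.carrier →+ N.carrier} {k : ℤ}
    (hf : ∀ n, ∀ x ∈ M.grading n, f x ∈ N.grading (n + k)) (n : ℤ) (x : M.carrier) :
    f (M.proj n x) = N.proj (n + k) (f x) := by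
  induction x using GrMod.induction with
  | zero => simp
  | add x y hx hy => simp only [map_add, hx, hy]
  | hom m x hx =>
    by_cases h : m = n
    · subst h
      rw [proj_of_mem hx, proj_of_mem (hf _ _ hx)]
    · rw [proj_of_mem_ne h hx, proj_of_mem_ne (by omega) (hf _ _ hx), map_zero]

/-- A submodule stable under the projections is a graded module. -/
noncomputable abbrev ofSubmodule (M : GrMod 𝒜) (p : Submodule R M.carrier)
    (hp : ∀ n, ∀ x ∈ p, M.proj n x ∈ p) : GrMod 𝒜 where
  carrier := p
  grading n := (M.grading n).comap p.subtype.toAddMonoidHom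
  isInternal := by
    refine DirectSum.isInternal_of_proj
      (fun n => ((M.proj n).comp p.subtype.toAddMonoidHom).codRestrict p fun x => hp n _ x.2)
      (fun n x hx => Subtype.ext (proj_of_mem hx))
      (fun m n h x hx => Subtype.ext (proj_of_mem_ne h hx)) fun x => ?_
    have : (x : M.carrier) ∈ (⨆ n, (M.grading n).comap p.subtype.toAddMonoidHom).map
        p.subtype.toAddMonoidHom :=
      mem_of_proj_mem _ fun n => ⟨⟨_, hp n x x.2⟩, AddSubgroup.mem_iSup_of_mem n (proj_mem n _), rfl⟩
    obtain ⟨y, hy, hxy⟩ := this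
    rwa [← Subtype.ext hxy]
  smul_mem hr hx := M.smul_mem hr hx

theorem proj_ofSubmodule (p : Submodule R M.carrier) (hp : ∀ n, ∀ x ∈ p, M.proj n x ∈ p) (n : ℤ)
    (x : p) : (((M.ofSubmodule p hp).proj n x : p) : M.carrier) = M.proj n x := by
  have := map_proj (M := M.ofSubmodule p hp) (N := M) (f := p.subtype.toAddMonoidHom) (k := 0)
    (fun n x hx => (add_zero n).symm ▸ hx) n x
  rwa [add_zero] at this

/-- The shift of a graded module: an element of degree `n` has degree `n + k` in the shift. -/
abbrev shift (M : GrMod 𝒜) (k : ℤ) : GrMod 𝒜 where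
  carrier := M.carrier
  grading n := M.grading (n - k)
  isInternal := DirectSum.isInternal_of_proj (fun n => M.proj (n - k))
    (fun _ _ hx => proj_of_mem hx) (fun _ _ h _ hx => proj_of_mem_ne (by omega) hx) fun x => by
      induction x using GrMod.induction with
      | zero => exact zero_mem _
      | add x y hx hy => exact add_mem hx hy
      | hom n x hx => exact AddSubgroup.mem_iSup_of_mem (n + k) (by rwa [add_sub_cancel_right])
  smul_mem {i j r x} hr hx := by
    rw [add_sub_assoc]
    exact M.smul_mem hr hx

/-- The product of two graded modules. -/
abbrev prod (M N : GrMod 𝒜) : GrMod 𝒜 where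
  carrier := M.carrier × N.carrier
  grading n := (M.grading n).prod (N.grading n)
  isInternal := DirectSum.isInternal_of_proj (fun n => (M.proj n).prodMap (N.proj n))
    (fun _ _ hx => Prod.ext (proj_of_mem hx.1) (proj_of_mem hx.2))
    (fun _ _ h _ hx => Prod.ext (proj_of_mem_ne h hx.1) (proj_of_mem_ne h hx.2)) fun x => by
      obtain ⟨x, y⟩ := x
      have hx : (x, (0 : N.carrier)) ∈ ⨆ n, (M.grading n).prod (N.grading n) := by
        induction x using GrMod.induction with
        | zero => exact zero_mem _
        | add x y hx hy => simpa using add_mem hx hy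
        | hom n x hx => exact AddSubgroup.mem_iSup_of_mem n ⟨hx, zero_mem _⟩
      have hy : ((0 : M.carrier), y) ∈ ⨆ n, (M.grading n).prod (N.grading n) := by
        induction y using GrMod.induction with
        | zero => exact zero_mem _
        | add x y hx hy => simpa using add_mem hx hy
        | hom n x hx => exact AddSubgroup.mem_iSup_of_mem n ⟨zero_mem _, hx⟩
      simpa using add_mem hx hy
  smul_mem hr hx := ⟨M.smul_mem hr hx.1, N.smul_mem hr hx.2⟩

variable [GradedRing 𝒜]

variable (𝒜) in
/-- The ring as a graded module over itself. -/
abbrev ring : GrMod 𝒜 where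
  carrier := R
  grading := 𝒜
  isInternal := DirectSum.Decomposition.isInternal 𝒜
  smul_mem hr hx := SetLike.mul_mem_graded hr hx

variable (𝒜) in
/-- The free graded module on generators of prescribed degrees. -/
abbrev free {r : ℕ} (deg : Fin r → ℤ) : GrMod 𝒜 where
  carrier := Fin r → R
  grading n := AddSubgroup.pi Set.univ fun i => 𝒜 (n - deg i)
  isInternal := DirectSum.isInternal_of_proj
    (fun n => AddMonoidHom.pi fun i => ((ring 𝒜).proj (n - deg i)).comp (Pi.evalAddMonoidHom _ i))
    (fun n x hx => funext fun i => proj_of_mem (M := ring 𝒜) (hx i trivial))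
    (fun m n h x hx => funext fun i => proj_of_mem_ne (M := ring 𝒜) (by omega) (hx i trivial))
    fun x => by
      classical
      rw [← Finset.univ_sum_single x]
      refine sum_mem fun i _ => ?_
      generalize x i = a
      induction a using GrMod.induction (M := ring 𝒜) with
      | zero => simp
      | add a b ha hb => rw [Pi.single_add]; exact add_mem ha hb
      | hom n a ha =>
        refine AddSubgroup.mem_iSup_of_mem (n + deg i) fun j _ => ?_
        by_cases h : j = i
        · subst h
          simpa using ha
        · simp [h]
  smul_mem {i j r x} hr hx l _ := by
    change r * x l ∈ 𝒜 (i + j - deg l)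
    rw [add_sub_assoc]
    exact SetLike.mul_mem_graded hr (hx l trivial)

theorem single_mem_free {r : ℕ} (deg : Fin r → ℤ) (i : Fin r) :
    (Pi.single i 1 : Fin r → R) ∈ (free 𝒜 deg).grading (deg i) := by
  intro j _
  by_cases h : j = i
  · subst h
    simpa using SetLike.GradedOne.one_mem
  · simp [h]

theorem isFiniteFree_free {r : ℕ} (deg : Fin r → ℤ) : (free 𝒜 deg).IsFiniteFree :=
  ⟨r, Pi.basisFun R (Fin r), fun i => ⟨deg i, by
    rw [Pi.basisFun_apply]
    exact single_mem_free deg i⟩⟩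

/-- The homomorphism from a free graded module sending the generators to given elements of the
right degrees. -/
noncomputable def freeHom {r : ℕ} {deg : Fin r → ℤ} {z : Fin r → M.carrier}
    (hz : ∀ i, z i ∈ M.grading (deg i)) : Hom (free 𝒜 deg) M where
  toLinearMap := Fintype.linearCombination R z
  map_mem {n x} hx := by
    rw [Fintype.linearCombination_apply]
    exact sum_mem fun i _ => sub_add_cancel n (deg i) ▸ M.smul_mem (hx i trivial) (hz i)

/-- A homogeneous nonunit generates a proper homogeneous ideal. This replaces the usual property of
local rings and is available for homogeneous elements only. -/
theorem mem_of_not_isUnit (m : HomogeneousIdeal 𝒜) [hm : IsLocalGraded 𝒜 m] {i : ℤ} {r : R}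
    (hr : r ∈ 𝒜 i) (hu : ¬ IsUnit r) : r ∈ m.toIdeal :=
  hm.le_of_ne_top ⟨Ideal.span {r}, Ideal.homogeneous_span 𝒜 _ (by simpa using ⟨i, hr⟩)⟩
    (by rwa [Ne, Ideal.span_singleton_eq_top]) (Ideal.mem_span_singleton_self r)

/-- A finitely generated graded quotient of a graded module over a local graded ring is minimally
generated by the images of finitely many homogeneous elements. -/
theorem exists_minimal_generators (m : HomogeneousIdeal 𝒜) [IsLocalGraded 𝒜 m] {N : Type*}
    [AddCommGroup N] [Module R N] [Module.Finite R N] (π : M.carrier →ₗ[R] N)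
    (hπ : Function.Surjective π) (hker : ∀ x, π x = 0 → ∀ n, π (M.proj n x) = 0) :
    ∃ (r : ℕ) (deg : Fin r → ℤ) (z : Fin r → M.carrier), (∀ i, z i ∈ M.grading (deg i)) ∧
      Submodule.span R (Set.range fun i => π (z i)) = ⊤ ∧
      ∀ a : Fin r → R, ∑ i, a i • π (z i) = 0 → ∀ i, a i ∈ m.toIdeal := by
  classical
  let H : Set N := {y | ∃ n, ∃ z ∈ M.grading n, π z = y}
  have hH : Submodule.span R H = ⊤ := by
    rw [eq_top_iff]
    rintro y -
    obtain ⟨x, rfl⟩ := hπ y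
    induction x using GrMod.induction with
    | zero => rw [map_zero]; exact zero_mem _
    | add x y hx hy => rw [map_add]; exact add_mem hx hy
    | hom n x hx => exact Submodule.subset_span ⟨n, x, hx, rfl⟩
  obtain ⟨r, y, hy, hspan, hmin⟩ := _root_.exists_minimal_generators (R := R) (H := H) (by
    obtain ⟨s, hsH, hs⟩ := (Submodule.fg_span_iff_fg_span_finset_subset H).1
      (hH ▸ Module.Finite.fg_top)
    refine ⟨s.card, fun i => s.equivFin.symm i, fun i => hsH (s.equivFin.symm i).2, ?_⟩
    rw [← hH, hs]
    congr 1
    ext y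
    constructor
    · rintro ⟨i, rfl⟩
      exact (s.equivFin.symm i).2
    · intro hy
      exact ⟨s.equivFin ⟨y, hy⟩, by simp⟩)
  choose deg z hz hzy using hy
  obtain rfl : (fun i => π (z i)) = y := funext hzy
  refine ⟨r, deg, z, hz, hspan, fun a ha i => ?_⟩
  refine mem_of_proj_mem (M := ring 𝒜) m.toIdeal.toAddSubgroup fun j => ?_
  refine mem_of_not_isUnit m (proj_mem (M := ring 𝒜) j (a i)) ?_
  -- The component of degree `j + deg i` of the relation is again a relation, by homogeneity of the
  -- kernel. Its `i`-th coefficient is the degree `j` component of `a i`, which is therefore a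
  -- homogeneous nonunit.
  have hterm : ∀ l, (ring 𝒜).proj (j + deg i - deg l) (a l) • z l =
      M.proj (j + deg i) (a l • z l) := fun l => by
    have := map_proj (M := ring 𝒜) (N := M)
      (f := ((LinearMap.toSpanSingleton R M.carrier (z l)).toAddMonoidHom)) (k := deg l)
      (fun n x hx => M.smul_mem hx (hz l)) (j + deg i - deg l) (a l)
    rwa [sub_add_cancel] at this
  have h0 := hmin (fun l => (ring 𝒜).proj (j + deg i - deg l) (a l)) (by
    have h1 := hker (∑ l, a l • z l) (by simpa using ha) (j + deg i)
    rw [map_sum, map_sum] at h1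
    rw [← h1]
    exact Finset.sum_congr rfl fun l _ => by rw [← hterm l, map_smul]) i
  simpa using h0

end GrMod

/-! ### Quasi-isomorphisms, cones and homotopies of DG modules -/

namespace DGMod

variable {R : Type u} [CommRing R] {𝒜 : ℤ → AddSubgroup R} {M N P X Y : DGMod 𝒜}

theorem quasiIso_iff (f : M ⟶ N) : quasiIso 𝒜 f ↔
    (∀ z, N.d z = 0 → ∃ x, M.d x = 0 ∧ ∃ w, Hom.toLinearMap f x = z + N.d w) ∧
      ∀ x, M.d x = 0 → ∀ w, Hom.toLinearMap f x = N.d w → ∃ y, M.d y = x := by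
  constructor
  · rintro ⟨hinj, hsurj⟩
    constructor
    · intro z hz
      obtain ⟨x, hx⟩ := hsurj (Submodule.Quotient.mk ⟨z, hz⟩)
      obtain ⟨x, rfl⟩ := Submodule.Quotient.mk_surjective _ x
      obtain ⟨w, hw⟩ := (Submodule.Quotient.eq _).1 hx
      exact ⟨x, x.2, w, (sub_eq_iff_eq_add'.1 hw.symm)⟩
    · intro x hx w hw
      have h0 : homologyMap f (Submodule.Quotient.mk ⟨x, hx⟩) = 0 :=
        (Submodule.Quotient.mk_eq_zero _).2 ⟨w, hw.symm⟩
      obtain ⟨y, hy⟩ := (Submodule.Quotient.mk_eq_zero _).1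
        (hinj (h0.trans (map_zero _).symm))
      exact ⟨y, hy⟩
  · rintro ⟨hsurj, hinj⟩
    constructor
    · rw [injective_iff_map_eq_zero]
      intro x hx
      obtain ⟨x, rfl⟩ := Submodule.Quotient.mk_surjective _ x
      obtain ⟨w, hw⟩ := (Submodule.Quotient.mk_eq_zero _).1 hx
      obtain ⟨y, hy⟩ := hinj x x.2 w hw.symm
      exact (Submodule.Quotient.mk_eq_zero _).2 ⟨y, hy⟩
    · intro z
      obtain ⟨z, rfl⟩ := Submodule.Quotient.mk_surjective _ z
      obtain ⟨x, hx, w, hw⟩ := hsurj z z.2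
      exact ⟨Submodule.Quotient.mk ⟨x, hx⟩, (Submodule.Quotient.eq _).2 ⟨w, sub_eq_iff_eq_add'.2 hw |>.symm⟩⟩

/-- A DG module is acyclic if its homology vanishes. -/
def IsAcyclic (C : DGMod 𝒜) : Prop := ∀ x, C.d x = 0 → ∃ y, C.d y = x

theorem d_proj (n : ℤ) (x : M.carrier) : M.d (M.proj n x) = M.proj (n - 1) (M.d x) :=
  GrMod.map_proj (M := M.toGrMod) (N := M.toGrMod) (f := M.d.toAddMonoidHom) (k := -1)
    (fun _ _ hx => M.d_mem hx) n x

theorem IsAcyclic.exists_mem (hC : M.IsAcyclic) {n : ℤ} {x : M.carrier} (hx : x ∈ M.grading n)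
    (h : M.d x = 0) : ∃ y ∈ M.grading (n + 1), M.d y = x := by
  obtain ⟨y, rfl⟩ := hC x h
  refine ⟨M.proj (n + 1) y, GrMod.proj_mem _ _, ?_⟩
  rw [d_proj, add_sub_cancel_right, GrMod.proj_of_mem hx]

/-- The path object of a DG module. -/
abbrev path (X : DGMod 𝒜) : DGMod 𝒜 where
  toGrMod := X.prod (X.prod (X.shift (-1)))
  d := (X.d ∘ₗ LinearMap.fst R _ _).prod ((X.d ∘ₗ LinearMap.fst R _ _ ∘ₗ LinearMap.snd R _ _).prod
    (LinearMap.fst R _ _ - LinearMap.fst R _ _ ∘ₗ LinearMap.snd R _ _ -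
      X.d ∘ₗ LinearMap.snd R _ _ ∘ₗ LinearMap.snd R _ _))
  d_mem {n x} hx := by
    refine ⟨X.d_mem hx.1, X.d_mem hx.2.1, ?_⟩
    have h1 : X.d x.2.2 ∈ X.grading (n - -1 - 1) := X.d_mem hx.2.2
    change x.1 - x.2.1 - X.d x.2.2 ∈ X.grading (n - 1 - -1)
    rw [sub_neg_eq_add, add_sub_cancel_right] at h1
    rw [sub_neg_eq_add, sub_add_cancel]
    exact sub_mem (sub_mem hx.1 hx.2.1) h1
  d_d x := by
    refine Prod.ext (X.d_d _) (Prod.ext (X.d_d _) ?_)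
    simp [X.d_d]

/-- The mapping cone of a morphism of DG modules. -/
abbrev cone (f : M ⟶ N) : DGMod 𝒜 where
  toGrMod := N.prod (M.shift 1)
  d := (N.d ∘ₗ LinearMap.fst R _ _ + Hom.toLinearMap f ∘ₗ LinearMap.snd R _ _).prod
    (-(M.d ∘ₗ LinearMap.snd R _ _))
  d_mem hx := ⟨add_mem (N.d_mem hx.1) (Hom.map_mem f hx.2), neg_mem (M.d_mem hx.2)⟩
  d_d x := by
    refine Prod.ext ?_ ?_
    · simp [N.d_d, Hom.map_d f]
    · simp [M.d_d]

/-- The desuspension of a DG module. -/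
abbrev desuspension (M : DGMod 𝒜) : DGMod 𝒜 where
  toGrMod := M.shift (-1)
  d := -M.d
  d_mem {n x} hx := by
    have h : n - 1 - -1 = n - -1 - 1 := by ring
    change -M.d x ∈ M.grading (n - 1 - -1)
    rw [h]
    exact neg_mem (M.d_mem hx)
  d_d x := by simp [M.d_d]

theorem IsAcyclic.desuspension (hC : M.IsAcyclic) : M.desuspension.IsAcyclic := fun x hx => by
  obtain ⟨y, hy⟩ := hC x (neg_eq_zero.1 hx)
  exact ⟨-y, by simpa using hy⟩

theorem isAcyclic_cone {f : M ⟶ N} (hf : quasiIso 𝒜 f) : (cone f).IsAcyclic := by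
  rw [quasiIso_iff] at hf
  rintro ⟨y, x⟩ h
  have h1 : N.d y + Hom.toLinearMap f x = 0 := congrArg Prod.fst h
  have h2 : M.d x = 0 := neg_eq_zero.1 (congrArg Prod.snd h)
  obtain ⟨x', hx'⟩ := hf.2 x h2 (-y) (by rw [map_neg, eq_neg_of_add_eq_zero_right h1])
  obtain ⟨z, hz, w, hw⟩ := hf.1 (y + Hom.toLinearMap f x') (by
    rw [map_add, ← Hom.map_d f, hx', h1])
  refine ⟨(-w, z - x'), Prod.ext ?_ ?_⟩
  · change N.d (-w) + Hom.toLinearMap f (z - x') = y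
    rw [map_neg, map_sub, hw]
    abel
  · simp [hz, hx']

/-- Homotopy of morphisms of DG modules. -/
def Homotopic (f g : M ⟶ N) : Prop :=
  ∃ h : M.carrier →ₗ[R] N.carrier, (∀ n, ∀ x ∈ M.grading n, h x ∈ N.grading (n + 1)) ∧
    ∀ x, Hom.toLinearMap f x = Hom.toLinearMap g x + (N.d (h x) + h (M.d x))

theorem Homotopic.refl (f : M ⟶ N) : Homotopic f f := ⟨0, fun _ _ _ => zero_mem _, by simp⟩

theorem Homotopic.symm {f g : M ⟶ N} (H : Homotopic f g) : Homotopic g f := by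
  obtain ⟨h, hdeg, hh⟩ := H
  exact ⟨-h, fun n x hx => neg_mem (hdeg n x hx), fun x => by
    rw [hh]
    simp only [LinearMap.neg_apply, map_neg]
    abel⟩

theorem Homotopic.trans {f g k : M ⟶ N} (H : Homotopic f g) (H' : Homotopic g k) :
    Homotopic f k := by
  obtain ⟨h, hdeg, hh⟩ := H
  obtain ⟨h', hdeg', hh'⟩ := H'
  exact ⟨h + h', fun n x hx => add_mem (hdeg n x hx) (hdeg' n x hx), fun x => by
    rw [hh, hh']
    simp only [LinearMap.add_apply, map_add]
    abel⟩

theorem Homotopic.comp_right {f g : M ⟶ N} (H : Homotopic f g) (k : N ⟶ X) :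
    Homotopic (f ≫ k) (g ≫ k) := by
  obtain ⟨h, hdeg, hh⟩ := H
  refine ⟨Hom.toLinearMap k ∘ₗ h, fun n x hx => Hom.map_mem k (hdeg n x hx), fun x => ?_⟩
  change Hom.toLinearMap k (Hom.toLinearMap f x) = Hom.toLinearMap k (Hom.toLinearMap g x) +
    (X.d (Hom.toLinearMap k (h x)) + Hom.toLinearMap k (h (M.d x)))
  rw [hh, map_add, map_add, Hom.map_d k]

/-- Homotopic morphisms become equal in the derived category. -/
theorem Homotopic.Q_map_eq {f g : M ⟶ N} (H : Homotopic f g) : (Q 𝒜).map f = (Q 𝒜).map g := by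
  obtain ⟨h, hdeg, hh⟩ := H
  -- The constant-path map `i` is a quasi-isomorphism and a common section of both end-point
  -- projections, so these agree in the derived category. A homotopy is a morphism `k` to the path
  -- object with end points `f` and `g`.
  let i : N ⟶ path N :=
    { toLinearMap := LinearMap.id.prod (LinearMap.id.prod 0)
      map_mem := fun hx => ⟨hx, hx, zero_mem _⟩
      map_d := fun x => by simp }
  let p₀ : path N ⟶ N :=
    { toLinearMap := LinearMap.fst R _ _
      map_mem := fun hx => hx.1
      map_d := fun x => rfl }
  let p₁ : path N ⟶ N :=
    { toLinearMap := LinearMap.fst R _ _ ∘ₗ LinearMap.snd R _ _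
      map_mem := fun hx => hx.2.1
      map_d := fun x => rfl }
  let k : M ⟶ path N :=
    { toLinearMap := (Hom.toLinearMap f).prod ((Hom.toLinearMap g).prod h)
      map_mem := fun {n x} hx => ⟨Hom.map_mem f hx, Hom.map_mem g hx, by
        change h x ∈ N.grading (n - -1)
        rw [sub_neg_eq_add]
        exact hdeg n x hx⟩
      map_d := fun x => by
        refine Prod.ext (Hom.map_d f x) (Prod.ext (Hom.map_d g x) ?_)
        change h (M.d x) = Hom.toLinearMap f x - Hom.toLinearMap g x - N.d (h x)
        rw [hh]
        abel }
  have hi : quasiIso 𝒜 i := by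
    rw [quasiIso_iff]
    constructor
    · rintro ⟨a, b, c⟩ hz
      have h1 : N.d a = 0 := congrArg Prod.fst hz
      have h3 : a - b - N.d c = 0 := congrArg (fun z => z.2.2) hz
      refine ⟨a, h1, (0, c, 0), ?_⟩
      refine Prod.ext ?_ (Prod.ext ?_ ?_)
      · change a = a + N.d 0
        rw [map_zero, add_zero]
      · change a = b + N.d c
        rw [← sub_eq_zero.1 h3, add_sub_cancel]
      · change 0 = c + (0 - c - N.d 0)
        rw [map_zero]
        abel
    · rintro x - ⟨a, b, c⟩ hw
      exact ⟨a, (congrArg Prod.fst hw).symm⟩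
  have : IsIso ((Q 𝒜).map i) := Localization.inverts (Q 𝒜) (quasiIso 𝒜) i hi
  have h01 : (Q 𝒜).map p₀ = (Q 𝒜).map p₁ := by
    rw [← cancel_epi ((Q 𝒜).map i), ← Functor.map_comp, ← Functor.map_comp]
    rfl
  have hf : f = k ≫ p₀ := rfl
  have hg : g = k ≫ p₁ := rfl
  rw [hf, hg, Functor.map_comp, Functor.map_comp, h01]

end DGMod

/-! ### Homotopically projective DG modules and derived morphisms out of them -/

namespace DGMod

variable {R : Type u} [CommRing R] {𝒜 : ℤ → AddSubgroup R} {M N P X Y : DGMod 𝒜}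

/-- A DG module is homotopically projective if all morphisms from it to acyclic DG modules are
null-homotopic. -/
def IsKProjective (P : DGMod 𝒜) : Prop :=
  ∀ (C : DGMod 𝒜), C.IsAcyclic → ∀ f : P ⟶ C, ∃ h : P.carrier →ₗ[R] C.carrier,
    (∀ n, ∀ x ∈ P.grading n, h x ∈ C.grading (n + 1)) ∧
      ∀ x, C.d (h x) + h (P.d x) = Hom.toLinearMap f x

/-- Compose `f` with the inclusion of `Y` in the acyclic cone of `s`. The second component of a
null-homotopy is the lift, and its first component is the homotopy. -/
theorem IsKProjective.exists_lift (hP : P.IsKProjective) {s : X ⟶ Y} (hs : quasiIso 𝒜 s)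
    (f : P ⟶ Y) : ∃ g : P ⟶ X, Homotopic f (g ≫ s) := by
  obtain ⟨h, hdeg, hh⟩ := hP _ (isAcyclic_cone hs)
    { toLinearMap := (Hom.toLinearMap f).prod 0
      map_mem := fun hx => ⟨Hom.map_mem f hx, zero_mem _⟩
      map_d := fun x => by
        refine Prod.ext ?_ ?_
        · change Hom.toLinearMap f (P.d x) = Y.d (Hom.toLinearMap f x) + Hom.toLinearMap s 0
          rw [Hom.map_d f, map_zero, add_zero]
        · change 0 = -X.d 0
          rw [map_zero, neg_zero] }
  refine ⟨{ toLinearMap := LinearMap.snd R _ _ ∘ₗ h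
            map_mem := fun {n x} hx => ?_
            map_d := fun x => ?_ }, LinearMap.fst R _ _ ∘ₗ h, fun n x hx => (hdeg n x hx).1,
            fun x => ?_⟩
  · have h1 : (h x).2 ∈ X.grading (n + 1 - 1) := (hdeg n x hx).2
    rwa [add_sub_cancel_right] at h1
  · have h1 : -X.d (h x).2 + (h (P.d x)).2 = 0 := congrArg Prod.snd (hh x)
    exact (neg_add_eq_zero.1 h1).symm
  · have h1 : Y.d (h x).1 + Hom.toLinearMap s (h x).2 + (h (P.d x)).1 = Hom.toLinearMap f x :=
      congrArg Prod.fst (hh x)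
    change Hom.toLinearMap f x = Hom.toLinearMap s (h x).2 + (Y.d (h x).1 + (h (P.d x)).1)
    rw [← h1]
    abel

/-- With `k` a homotopy between the composites, `(-k, f - g)` is a chain map to the desuspended cone
of `s`. The second component of a null-homotopy of it is the required homotopy. -/
theorem IsKProjective.homotopic_of_comp (hP : P.IsKProjective) {s : X ⟶ Y} (hs : quasiIso 𝒜 s)
    {f g : P ⟶ X} (H : Homotopic (f ≫ s) (g ≫ s)) : Homotopic f g := by
  obtain ⟨k, kdeg, hk⟩ := H
  have hk : ∀ x, Hom.toLinearMap s (Hom.toLinearMap f x) =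
    Hom.toLinearMap s (Hom.toLinearMap g x) + (Y.d (k x) + k (P.d x)) := hk
  obtain ⟨h, hdeg, hh⟩ := hP _ (isAcyclic_cone hs).desuspension
    { toLinearMap := (-k).prod (Hom.toLinearMap f - Hom.toLinearMap g)
      map_mem := fun {n x} hx => by
        constructor
        · change -k x ∈ Y.grading (n - -1)
          rw [sub_neg_eq_add]
          exact neg_mem (kdeg n x hx)
        · change Hom.toLinearMap f x - Hom.toLinearMap g x ∈ X.grading (n - -1 - 1)
          rw [sub_neg_eq_add, add_sub_cancel_right]
          exact sub_mem (Hom.map_mem f hx) (Hom.map_mem g hx)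
      map_d := fun x => by
        refine Prod.ext ?_ ?_
        · change -k (P.d x) = -(Y.d (-k x) +
            Hom.toLinearMap s (Hom.toLinearMap f x - Hom.toLinearMap g x))
          rw [map_neg, map_sub, hk]
          abel
        · change Hom.toLinearMap f (P.d x) - Hom.toLinearMap g (P.d x) =
            - -X.d (Hom.toLinearMap f x - Hom.toLinearMap g x)
          rw [Hom.map_d f, Hom.map_d g, map_sub, neg_neg] }
  refine ⟨LinearMap.snd R _ _ ∘ₗ h, fun n x hx => ?_, fun x => ?_⟩
  · have h1 : (h x).2 ∈ X.grading (n + 1 - -1 - 1) := (hdeg n x hx).2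
    rwa [sub_neg_eq_add, add_sub_cancel_right] at h1
  · have h1 : - -X.d (h x).2 + (h (P.d x)).2 = Hom.toLinearMap f x - Hom.toLinearMap g x :=
      congrArg Prod.snd (hh x)
    rw [neg_neg] at h1
    change Hom.toLinearMap f x = Hom.toLinearMap g x + (X.d (h x).2 + (h (P.d x)).2)
    rw [h1, add_sub_cancel]

/-- The setoid of homotopic morphisms. -/
def homotopySetoid (P X : DGMod 𝒜) : Setoid (P ⟶ X) where
  r := Homotopic
  iseqv := ⟨Homotopic.refl, Homotopic.symm, Homotopic.trans⟩

/-- The functor of homotopy classes of morphisms from a DG module. -/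
def homotopyClasses (P : DGMod 𝒜) : DGMod 𝒜 ⥤ Type u where
  obj X := Quotient (homotopySetoid P X)
  map {X Y} k := TypeCat.ofHom (Quotient.map (sa := homotopySetoid P X) (sb := homotopySetoid P Y)
    (fun f => f ≫ k) fun _ _ H => Homotopic.comp_right H k)
  map_id X := by
    ext f
    induction f using Quotient.inductionOn
    rfl
  map_comp k l := by
    ext f
    induction f using Quotient.inductionOn
    rfl

theorem IsKProjective.isInvertedBy (hP : P.IsKProjective) :
    (quasiIso 𝒜).IsInvertedBy (homotopyClasses P) := by
  intro X Y s hs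
  rw [isIso_iff_bijective]
  constructor
  · intro f g
    induction f using Quotient.inductionOn
    induction g using Quotient.inductionOn
    intro h
    exact Quotient.sound (s := homotopySetoid P X)
      (hP.homotopic_of_comp hs (Quotient.exact (s := homotopySetoid P Y) h))
  · intro f
    induction f using Quotient.inductionOn with
    | h f =>
    obtain ⟨g, hg⟩ := hP.exists_lift hs f
    exact ⟨Quotient.mk _ g, Quotient.sound (s := homotopySetoid P Y) hg.symm⟩

/-- Homotopy classes of maps from `P` form a functor that inverts quasi-isomorphisms, hence extends
to the derived category; evaluate the two induced maps on the class of the identity of `P`. -/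
theorem IsKProjective.homotopic_of_Q_map_eq (hP : P.IsKProjective) {f g : P ⟶ X}
    (h : (Q 𝒜).map f = (Q 𝒜).map g) : Homotopic f g := by
  let e := eqToIso (Localization.Construction.fac (homotopyClasses P) hP.isInvertedBy)
  have key : (homotopyClasses P).map f = (homotopyClasses P).map g := by
    rw [← cancel_epi (e.hom.app P), ← e.hom.naturality f, ← e.hom.naturality g, Functor.comp_map,
      Functor.comp_map, h]
  have := ConcreteCategory.congr_hom key (Quotient.mk (homotopySetoid P P) (𝟙 P))
  exact Quotient.exact (s := homotopySetoid P X) this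

/-- The localization is generated by images of morphisms and formal inverses of quasi-isomorphisms.
Being represented by a chain map from `P` is preserved by composition with either kind, the second
by `IsKProjective.exists_lift`. Apply this to the identity of `P` followed by `φ`. -/
theorem IsKProjective.exists_Q_map_eq (hP : P.IsKProjective)
    (φ : (Q 𝒜).obj P ⟶ (Q 𝒜).obj X) : ∃ f : P ⟶ X, (Q 𝒜).map f = φ := by
  let good : ∀ A : Derived 𝒜, ((Q 𝒜).obj P ⟶ A) → Prop := fun A u =>
    ∃ (X : DGMod 𝒜) (f : P ⟶ X) (h : (Q 𝒜).obj X = A), (Q 𝒜).map f ≫ eqToHom h = u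
  let W : MorphismProperty (Derived 𝒜) := fun A B φ => ∀ u, good A u → good B (u ≫ φ)
  -- Objects of the constructed localization correspond bijectively to DG modules, so the equalities
  -- of objects carried by `good` can be eliminated.
  have hinj : ∀ X Y : DGMod 𝒜, (Q 𝒜).obj X = (Q 𝒜).obj Y → X = Y := fun X Y h =>
    (Localization.Construction.objEquiv (quasiIso 𝒜)).injective h
  have : W.IsStableUnderComposition :=
    ⟨fun φ ψ hφ hψ u hu => by
      rw [← Category.assoc]
      exact hψ _ (hφ u hu)⟩
  have htop : W = ⊤ := by
    refine Localization.Construction.morphismProperty_eq_top W ?_ ?_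
    · rintro X Y k _ ⟨X', f, h, rfl⟩
      obtain rfl := hinj _ _ h
      exact ⟨Y, f ≫ k, rfl, by simp⟩
    · rintro X Y s hs _ ⟨Y', f, h, rfl⟩
      obtain rfl := hinj _ _ h
      obtain ⟨g, hg⟩ := hP.exists_lift hs f
      refine ⟨X, g, rfl, ?_⟩
      have h1 : (Q 𝒜).map f = (Q 𝒜).map g ≫ (Localization.Construction.wIso s hs).hom := by
        rw [hg.Q_map_eq, Functor.map_comp]
        rfl
      rw [eqToHom_refl, eqToHom_refl, Category.comp_id, Category.comp_id, h1, Category.assoc,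
        Iso.hom_inv_id, Category.comp_id]
  have hφ : W φ := htop ▸ MorphismProperty.top_apply φ
  obtain ⟨X', f, h, hf⟩ := hφ (𝟙 _) ⟨P, 𝟙 P, rfl, by simp⟩
  obtain rfl := hinj _ _ h
  exact ⟨f, by simpa using hf⟩

theorem IsSmall.of_iso (hM : M.IsSmall) (e : (Q 𝒜).obj M ≅ (Q 𝒜).obj N) : N.IsSmall := by
  intro ι X f
  obtain ⟨s, g, hg⟩ := hM ι X (e.hom ≫ f)
  exact ⟨s, e.inv ≫ g, by rw [Category.assoc, hg, Iso.inv_hom_id_assoc]⟩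

theorem IsSmall.of_quasiIso (hM : M.IsSmall) {f : M ⟶ N} (hf : quasiIso 𝒜 f) : N.IsSmall :=
  hM.of_iso (Localization.Construction.wIso f hf)

/-- The projection of a direct sum to a summand. -/
def directSumComponent {ι : Type u} (X : ι → DGMod 𝒜) (j : ι) : directSum X ⟶ X j where
  toLinearMap := DirectSum.component R ι (fun i => (X i).carrier) j
  map_mem hx := hx j
  map_d _ := rfl

/-- A morphism to a direct sum whose components outside of a finite set vanish factors through the
finite subsum. -/
theorem exists_comp_directSumIncl {ι : Type u} {X : ι → DGMod 𝒜} (s : Finset ι)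
    (f : P ⟶ directSum X)
    (hf : ∀ x, ∀ j ∉ s, Hom.toLinearMap (directSumComponent X j) (Hom.toLinearMap f x) = 0) :
    ∃ g : P ⟶ directSum (fun i : s => X i), g ≫ directSumIncl X s = f := by
  classical
  let F : P.carrier →ₗ[R] DirectSum ι fun i => (X i).carrier := Hom.toLinearMap f
  refine ⟨{ toLinearMap := (DFinsupp.subtypeDomainLinearMap R (fun i => (X i).carrier) (· ∈ s)) ∘ₗ F
            map_mem := fun hx i => Hom.map_mem f hx i
            map_d := fun x => DFinsupp.ext fun i => ?_ }, ?_⟩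
  · exact DFunLike.congr_fun (F := DirectSum ι fun i => (X i).carrier) (Hom.map_d f x) (i : ι)
  · refine Hom.ext (LinearMap.ext fun x => DFinsupp.ext fun j => ?_)
    refine (directSumInclLinear_apply X s _ j).trans ?_
    split_ifs with h
    · rfl
    · exact (hf x j h).symm

/-- A derived morphism is represented by a chain map, and the images of finitely many generators
have finite total support. -/
theorem IsKProjective.isSmall (hP : P.IsKProjective) [hfin : Module.Finite R P.carrier] :
    P.IsSmall := by
  classical
  intro ι X φ
  obtain ⟨f, rfl⟩ := hP.exists_Q_map_eq φ
  let F : P.carrier →ₗ[R] DirectSum ι fun i => (X i).carrier := Hom.toLinearMap f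
  obtain ⟨t, ht⟩ := hfin.fg_top
  let s : Finset ι := t.biUnion fun x => DFinsupp.support (F x)
  obtain ⟨g, hg⟩ := exists_comp_directSumIncl s f (fun x j hj => by
    have hx : x ∈ Submodule.span R (t : Set P.carrier) := ht ▸ Submodule.mem_top
    change F x j = 0
    induction hx using Submodule.span_induction with
    | mem x hx =>
      by_contra h
      exact hj (Finset.mem_biUnion.2 ⟨x, hx, DFinsupp.mem_support_iff.2 h⟩)
    | zero => rw [map_zero]; rfl
    | add x y _ _ hx hy => rw [map_add, DirectSum.add_apply, hx, hy, add_zero]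
    | smul a x _ hx => rw [map_smul, DirectSum.smul_apply, hx, smul_zero])
  exact ⟨s, (Q 𝒜).map g, by rw [← Functor.map_comp, hg]⟩

end DGMod

/-! ### Minimal covers under flat base change to a local ring -/

section BaseChange

open IsLocalRing TensorProduct

variable {R : Type u} [CommRing R] {S : Type u} [CommRing S] [Algebra R S] [IsLocalRing S]
  {I : Ideal R} {K F N : Type u} [AddCommGroup K] [Module R K] [AddCommGroup F] [Module R F]
  [AddCommGroup N] [Module R N]

theorem range_baseChange_le (hI : I.map (algebraMap R S) ≤ maximalIdeal S) {f : K →ₗ[R] F}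
    (hf : LinearMap.range f ≤ I • ⊤) :
    LinearMap.range (f.baseChange S) ≤ maximalIdeal S • (⊤ : Submodule S (S ⊗[R] F)) := by
  rintro _ ⟨t, rfl⟩
  induction t using TensorProduct.induction_on with
  | zero => rw [map_zero]; exact zero_mem _
  | add x y hx hy => rw [map_add]; exact add_mem hx hy
  | tmul s k =>
    rw [LinearMap.baseChange_tmul]
    have h : f k ∈ I • (⊤ : Submodule R F) := hf ⟨k, rfl⟩
    generalize f k = y at h ⊢
    induction h using Submodule.smul_induction_on' with
    | smul a ha y _ =>
      rw [← TensorProduct.smul_tmul, ← algebraMap_smul S a s, ← TensorProduct.smul_tmul']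
      exact Submodule.smul_mem_smul (hI (Ideal.mem_map_of_mem _ ha)) trivial
    | add x _ y _ hx hy => rw [TensorProduct.tmul_add]; exact add_mem hx hy

/-- Flatness keeps the sequence exact, and entries in `I` become entries in the maximal ideal of
`S`. So covers chosen over `R` lower the projective dimension measured over `S`. -/
theorem PdLT.baseChange_ker_of_minimal [Module.Flat R S]
    (hI : I.map (algebraMap R S) ≤ maximalIdeal S) [Module.Projective R F] [Module.Finite R K]
    {f : K →ₗ[R] F} {g : F →ₗ[R] N} (hf : Function.Injective f) (hfg : Function.Exact f g)
    (hg : Function.Surjective g) (hmin : LinearMap.range f ≤ I • ⊤) {n : ℕ}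
    (h : PdLT S (S ⊗[R] N) (n + 1)) : PdLT S (S ⊗[R] K) n :=
  PdLT.ker_of_minimal (f := f.baseChange S) (g := g.baseChange S)
    (Module.Flat.lTensor_preserves_injective_linearMap f hf) (lTensor_exact S hfg hg)
    (LinearMap.lTensor_surjective S hg) (range_baseChange_le hI hmin) h

/-- This stands in for faithful flatness. If `S ⊗ N = 0`, minimality makes the base-changed kernel
vanish as well; then `S ^ r = 0`, so `r = 0`. -/
theorem subsingleton_of_subsingleton_baseChange [Module.Flat R S] [IsNoetherianRing R]
    (hI : I.map (algebraMap R S) ≤ maximalIdeal S) {r : ℕ} {g : (Fin r → R) →ₗ[R] N}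
    (hg : Function.Surjective g) (hmin : LinearMap.ker g ≤ I • ⊤)
    (h : Subsingleton (S ⊗[R] N)) : Subsingleton N := by
  have hK := PdLT.baseChange_ker_of_minimal (n := 0) hI
    (f := (LinearMap.ker g).subtype) Subtype.val_injective
    (LinearMap.exact_subtype_ker_map g) hg (by rwa [Submodule.range_subtype])
    ((pdLT_zero_iff.2 h).mono (Nat.zero_le _))
  rw [pdLT_zero_iff] at hK
  have hex := lTensor_exact S (LinearMap.exact_subtype_ker_map g) hg
  have hF : Subsingleton (S ⊗[R] (Fin r → R)) := by
    refine ⟨fun x y => ?_⟩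
    obtain ⟨k, hk⟩ := (hex (x - y)).1 (Subsingleton.elim _ _)
    rw [Subsingleton.elim k 0, map_zero] at hk
    exact sub_eq_zero.1 hk.symm
  have hS : Subsingleton (Fin r → S) :=
    (TensorProduct.piScalarRight R R S (Fin r)).symm.injective.subsingleton
  have : IsEmpty (Fin r) := ⟨fun i => zero_ne_one (congrFun
    (Subsingleton.elim (0 : Fin r → S) 1) i)⟩
  exact hg.subsingleton

end BaseChange

/-! ### Gluing a resolution of a cone to a free module -/

namespace DGMod

variable {R : Type u} [CommRing R] {𝒜 : ℤ → AddSubgroup R} {M N P X Y : DGMod 𝒜}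

section Extension

variable {f : N ⟶ M} (hN : N.d = 0) (g : P ⟶ cone f)

/-- The extension of `P` by `N` classified by the second component of a morphism from `P` to the
cone of a morphism out of `N`. -/
abbrev extension : DGMod 𝒜 where
  toGrMod := P.prod N.toGrMod
  d := (P.d ∘ₗ LinearMap.fst R _ _).prod
    (-(LinearMap.snd R _ _ ∘ₗ Hom.toLinearMap g ∘ₗ LinearMap.fst R _ _))
  d_mem hx := ⟨P.d_mem hx.1, (N.grading _).neg_mem (Hom.map_mem g hx.1).2⟩
  d_d x := by
    refine Prod.ext (P.d_d _) ?_
    have h1 : (Hom.toLinearMap g (P.d x.1)).2 = -N.d (Hom.toLinearMap g x.1).2 :=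
      congrArg Prod.snd (Hom.map_d g x.1)
    change -(Hom.toLinearMap g (P.d x.1)).2 = 0
    rw [h1, hN, LinearMap.zero_apply, neg_zero, neg_zero]

/-- The morphism from the extension to the target. -/
abbrev extensionHom : extension hN g ⟶ M where
  toLinearMap := LinearMap.fst R _ _ ∘ₗ Hom.toLinearMap g ∘ₗ LinearMap.fst R _ _ +
    Hom.toLinearMap f ∘ₗ LinearMap.snd R _ _
  map_mem hx := add_mem (Hom.map_mem g hx.1).1 (Hom.map_mem f hx.2)
  map_d x := by
    have h1 : (Hom.toLinearMap g (P.d x.1)).1 =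
        M.d (Hom.toLinearMap g x.1).1 + Hom.toLinearMap f (Hom.toLinearMap g x.1).2 :=
      congrArg Prod.fst (Hom.map_d g x.1)
    change (Hom.toLinearMap g (P.d x.1)).1 + Hom.toLinearMap f (-(Hom.toLinearMap g x.1).2) =
      M.d ((Hom.toLinearMap g x.1).1 + Hom.toLinearMap f x.2)
    rw [h1, map_neg, map_add, ← Hom.map_d f, hN, LinearMap.zero_apply, map_zero]
    abel

/-- The extension is the fibre of `P ⟶ cone f ⟶ N[1]`, while the fibre of `cone f ⟶ N[1]` is `M` up
to quasi-isomorphism. The proof is the corresponding five-lemma chase on cycles. -/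
theorem quasiIso_extensionHom (hg : quasiIso 𝒜 g) : quasiIso 𝒜 (extensionHom hN g) := by
  rw [quasiIso_iff] at hg ⊢
  obtain ⟨hsurj, hinj⟩ := hg
  constructor
  · intro z hz
    obtain ⟨p, hp, ⟨w, a⟩, hw⟩ := hsurj (z, 0) (Prod.ext
      (by change M.d z + Hom.toLinearMap f 0 = 0; rw [hz, map_zero, add_zero])
      (by change -N.d 0 = 0; rw [map_zero, neg_zero]))
    have h1 : (Hom.toLinearMap g p).1 = z + (M.d w + Hom.toLinearMap f a) := congrArg Prod.fst hw
    have h2 : (Hom.toLinearMap g p).2 = 0 + -N.d a := congrArg Prod.snd hw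
    rw [hN, LinearMap.zero_apply, neg_zero, add_zero] at h2
    refine ⟨(p, -a), Prod.ext hp ?_, w, ?_⟩
    · change -(Hom.toLinearMap g p).2 = 0
      rw [h2, neg_zero]
    · change (Hom.toLinearMap g p).1 + Hom.toLinearMap f (-a) = z + M.d w
      rw [h1, map_neg]
      abel
  · rintro ⟨p, a⟩ hpa w hw
    have hp : P.d p = 0 := congrArg Prod.fst hpa
    have hp2 : (Hom.toLinearMap g p).2 = 0 := neg_eq_zero.1 (congrArg Prod.snd hpa)
    have hw : (Hom.toLinearMap g p).1 + Hom.toLinearMap f a = M.d w := hw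
    obtain ⟨p', hp'⟩ := hinj p hp (w, -a) (Prod.ext
      (by
        change (Hom.toLinearMap g p).1 = M.d w + Hom.toLinearMap f (-a)
        rw [← hw, map_neg]
        abel)
      (by
        change (Hom.toLinearMap g p).2 = -N.d (-a)
        rw [hp2, hN, LinearMap.zero_apply, neg_zero]))
    -- The primitive `p'` of `p` may have the wrong component in `N`. The discrepancy is a cycle of
    -- the cone, hence homologous to the image of a cycle `q`, and `p' - q` is the corrected
    -- primitive.
    have hcyc : (cone f).d (Hom.toLinearMap g p' - (w, -a)) = 0 := by
      rw [map_sub, ← Hom.map_d g, hp', sub_eq_zero]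
      refine Prod.ext ?_ ?_
      · change (Hom.toLinearMap g p).1 = M.d w + Hom.toLinearMap f (-a)
        rw [← hw, map_neg]
        abel
      · change (Hom.toLinearMap g p).2 = -N.d (-a)
        rw [hp2, hN, LinearMap.zero_apply, neg_zero]
    obtain ⟨q, hq, ⟨w', b⟩, hw'⟩ := hsurj _ hcyc
    have h2 : (Hom.toLinearMap g q).2 = (Hom.toLinearMap g p').2 - -a + -N.d b :=
      congrArg Prod.snd hw'
    refine ⟨(p' - q, 0), Prod.ext ?_ ?_⟩
    · change P.d (p' - q) = p
      rw [map_sub, hp', hq, sub_zero]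
    · change -(Hom.toLinearMap g (p' - q)).2 = a
      rw [map_sub, Prod.snd_sub, h2, hN, LinearMap.zero_apply]
      abel

theorem IsKProjective.extension (hNproj : N.IsKProjective) (hP : P.IsKProjective) :
    (extension hN g).IsKProjective := by
  intro C hC χ
  obtain ⟨k, kdeg, hk⟩ := hNproj C hC
    { toLinearMap := Hom.toLinearMap χ ∘ₗ LinearMap.inr R _ _
      map_mem := fun hx => Hom.map_mem χ ⟨zero_mem _, hx⟩
      map_d := fun x => by
        have h1 : (DGMod.extension hN g).d ((0 : P.carrier), x) = 0 := Prod.ext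
          (map_zero P.d) (by
            change -(Hom.toLinearMap g 0).2 = 0
            rw [map_zero, Prod.snd_zero, neg_zero])
        change Hom.toLinearMap χ (0, N.d x) = C.d (Hom.toLinearMap χ (0, x))
        rw [← Hom.map_d χ, h1, hN, LinearMap.zero_apply]
        rfl }
  have hk : ∀ x, C.d (k x) = Hom.toLinearMap χ (0, x) := fun x => by
    have h0 : N.d x = 0 := by rw [hN, LinearMap.zero_apply]
    have := hk x
    rw [h0, map_zero, add_zero] at this
    exact this
  have hχd : ∀ p a, Hom.toLinearMap χ (P.d p, -(Hom.toLinearMap g p).2) =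
    C.d (Hom.toLinearMap χ (p, a)) := fun p a => Hom.map_d χ (p, a)
  have hsplit : ∀ p a, Hom.toLinearMap χ (p, a) =
      Hom.toLinearMap χ (p, 0) + Hom.toLinearMap χ (0, a) := fun p a => by
    rw [← map_add]
    congr 1
    exact Prod.ext (add_zero _).symm (zero_add _).symm
  have hneg : ∀ a, Hom.toLinearMap χ (0, -a) = -Hom.toLinearMap χ (0, a) := fun a => by
    rw [← hk, ← hk, map_neg, map_neg]
  have hgd : ∀ p, (Hom.toLinearMap g (P.d p)).2 = 0 := fun p => by
    have h1 : (Hom.toLinearMap g (P.d p)).2 = -N.d (Hom.toLinearMap g p).2 :=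
      congrArg Prod.snd (Hom.map_d g p)
    rw [h1, hN, LinearMap.zero_apply, neg_zero]
  -- With `k` contracting `χ` on `N`, the restriction of `χ` to `P` becomes a chain map once `k` of
  -- the twisting term is added. Its null-homotopy `h` and `k` together contract `χ`.
  obtain ⟨h, hdeg, hh⟩ := hP C hC
    { toLinearMap := Hom.toLinearMap χ ∘ₗ LinearMap.inl R _ _ +
        k ∘ₗ LinearMap.snd R _ _ ∘ₗ Hom.toLinearMap g
      map_mem := fun {n x} hx => by
        refine add_mem (Hom.map_mem χ ⟨hx, zero_mem _⟩) ?_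
        have := kdeg (n - 1) _ (Hom.map_mem g hx).2
        rwa [sub_add_cancel] at this
      map_d := fun x => by
        change Hom.toLinearMap χ (P.d x, 0) + k (Hom.toLinearMap g (P.d x)).2 =
          C.d (Hom.toLinearMap χ (x, 0) + k (Hom.toLinearMap g x).2)
        rw [hgd, map_zero, map_add, ← hχd, hk, hsplit _ (-_), hneg]
        abel }
  have hh : ∀ x, C.d (h x) + h (P.d x) =
    Hom.toLinearMap χ (x, 0) + k (Hom.toLinearMap g x).2 := hh
  refine ⟨h ∘ₗ LinearMap.fst R _ _ + k ∘ₗ LinearMap.snd R _ _,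
    fun n x hx => add_mem (hdeg n _ hx.1) (kdeg n _ hx.2), fun x => ?_⟩
  change C.d (h x.1 + k x.2) + (h (P.d x.1) + k (-(Hom.toLinearMap g x.1).2)) =
    Hom.toLinearMap χ (x.1, x.2)
  have h1 := hh x.1
  rw [hsplit, map_add, hk, map_neg, eq_sub_of_add_eq h1]
  abel

/-- The homology of the cone of a morphism from a module with zero differential which is surjective
on homology. -/
theorem nonempty_homology_cone_equiv (f : N ⟶ M) (hN : N.d = 0)
    (hf : ∀ z, M.d z = 0 → ∃ a w, Hom.toLinearMap f a = z + M.d w) :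
    Nonempty ((cone f).Homology ≃ₗ[R] (LinearMap.range M.d).comap (Hom.toLinearMap f)) := by
  -- For a cycle `(x, a)` of the cone, `f a = -d x` is a boundary; `Φ` keeps `a`. When `N` is a free
  -- cover of the homology of `M`, the target is the first syzygy.
  let Φ : LinearMap.ker (cone f).d →ₗ[R] (LinearMap.range M.d).comap (Hom.toLinearMap f) :=
    LinearMap.codRestrict _ (LinearMap.snd R _ _ ∘ₗ (LinearMap.ker (cone f).d).subtype) (by
      rintro ⟨⟨x, a⟩, hx⟩
      have h1 : M.d x + Hom.toLinearMap f a = 0 := congrArg Prod.fst hx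
      exact ⟨-x, by rw [map_neg]; exact neg_eq_of_add_eq_zero_right h1⟩)
  have hΦ : (LinearMap.range (cone f).d).submoduleOf (LinearMap.ker (cone f).d) ≤
      LinearMap.ker Φ := by
    rintro ⟨_, hx⟩ ⟨⟨y, b⟩, rfl⟩
    refine Subtype.ext ?_
    change -N.d b = 0
    rw [hN, LinearMap.zero_apply, neg_zero]
  refine ⟨LinearEquiv.ofBijective (Submodule.liftQ _ Φ hΦ) ⟨?_, ?_⟩⟩
  · rw [injective_iff_map_eq_zero]
    intro y hy
    obtain ⟨⟨⟨x, a⟩, hx⟩, rfl⟩ := Submodule.Quotient.mk_surjective _ y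
    obtain rfl : a = 0 := congrArg Subtype.val hy
    have h1 : M.d x + Hom.toLinearMap f 0 = 0 := congrArg Prod.fst hx
    rw [map_zero, add_zero] at h1
    obtain ⟨a, w, ha⟩ := hf x h1
    refine (Submodule.Quotient.mk_eq_zero _).2 ⟨(-w, a), Prod.ext ?_ ?_⟩
    · change M.d (-w) + Hom.toLinearMap f a = x
      rw [ha, map_neg]
      abel
    · change -N.d a = 0
      rw [hN, LinearMap.zero_apply, neg_zero]
  · rintro ⟨a, w, hw⟩
    refine ⟨Submodule.Quotient.mk ⟨(-w, a), Prod.ext ?_ ?_⟩, rfl⟩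
    · change M.d (-w) + Hom.toLinearMap f a = 0
      rw [← hw, map_neg, neg_add_cancel]
    · change -N.d a = 0
      rw [hN, LinearMap.zero_apply, neg_zero]

end Extension

end DGMod

/-! ### Finite homotopically projective resolutions and the criterion for smallness -/

namespace DGMod

open IsLocalRing TensorProduct

variable {R : Type u} [CommRing R] {𝒜 : ℤ → AddSubgroup R} [GradedRing 𝒜]

/-- Choose homogeneous primitives of the images of the basis vectors. The degree `k` is needed for
the components of a totalization. -/
theorem IsAcyclic.exists_lift_free {C : DGMod 𝒜} (hC : C.IsAcyclic) {r : ℕ} (deg : Fin r → ℤ)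
    {k : ℤ} (f : (Fin r → R) →ₗ[R] C.carrier)
    (hf : ∀ l, ∀ x ∈ (GrMod.free 𝒜 deg).grading l, f x ∈ C.grading (l + k))
    (hd : ∀ x, C.d (f x) = 0) : ∃ h : (Fin r → R) →ₗ[R] C.carrier,
      (∀ l, ∀ x ∈ (GrMod.free 𝒜 deg).grading l, h x ∈ C.grading (l + k + 1)) ∧
        ∀ x, C.d (h x) = f x := by
  choose y hy hdy using fun i => hC.exists_mem (hf _ _ (GrMod.single_mem_free deg i)) (hd _)
  refine ⟨Fintype.linearCombination R y, fun l x hx => ?_, LinearMap.congr_fun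
    (f := C.d ∘ₗ Fintype.linearCombination R y) (g := f) ?_⟩
  · refine (GrMod.freeHom (deg := fun i => deg i + k + 1) hy).map_mem (n := l + k + 1) (x := x)
      fun i hi => ?_
    change (x : Fin r → R) i ∈ 𝒜 (l + k + 1 - (deg i + k + 1))
    rw [add_sub_add_right_eq_sub, add_sub_add_right_eq_sub]
    exact hx i hi
  · refine (Pi.basisFun R (Fin r)).ext fun i => ?_
    rw [LinearMap.comp_apply, Pi.basisFun_apply, Fintype.linearCombination_apply_single, one_smul,
      hdy]

theorem isKProjective_free {r : ℕ} (deg : Fin r → ℤ) :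
    (ofGrMod (GrMod.free 𝒜 deg)).IsKProjective := by
  intro C hC f
  obtain ⟨h, hdeg, hh⟩ := hC.exists_lift_free deg (k := 0) (Hom.toLinearMap f)
    (fun l x hx => (add_zero l).symm ▸ Hom.map_mem f hx)
    (fun x => (Hom.map_d f x).symm.trans (map_zero (Hom.toLinearMap f)))
  refine ⟨h, fun n x hx => ?_, fun x => ?_⟩
  · have := hdeg n x hx
    rwa [add_zero] at this
  · change C.d (h x) + h 0 = _
    rw [map_zero, add_zero]
    exact hh x

variable [IsNoetherianRing R] (m : HomogeneousIdeal 𝒜) [IsLocalGraded 𝒜 m]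
  {S : Type u} [CommRing S] [Algebra R S] [IsLocalRing S] [Module.Flat R S]

/-- A DG module whose homology is finitely generated and has finite projective dimension after base
change to a flat local algebra has a finite homotopically projective resolution. -/
theorem exists_quasiIso_of_pdLT (hS : m.toIdeal.map (algebraMap R S) ≤ maximalIdeal S) (n : ℕ)
    (M : DGMod 𝒜) (hfin : Module.Finite R M.Homology) (h : PdLT S (S ⊗[R] M.Homology) n) :
    ∃ (P : DGMod 𝒜) (g : P ⟶ M), P.IsKProjective ∧ Module.Finite R P.carrier ∧ quasiIso 𝒜 g := by
  have hstab : ∀ n, ∀ x ∈ LinearMap.ker M.d, M.proj n x ∈ LinearMap.ker M.d := fun n x hx => by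
    rw [LinearMap.mem_ker] at hx ⊢
    rw [d_proj, hx, map_zero]
  let Z : GrMod 𝒜 := M.toGrMod.ofSubmodule (LinearMap.ker M.d) hstab
  let π : Z.carrier →ₗ[R] M.Homology := Submodule.mkQ _
  obtain ⟨r, deg, z, hz, hspan, hmin⟩ := GrMod.exists_minimal_generators m (M := Z) π
    (Submodule.mkQ_surjective _) (by
      intro x hx k
      obtain ⟨w, hw⟩ := (Submodule.Quotient.mk_eq_zero _).1 hx
      refine (Submodule.Quotient.mk_eq_zero _).2 ⟨M.proj (k + 1) w, ?_⟩
      rw [d_proj, add_sub_cancel_right, hw]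
      exact (GrMod.proj_ofSubmodule _ hstab k x).symm)
  let L : (Fin r → R) →ₗ[R] M.carrier := Fintype.linearCombination R fun i => (z i).1
  have hL : ∀ a, M.d (L a) = 0 := fun a => by
    rw [Fintype.linearCombination_apply, map_sum]
    exact Finset.sum_eq_zero fun i _ => by rw [map_smul, (z i).2, smul_zero]
  let f : ofGrMod (GrMod.free 𝒜 deg) ⟶ M :=
    { toLinearMap := L
      map_mem := (GrMod.freeHom (M := M.toGrMod) (z := fun i => (z i).1) hz).map_mem
      map_d := fun x => (map_zero L).trans (hL x).symm }
  let g : (Fin r → R) →ₗ[R] M.Homology := Fintype.linearCombination R fun i => π (z i)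
  have hgs : Function.Surjective g := by
    rw [← LinearMap.range_eq_top, Fintype.range_linearCombination, hspan]
  have hgL : ∀ a, g a = Submodule.Quotient.mk ⟨L a, hL a⟩ := by
    intro a
    rw [Fintype.linearCombination_apply]
    simp only [← map_smul]
    rw [← map_sum]
    refine congrArg (Submodule.Quotient.mk) (Subtype.ext ?_)
    refine Eq.trans (map_sum (LinearMap.ker M.d).subtype _ _) ?_
    exact (Fintype.linearCombination_apply R _ a).symm
  have hker : LinearMap.ker g = (LinearMap.range M.d).comap L := by
    ext a
    rw [LinearMap.mem_ker, hgL, Submodule.Quotient.mk_eq_zero]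
    rfl
  have hkerm : LinearMap.ker g ≤ m.toIdeal • ⊤ := by
    intro a ha
    rw [← (Pi.basisFun R (Fin r)).sum_repr a]
    exact sum_mem fun i _ => Submodule.smul_mem_smul (hmin a ha i) trivial
  cases n with
  | zero =>
    have hsub := subsingleton_of_subsingleton_baseChange hS hgs hkerm (pdLT_zero_iff.1 h)
    let e : Fin 0 → ℤ := Fin.elim0
    refine ⟨ofGrMod (GrMod.free 𝒜 e), ⟨0, fun _ => zero_mem _, fun _ => (map_zero M.d).symm⟩,
      isKProjective_free e, inferInstanceAs (Module.Finite R (Fin 0 → R)), ?_⟩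
    have : Subsingleton (ofGrMod (GrMod.free 𝒜 e)).carrier :=
      inferInstanceAs (Subsingleton (Fin 0 → R))
    rw [quasiIso_iff]
    refine ⟨fun x hx => ?_, fun x _ _ _ => ⟨0, Subsingleton.elim _ _⟩⟩
    obtain ⟨w, hw⟩ := (Submodule.Quotient.mk_eq_zero _).1
      (Subsingleton.elim (Submodule.Quotient.mk ⟨x, hx⟩ : M.Homology) 0)
    refine ⟨0, map_zero _, -w, ?_⟩
    rw [map_zero, map_neg, hw]
    exact (add_neg_cancel x).symm
  | succ n =>
    obtain ⟨e⟩ := nonempty_homology_cone_equiv f rfl (fun x hx => by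
      obtain ⟨a, ha⟩ := hgs (Submodule.Quotient.mk ⟨x, hx⟩)
      rw [hgL] at ha
      obtain ⟨w, hw⟩ := (Submodule.Quotient.eq _).1 ha
      exact ⟨a, w, sub_eq_iff_eq_add'.1 hw.symm⟩)
    let e' : LinearMap.ker g ≃ₗ[R] (cone f).Homology := (LinearEquiv.ofEq _ _ hker).trans e.symm
    have hK := PdLT.baseChange_ker_of_minimal (n := n) hS
      (f := (LinearMap.ker g).subtype) Subtype.val_injective
      (LinearMap.exact_subtype_ker_map g) hgs (by rwa [Submodule.range_subtype]) h
    -- The homology of the cone is the syzygy `ker g`, whose base change satisfies the bound `n`. So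
    -- the cone has a finite resolution, and the extension by the free module resolves `M`.
    obtain ⟨P, k, hP, hPfin, hk⟩ := exists_quasiIso_of_pdLT hS n (cone f)
      (Module.Finite.equiv e') (hK.of_equiv (e'.baseChange R S _ _))
    have : Module.Finite R (Fin r → R) := inferInstance
    exact ⟨extension rfl k, extensionHom rfl k, (isKProjective_free deg).extension rfl k hP,
      inferInstanceAs (Module.Finite R (P.carrier × (Fin r → R))), quasiIso_extensionHom rfl k hk⟩

theorem isSmall_of_pdLT (hS : m.toIdeal.map (algebraMap R S) ≤ maximalIdeal S) {n : ℕ}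
    {M : DGMod 𝒜} (hfin : Module.Finite R M.Homology) (h : PdLT S (S ⊗[R] M.Homology) n) :
    M.IsSmall := by
  obtain ⟨P, g, hP, _, hg⟩ := exists_quasiIso_of_pdLT m hS n M hfin h
  exact hP.isSmall.of_quasiIso hg

end DGMod

open scoped DirectSum

/-! ### Minimal graded free resolutions -/

namespace GrMod

variable {R : Type u} [CommRing R] {𝒜 : ℤ → AddSubgroup R} [GradedRing 𝒜]

/-- A finitely generated graded module over a Noetherian local graded ring has a minimal resolution
by finite free graded modules. -/
theorem exists_minimal_resolution [IsNoetherianRing R] (m : HomogeneousIdeal 𝒜)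
    [IsLocalGraded 𝒜 m] (M : GrMod 𝒜) [Module.Finite R M.carrier] :
    ∃ (r : ℕ → ℕ) (deg : ∀ n, Fin (r n) → ℤ)
      (δ : ∀ n, Hom (free 𝒜 (deg (n + 1))) (free 𝒜 (deg n))) (ε : Hom (free 𝒜 (deg 0)) M),
      Function.Surjective ε.toLinearMap ∧ Function.Exact (δ 0).toLinearMap ε.toLinearMap ∧
      (∀ n, Function.Exact (δ (n + 1)).toLinearMap (δ n).toLinearMap) ∧
      ∀ n x i, (δ n).toLinearMap x i ∈ m.toIdeal := by
  have hgen : ∀ K : {K : GrMod 𝒜 // Module.Finite R K.carrier}, ∃ (r : ℕ) (deg : Fin r → ℤ)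
      (ε : Hom (free 𝒜 deg) K.1), Function.Surjective ε.toLinearMap ∧
        ∀ x, ε.toLinearMap x = 0 → ∀ i, x i ∈ m.toIdeal := by
    rintro ⟨K, hK⟩
    obtain ⟨r, deg, z, hz, hspan, hmin⟩ := exists_minimal_generators m (M := K) LinearMap.id
      Function.surjective_id fun x hx n => by
        rw [LinearMap.id_apply] at hx ⊢
        rw [hx, map_zero]
    refine ⟨r, deg, freeHom hz, ?_, fun x hx => hmin x ?_⟩
    · rw [← LinearMap.range_eq_top]
      exact (Fintype.range_linearCombination R _).trans hspan
    · exact (Fintype.linearCombination_apply R z x).symm.trans hx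
  choose r deg ε hsurj hmin using hgen
  have hstab : ∀ K n, ∀ x ∈ LinearMap.ker (ε K).toLinearMap,
      (free 𝒜 (deg K)).proj n x ∈ LinearMap.ker (ε K).toLinearMap := by
    intro K n x hx
    have := map_proj (M := free 𝒜 (deg K)) (N := K.1) (f := (ε K).toLinearMap.toAddMonoidHom)
      (k := 0) (fun n x hx => (add_zero n).symm ▸ (ε K).map_mem hx) n x
    rw [LinearMap.mem_ker] at hx ⊢
    refine Eq.trans this ?_
    change K.1.proj (n + 0) ((ε K).toLinearMap x) = 0
    rw [hx, map_zero]
  -- The syzygy of the chosen minimal cover, again finitely generated and graded. Iterating from `M`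
  -- and splicing gives the resolution; each differential lands in the kernel of a minimal cover, so
  -- its coordinates lie in `m`.
  let next : {K : GrMod 𝒜 // Module.Finite R K.carrier} →
      {K : GrMod 𝒜 // Module.Finite R K.carrier} := fun K =>
    ⟨(free 𝒜 (deg K)).ofSubmodule (LinearMap.ker (ε K).toLinearMap) (hstab K),
      inferInstanceAs (Module.Finite R (LinearMap.ker (ε K).toLinearMap))⟩
  let K : ℕ → {K : GrMod 𝒜 // Module.Finite R K.carrier} := fun n =>
    Nat.rec ⟨M, inferInstance⟩ (fun _ => next) n
  let ι : ∀ n, Hom (K (n + 1)).1 (free 𝒜 (deg (K n))) := fun n =>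
    ⟨(LinearMap.ker (ε (K n)).toLinearMap).subtype, fun hx => hx⟩
  have hι : ∀ n, Function.Injective (ι n).toLinearMap := fun n => Subtype.val_injective
  have hιm : ∀ n x, (ε (K n)).toLinearMap ((ι n).toLinearMap x) = 0 := fun n x => x.2
  have hex : ∀ n y, (ε (K n)).toLinearMap y = 0 ↔
      y ∈ Set.range fun x => (ι n).toLinearMap ((ε (K (n + 1))).toLinearMap x) := by
    intro n y
    constructor
    · intro hy
      obtain ⟨x, hx⟩ := hsurj (K (n + 1)) ⟨y, hy⟩
      exact ⟨x, congrArg Subtype.val hx⟩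
    · rintro ⟨x, rfl⟩
      exact hιm n _
  refine ⟨fun n => r (K n), fun n => deg (K n), fun n =>
    ⟨(ι n).toLinearMap ∘ₗ (ε (K (n + 1))).toLinearMap,
      fun hx => (ι n).map_mem ((ε (K (n + 1))).map_mem hx)⟩, ε (K 0), hsurj (K 0), hex 0,
      fun n y => ?_, fun n x => hmin _ _ (hιm n _)⟩
  refine Iff.trans ?_ (hex (n + 1) y)
  exact map_eq_zero_iff (ι n).toLinearMap (hι n)

end GrMod

/-! ### Totalization of a complex of graded modules -/

namespace DGMod

variable {R : Type u} [CommRing R] {𝒜 : ℤ → AddSubgroup R}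

/-- The differential of the totalization of a complex of graded modules. -/
noncomputable def totalD (F : ℕ → GrMod 𝒜) (δ : ∀ n, GrMod.Hom (F (n + 1)) (F n)) :
    (⨁ n, (F n).carrier) →ₗ[R] ⨁ n, (F n).carrier :=
  DirectSum.toModule R ℕ _ fun n => match n with
    | 0 => 0
    | n + 1 => DirectSum.lof R ℕ (fun n => (F n).carrier) n ∘ₗ (δ n).toLinearMap

section

variable {F : ℕ → GrMod 𝒜} {δ : ∀ n, GrMod.Hom (F (n + 1)) (F n)}

theorem totalD_of_zero (a : (F 0).carrier) :
    totalD F δ (DirectSum.of (fun n => (F n).carrier) 0 a) = 0 := by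
  rw [← DirectSum.lof_eq_of R, totalD, DirectSum.toModule_lof, LinearMap.zero_apply]

theorem totalD_of_succ (n : ℕ) (a : (F (n + 1)).carrier) :
    totalD F δ (DirectSum.of (fun n => (F n).carrier) (n + 1) a) =
      DirectSum.of (fun n => (F n).carrier) n ((δ n).toLinearMap a) := by
  rw [← DirectSum.lof_eq_of R, totalD, DirectSum.toModule_lof]
  rfl

theorem totalD_apply (x : ⨁ n, (F n).carrier) (n : ℕ) :
    totalD F δ x n = (δ n).toLinearMap (x (n + 1)) := by
  induction x using DirectSum.induction_on with
  | zero => simp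
  | add x y hx hy => rw [map_add, DirectSum.add_apply, hx, hy, DirectSum.add_apply, map_add]
  | of l a =>
    cases l with
    | zero =>
      rw [totalD_of_zero, DirectSum.of_eq_of_ne _ _ _ (Nat.succ_ne_zero n), map_zero]
      rfl
    | succ l =>
      rw [totalD_of_succ]
      by_cases h : l = n
      · subst h
        rw [DirectSum.of_eq_same, DirectSum.of_eq_same]
      · rw [DirectSum.of_eq_of_ne _ _ _ (Ne.symm h), DirectSum.of_eq_of_ne _ _ _ (by omega),
          map_zero]

end

/-- The total DG module of a complex of graded modules. -/
noncomputable abbrev total (F : ℕ → GrMod 𝒜) (δ : ∀ n, GrMod.Hom (F (n + 1)) (F n))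
    (hδ : ∀ n x, (δ n).toLinearMap ((δ (n + 1)).toLinearMap x) = 0) : DGMod 𝒜 where
  carrier := ⨁ n, (F n).carrier
  grading k :=
    { carrier := {x | ∀ n : ℕ, x n ∈ (F n).grading (k - n)}
      add_mem' := fun hx hy i => add_mem (hx i) (hy i)
      zero_mem' := fun _ => zero_mem _
      neg_mem' := fun hx i => neg_mem (hx i) }
  isInternal := by
    refine DirectSum.isInternal_of_proj (fun k => DirectSum.map fun n => (F n).proj (k - n))
      (fun k x hx => DFinsupp.ext fun n => (DirectSum.map_apply _ _ _).trans
        (GrMod.proj_of_mem (hx n)))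
      (fun k l h x hx => DFinsupp.ext fun n => (DirectSum.map_apply _ _ _).trans
        (GrMod.proj_of_mem_ne (by omega) (hx n))) fun x => ?_
    induction x using DirectSum.induction_on with
    | zero => exact zero_mem _
    | add x y hx hy => exact add_mem hx hy
    | of n a =>
      induction a using GrMod.induction with
      | zero => rw [map_zero]; exact zero_mem _
      | add x y hx hy => rw [map_add]; exact add_mem hx hy
      | hom k a ha =>
        refine AddSubgroup.mem_iSup_of_mem (k + n) fun l => ?_
        by_cases h : n = l
        · subst h
          rwa [DirectSum.of_eq_same, add_sub_cancel_right]
        · rw [DirectSum.of_eq_of_ne _ _ _ (Ne.symm h)]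
          exact zero_mem _
  smul_mem {i j r x} hr hx n := by
    rw [add_sub_assoc]
    exact (F n).smul_mem hr (hx n)
  d := totalD F δ
  d_mem {k x} hx n := by
    rw [totalD_apply]
    have := (δ n).map_mem (hx (n + 1))
    rwa [Nat.cast_succ, add_comm, ← sub_sub] at this
  d_d x := DFinsupp.ext fun n => by
    rw [totalD_apply, totalD_apply]
    exact hδ n _

variable {F : ℕ → GrMod 𝒜} {δ : ∀ n, GrMod.Hom (F (n + 1)) (F n)}
  (hδ : ∀ n x, (δ n).toLinearMap ((δ (n + 1)).toLinearMap x) = 0)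

/-- The augmentation of the totalization of a resolution. -/
noncomputable def totalHom {M : GrMod 𝒜} (ε : GrMod.Hom (F 0) M)
    (hε : ∀ x, ε.toLinearMap ((δ 0).toLinearMap x) = 0) : total F δ hδ ⟶ ofGrMod M where
  toLinearMap := ε.toLinearMap ∘ₗ DirectSum.component R ℕ (fun n => (F n).carrier) 0
  map_mem {k x} hx := by
    have h : x 0 ∈ (F 0).grading (k - (0 : ℕ)) := hx 0
    rw [Nat.cast_zero, sub_zero] at h
    exact ε.map_mem h
  map_d x := by
    refine (congrArg ε.toLinearMap (totalD_apply x 0)).trans ((hε _).trans ?_)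
    rfl

/-- The components have no differential of their own, so a cycle of the totalization is a cycle in
each coordinate and can be lifted coordinatewise by exactness. -/
theorem quasiIso_totalHom {M : GrMod 𝒜} (ε : GrMod.Hom (F 0) M)
    (hε : Function.Surjective ε.toLinearMap)
    (h₀ : Function.Exact (δ 0).toLinearMap ε.toLinearMap)
    (hex : ∀ n, Function.Exact (δ (n + 1)).toLinearMap (δ n).toLinearMap) :
    quasiIso 𝒜 (totalHom hδ ε h₀.apply_apply_eq_zero) := by
  classical
  rw [quasiIso_iff]
  constructor
  · intro z _
    obtain ⟨a, ha⟩ := hε z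
    refine ⟨DirectSum.of (fun n => (F n).carrier) 0 a, totalD_of_zero a, 0, ?_⟩
    rw [map_zero, add_zero, ← ha]
    exact congrArg ε.toLinearMap (DirectSum.of_eq_same (β := fun n => (F n).carrier) 0 a)
  · intro x hx w hw
    have hw : ε.toLinearMap (x 0) = 0 := hw
    have hx : totalD F δ x = 0 := hx
    have : ∀ n, ∃ y, (δ n).toLinearMap y = x n := by
      intro n
      cases n with
      | zero => exact (h₀ _).1 hw
      | succ n =>
        refine (hex n _).1 ?_
        rw [← totalD_apply, hx]
        rfl
    choose y hy using this
    refine ⟨∑ n ∈ DFinsupp.support x, DirectSum.of (fun n => (F n).carrier) (n + 1) (y n), ?_⟩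
    refine (map_sum (totalD F δ) _ _).trans ?_
    refine Eq.trans (Finset.sum_congr rfl fun n _ => ?_) (DirectSum.sum_support_of x)
    rw [totalD_of_succ, hy]

/-- Homotopical projectivity of a totalization, provided that homogeneous maps from the components
to cycles of an acyclic DG module lift. -/
theorem isKProjective_total (hF : ∀ (C : DGMod 𝒜), C.IsAcyclic → ∀ n (k : ℤ)
    (f : (F n).carrier →ₗ[R] C.carrier), (∀ l, ∀ x ∈ (F n).grading l, f x ∈ C.grading (l + k)) →
    (∀ x, C.d (f x) = 0) → ∃ h : (F n).carrier →ₗ[R] C.carrier,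
      (∀ l, ∀ x ∈ (F n).grading l, h x ∈ C.grading (l + k + 1)) ∧ ∀ x, C.d (h x) = f x) :
    (total F δ hδ).IsKProjective := by
  intro C hC f
  let of : ∀ n, (F n).carrier →ₗ[R] ⨁ n, (F n).carrier := DirectSum.lof R ℕ _
  have hof : ∀ n l, ∀ x ∈ (F n).grading l, of n x ∈ (total F δ hδ).grading (l + n) := by
    intro n l x hx i
    change DirectSum.of (fun n => (F n).carrier) n x i ∈ _
    by_cases h : n = i
    · subst h
      rwa [DirectSum.of_eq_same, add_sub_cancel_right]
    · rw [DirectSum.of_eq_of_ne _ _ _ (Ne.symm h)]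
      exact zero_mem _
  let f' : (⨁ n, (F n).carrier) →ₗ[R] C.carrier := Hom.toLinearMap f
  have hf'd : ∀ x, f' (totalD F δ x) = C.d (f' x) := Hom.map_d f
  -- A stage records the homotopy identity on cycles only. Since `δ` takes values in cycles, this is
  -- what makes `f' - h ∘ δ` cycle-valued on the next component, hence liftable.
  let H : ℕ → Type u := fun n => {h : (F n).carrier →ₗ[R] C.carrier //
    (∀ l, ∀ x ∈ (F n).grading l, h x ∈ C.grading (l + n + 1)) ∧
      ∀ x, totalD F δ (of n x) = 0 → C.d (h x) = f' (of n x)}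
  have h₀ : Nonempty (H 0) := by
    obtain ⟨h, hdeg, hh⟩ := hF C hC 0 (0 : ℕ) (f' ∘ₗ of 0)
      (fun l x hx => Hom.map_mem f (hof 0 l x hx))
      (fun x => (hf'd _).symm.trans (by
        rw [show totalD F δ (of 0 x) = 0 from totalD_of_zero x, map_zero]))
    exact ⟨h, hdeg, fun x _ => hh x⟩
  have hs : ∀ n (h : H n), ∃ h' : H (n + 1), ∀ x,
      C.d (h'.1 x) + h.1 ((δ n).toLinearMap x) = f' (of (n + 1) x) := by
    rintro n ⟨h, hdeg, hh⟩
    obtain ⟨h', hdeg', hh'⟩ := hF C hC (n + 1) (n + 1 : ℕ)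
      (f' ∘ₗ of (n + 1) - h ∘ₗ (δ n).toLinearMap)
      (fun l x hx => by
        refine sub_mem (Hom.map_mem f (hof (n + 1) l x hx)) ?_
        have := hdeg l _ ((δ n).map_mem hx)
        rwa [add_assoc] at this)
      (fun x => by
        have hd : totalD F δ (of (n + 1) x) = of n ((δ n).toLinearMap x) := totalD_of_succ n x
        have h1 := hh ((δ n).toLinearMap x) (by
          rw [← hd]
          exact (total F δ hδ).d_d _)
        change C.d (f' (of (n + 1) x) - h ((δ n).toLinearMap x)) = 0
        rw [map_sub, h1, ← hf'd, hd, sub_self])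
    have hh'' : ∀ x, C.d (h' x) + h ((δ n).toLinearMap x) = f' (of (n + 1) x) := fun x => by
      rw [hh']
      exact sub_add_cancel _ _
    refine ⟨⟨h', hdeg', fun x hx => ?_⟩, hh''⟩
    have hd : of n ((δ n).toLinearMap x) = 0 := (totalD_of_succ n x).symm.trans hx
    have h0 : (δ n).toLinearMap x = 0 :=
      DirectSum.of_injective (β := fun n => (F n).carrier) n (hd.trans (map_zero _).symm)
    rw [← hh'' x, h0, map_zero, add_zero]
  choose step hstep using hs
  obtain ⟨h₀⟩ := h₀
  let h : ∀ n, H n := fun n => Nat.rec h₀ step n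
  have hrec : ∀ n x, C.d ((h (n + 1)).1 x) + (h n).1 ((δ n).toLinearMap x) = f' (of (n + 1) x) :=
    fun n x => hstep n (h n) x
  let T : (⨁ n, (F n).carrier) →ₗ[R] C.carrier := DirectSum.toModule R ℕ _ fun n => (h n).1
  have hT : ∀ n x, T (DirectSum.of (fun n => (F n).carrier) n x) = (h n).1 x := fun n x => by
    rw [← DirectSum.lof_eq_of R, DirectSum.toModule_lof]
  refine ⟨T, fun l x hx => ?_, fun x => ?_⟩
  · classical
    have hx : ∀ n : ℕ, x n ∈ (F n).grading (l - n) := hx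
    rw [← DirectSum.sum_support_of x]
    refine (map_sum T _ _).symm ▸ sum_mem fun n _ => ?_
    rw [hT]
    have := (h n).2.1 _ _ (hx n)
    rwa [sub_add_cancel] at this
  · change C.d (T x) + T (totalD F δ x) = f' x
    induction x using DirectSum.induction_on with
    | zero => simp
    | add x y hx hy => rw [map_add, map_add, map_add, map_add, map_add, ← hx, ← hy]; abel
    | of n a =>
      cases n with
      | zero =>
        rw [hT, totalD_of_zero, map_zero, add_zero]
        exact (h 0).2.2 a (totalD_of_zero a)
      | succ n => rw [hT, totalD_of_succ, hT]; exact hrec n a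

end DGMod

/-! ### Small modules have finite minimal resolutions -/

namespace DGMod

open scoped DirectSum

variable {R : Type u} [CommRing R] {𝒜 : ℤ → AddSubgroup R} [GradedRing 𝒜]

variable {r : ℕ → ℕ} {deg : ∀ n, Fin (r n) → ℤ}
  {δ : ∀ n, GrMod.Hom (GrMod.free 𝒜 (deg (n + 1))) (GrMod.free 𝒜 (deg n))}

theorem totalD_mem_smul (I : Ideal R) (hmin : ∀ n x i, (δ n).toLinearMap x i ∈ I)
    (x : ⨁ n, (GrMod.free 𝒜 (deg n)).carrier) :
    totalD (fun n => GrMod.free 𝒜 (deg n)) δ x ∈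
      I • (⊤ : Submodule R (⨁ n, (GrMod.free 𝒜 (deg n)).carrier)) := by
  induction x using DirectSum.induction_on with
  | zero => rw [map_zero]; exact zero_mem _
  | add x y hx hy => rw [map_add]; exact add_mem hx hy
  | of n a =>
    cases n with
    | zero => exact (totalD_of_zero (F := fun n => GrMod.free 𝒜 (deg n)) a).symm ▸ zero_mem _
    | succ n =>
      rw [totalD_of_succ, ← DirectSum.lof_eq_of R]
      generalize hy : (δ n).toLinearMap a = y
      have hy' : ∀ i, y i ∈ I := fun i => hy ▸ hmin n a i
      rw [← (Pi.basisFun R (Fin (r n))).sum_repr y, map_sum]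
      refine sum_mem fun i _ => ?_
      rw [map_smul]
      exact Submodule.smul_mem_smul (hy' i) trivial

/-- A small totalization of a minimal complex of free graded modules is finite. -/
theorem IsSmall.exists_bound_of_minimal
    (hδ : ∀ n x, (δ n).toLinearMap ((δ (n + 1)).toLinearMap x) = 0) (m : HomogeneousIdeal 𝒜) (hm : m.toIdeal ≠ ⊤)
    (hmin : ∀ n x i, (δ n).toLinearMap x i ∈ m.toIdeal)
    (h : (total (fun n => GrMod.free 𝒜 (deg n)) δ hδ).IsSmall) : ∃ N, ∀ n, N < n → r n = 0 := by
  classical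
  let T := total (fun n => GrMod.free 𝒜 (deg n)) δ hδ
  have hT : T.IsKProjective := isKProjective_total hδ fun C hC n k f hf hd =>
    hC.exists_lift_free (deg n) f hf hd
  -- One copy of `R / m` per basis element of the resolution, shifted so that reduction of that
  -- coordinate has degree zero; `ULift` places the index in the universe used by smallness.
  let X : ULift.{u} (Σ n, Fin (r n)) → DGMod 𝒜 := fun j =>
    ofGrMod ((GrMod.quotient 𝒜 m).shift (deg j.down.1 j.down.2 + j.down.1))
  let S := ⨁ _ : ULift.{u} (Σ n, Fin (r n)), R ⧸ m.toIdeal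
  let Φ : (⨁ n, (Fin (r n) → R)) →ₗ[R] S := DirectSum.toModule R ℕ _ fun n =>
    ∑ i, DirectSum.lof R _ (fun _ => R ⧸ m.toIdeal) (ULift.up ⟨n, i⟩) ∘ₗ
      m.toIdeal.mkQ ∘ₗ LinearMap.proj i
  have hΦ : ∀ x j, Φ x j = Ideal.Quotient.mk m.toIdeal (x j.down.1 j.down.2) := by
    intro x j
    induction x using DirectSum.induction_on with
    | zero => rw [map_zero]; exact (map_zero _).symm
    | add x y hx hy =>
      rw [map_add, DirectSum.add_apply, hx, hy, DirectSum.add_apply, Pi.add_apply, map_add]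
    | of n a =>
      obtain ⟨l, i⟩ := j
      have h1 : ∀ i', (DirectSum.lof R _ (fun _ => R ⧸ m.toIdeal) (ULift.up ⟨n, i'⟩) ∘ₗ
          m.toIdeal.mkQ ∘ₗ LinearMap.proj i') a =
          DirectSum.of (fun _ : ULift.{u} (Σ n, Fin (r n)) => R ⧸ m.toIdeal) (ULift.up ⟨n, i'⟩)
            (Ideal.Quotient.mk m.toIdeal (a i')) := fun i' => rfl
      rw [← DirectSum.lof_eq_of R, DirectSum.toModule_lof, LinearMap.sum_apply,
        DFinsupp.finsetSum_apply, DirectSum.lof_eq_of]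
      simp only [h1]
      by_cases hl : n = l
      · subst hl
        rw [DirectSum.of_eq_same, Finset.sum_eq_single i]
        · exact DirectSum.of_eq_same _ _
        · intro i' _ hi'
          refine DirectSum.of_eq_of_ne _ _ _ fun he => hi' ?_
          simpa using he.symm
        · simp
      · rw [DirectSum.of_eq_of_ne _ _ _ (Ne.symm hl), Pi.zero_apply, map_zero]
        refine Finset.sum_eq_zero fun i' _ => DirectSum.of_eq_of_ne _ _ _ fun he => hl ?_
        simp only [ULift.up.injEq, Sigma.mk.injEq] at he
        exact he.1.symm
  let φ : T ⟶ directSum X :=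
    { toLinearMap := Φ
      map_mem := fun {k x} hx j => by
        have h1 : x j.down.1 j.down.2 ∈ 𝒜 (k - j.down.1 - deg j.down.1 j.down.2) :=
          hx j.down.1 j.down.2 trivial
        rw [sub_sub, add_comm] at h1
        exact ⟨_, h1, (hΦ x j).symm⟩
      map_d := fun x => DFinsupp.ext fun j => by
        refine (hΦ _ j).trans (Ideal.Quotient.eq_zero_iff_mem.2 ?_)
        rw [totalD_apply]
        exact hmin _ _ _ }
  obtain ⟨s, g, hg⟩ := h _ X ((Q 𝒜).map φ)
  obtain ⟨g, rfl⟩ := hT.exists_Q_map_eq g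
  rw [← Functor.map_comp] at hg
  have H := hT.homotopic_of_Q_map_eq hg
  have hdm : ∀ x : ⨁ n, (Fin (r n) → R), T.d x ∈ m.toIdeal • (⊤ : Submodule R T.carrier) :=
    totalD_mem_smul m.toIdeal hmin
  -- On the basis vector of index `j`, coordinate `j` of `φ` is 1. The homotopy contributes nothing:
  -- `X j` has zero differential, and `d b` lies in `mT`, which maps to zero in `R / m`. If `j ∉ s`
  -- the factored map gives 0, so `1 = 0` in `R / m`.
  have hs : ∀ j, j ∈ s := by
    intro j
    by_contra hj
    obtain ⟨h, -, hh⟩ := H.comp_right (directSumComponent X j)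
    let h' : T.carrier →ₗ[R] R ⧸ m.toIdeal := h
    have hm0 : ∀ x ∈ m.toIdeal • (⊤ : Submodule R T.carrier), h' x = 0 := by
      intro x hx
      induction hx using Submodule.smul_induction_on' with
      | smul a ha y _ =>
        rw [map_smul, Algebra.smul_def, Ideal.Quotient.algebraMap_eq,
          Ideal.Quotient.eq_zero_iff_mem.2 ha, zero_mul]
      | add x _ y _ hx hy => rw [map_add, hx, hy, add_zero]
    let b : ⨁ n, (Fin (r n) → R) :=
      DirectSum.of (fun n => Fin (r n) → R) j.down.1 (Pi.single j.down.2 1)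
    have h1 : directSumInclLinear X s (Hom.toLinearMap g b) j =
      (Φ b j + (0 + h' (T.d b)) : R ⧸ m.toIdeal) := hh b
    have h2 := directSumInclLinear_apply X s (Hom.toLinearMap g b) j
    rw [dif_neg hj] at h2
    have h3 := h2.symm.trans h1
    rw [hm0 _ (hdm b), hΦ, DirectSum.of_eq_same, Pi.single_eq_same, map_one, add_zero,
      add_zero] at h3
    exact hm ((Ideal.eq_top_iff_one _).2
      (Ideal.Quotient.eq_zero_iff_mem.1 ((map_one _).trans h3.symm)))
  refine ⟨s.sup fun j => j.down.1, fun n hn => ?_⟩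
  by_contra hr
  exact hn.not_ge (Finset.le_sup (f := fun j => j.down.1)
    (hs (ULift.up ⟨n, ⟨0, Nat.pos_of_ne_zero hr⟩⟩)))

/-- A finitely generated graded module which is small as a DG module has a finite free
resolution. -/
theorem hasFiniteFreeResolution_of_isSmall [IsNoetherianRing R] (m : HomogeneousIdeal 𝒜)
    [hm : IsLocalGraded 𝒜 m] {M : GrMod 𝒜} [Module.Finite R M.carrier]
    (h : (ofGrMod M).IsSmall) : M.HasFiniteFreeResolution := by
  obtain ⟨r, deg, δ, ε, hε, h₀, hex, hmin⟩ := GrMod.exists_minimal_resolution m M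
  have hδ : ∀ n x, (δ n).toLinearMap ((δ (n + 1)).toLinearMap x) = 0 := fun n =>
    (hex n).apply_apply_eq_zero
  obtain ⟨N, hN⟩ := (h.of_iso (Localization.Construction.wIso _
    (quasiIso_totalHom hδ ε hε h₀ hex)).symm).exists_bound_of_minimal hδ m hm.ne_top hmin
  refine ⟨N, fun n => GrMod.free 𝒜 (deg n), δ, ε, fun n => GrMod.isFiniteFree_free _,
    fun n hn => ?_, hε, h₀, hex⟩
  have := hN n hn
  change Subsingleton (Fin (r n) → R)
  rw [this]
  infer_instance

end DGMod

/-! ### Equivalence of smallness with the three kinds of finite free resolution -/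

section

open IsLocalRing TensorProduct

variable {R : Type u} [CommRing R] {𝒜 : ℤ → AddSubgroup R}

/-- Flat base change of finite free resolutions. -/
theorem GrMod.HasFiniteFreeResolution.baseChange [Nontrivial R] {M : GrMod 𝒜}
    (h : M.HasFiniteFreeResolution) {S : Type*} [CommRing S] [Algebra R S] [Module.Flat R S]
    {N : Type*} [AddCommGroup N] [Module S N] (e : S ⊗[R] M.carrier ≃ₗ[S] N) :
    _root_.HasFiniteFreeResolution S N := by
  obtain ⟨n, F, d, ε, hF, hn, hε, h₀, hex⟩ := h
  choose r b hb using hF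
  let c : ∀ i, S ⊗[R] (F i).carrier ≃ₗ[S] (Fin (r i) → S) := fun i => ((b i).baseChange S).equivFun
  refine ⟨n, r, fun i => c i ∘ₗ (d i).toLinearMap.baseChange S ∘ₗ (c (i + 1)).symm,
    e ∘ₗ ε.toLinearMap.baseChange S ∘ₗ (c 0).symm, fun i hi => ?_, ?_, ?_, fun i => ?_⟩
  · by_contra hr
    have := hn i hi
    exact (b i).ne_zero ⟨0, Nat.pos_of_ne_zero hr⟩ (Subsingleton.elim _ _)
  · exact e.surjective.comp ((LinearMap.lTensor_surjective S hε).comp (c 0).symm.surjective)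
  · exact Function.Exact.of_ladder_linearEquiv_of_exact (e₁ := c 1) (e₂ := c 0) (e₃ := e)
      (LinearMap.ext fun x => by simp) (LinearMap.ext fun x => by simp)
      (f₁₂ := (d 0).toLinearMap.baseChange S) (f₂₃ := ε.toLinearMap.baseChange S)
      (lTensor_exact S h₀ hε)
  · exact Function.Exact.of_ladder_linearEquiv_of_exact (e₁ := c (i + 2)) (e₂ := c (i + 1))
      (e₃ := c i) (LinearMap.ext fun x => by simp) (LinearMap.ext fun x => by simp)
      (f₁₂ := (d (i + 1)).toLinearMap.baseChange S) (f₂₃ := (d i).toLinearMap.baseChange S)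
      (Module.Flat.lTensor_exact S (hex i))

theorem nonempty_baseChange_equiv_localizedModule (p : Ideal R) [p.IsPrime] (M : Type*)
    [AddCommGroup M] [Module R M] : Nonempty (Localization.AtPrime p ⊗[R] M
      ≃ₗ[Localization.AtPrime p] LocalizedModule.AtPrime p M) :=
  ⟨(IsLocalizedModule.isBaseChange p.primeCompl (Localization.AtPrime p)
    (LocalizedModule.mkLinearMap p.primeCompl M)).equiv⟩

theorem nonempty_baseChange_equiv_adicCompletion [IsNoetherianRing R] {S : Type u} [CommRing S]
    [IsNoetherianRing S] [Algebra R S] (I : Ideal S) {M : Type u} [AddCommGroup M] [Module R M]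
    [Module.Finite R M] {N : Type u} [AddCommGroup N] [Module S N] (e : S ⊗[R] M ≃ₗ[S] N) :
    Nonempty (AdicCompletion I S ⊗[R] M ≃ₗ[AdicCompletion I S] AdicCompletion I N) := by
  have : Module.Finite S N := Module.Finite.equiv e
  exact ⟨(TensorProduct.AlgebraTensorModule.cancelBaseChange R S (AdicCompletion I S)
    (AdicCompletion I S) M).symm.trans ((e.baseChange S (AdicCompletion I S) _ _).trans
      (AdicCompletion.ofTensorProductEquivOfFiniteNoetherian I N))⟩

theorem DGMod.nonempty_homology_ofGrMod_equiv (M : GrMod 𝒜) :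
    Nonempty ((DGMod.ofGrMod M).Homology ≃ₗ[R] M.carrier) := by
  have h : (LinearMap.range (DGMod.ofGrMod M).d).submoduleOf
      (LinearMap.ker (DGMod.ofGrMod M).d) = ⊥ := by
    rw [eq_bot_iff]
    rintro x ⟨y, hy⟩
    exact Subtype.ext hy.symm
  exact ⟨(Submodule.quotEquivOfEqBot _ h).trans (LinearEquiv.ofTop _ LinearMap.ker_zero)⟩

variable [GradedRing 𝒜] [IsNoetherianRing R]

/-- The common form of the implications from the localization and from the completion: both are flat
local `R`-algebras. -/
theorem DGMod.isSmall_ofGrMod (m : HomogeneousIdeal 𝒜) [IsLocalGraded 𝒜 m] {S : Type u}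
    [CommRing S] [Algebra R S] [IsLocalRing S] [Module.Flat R S]
    (hS : m.toIdeal.map (algebraMap R S) ≤ maximalIdeal S) {M : GrMod 𝒜}
    [Module.Finite R M.carrier] {N : Type u} [AddCommGroup N] [Module S N]
    (e : S ⊗[R] M.carrier ≃ₗ[S] N) (h : HasFiniteFreeResolution S N) :
    (DGMod.ofGrMod M).IsSmall := by
  obtain ⟨n, hn⟩ := h.exists_pdLT
  obtain ⟨e'⟩ := DGMod.nonempty_homology_ofGrMod_equiv M
  exact DGMod.isSmall_of_pdLT m hS (Module.Finite.equiv e'.symm)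
    (hn.of_equiv (e.symm.trans (e'.symm.baseChange R S _ _)))

theorem isSmall_tfae (m : HomogeneousIdeal 𝒜) [hm : IsLocalGraded 𝒜 m] (M : GrMod 𝒜)
    (hM : Module.Finite R M.carrier) :
      List.TFAE [
        (DGMod.ofGrMod M).IsSmall,
        M.HasFiniteFreeResolution,
        HasFiniteFreeResolution (Localization.AtPrime m.toIdeal)
          (LocalizedModule.AtPrime m.toIdeal M.carrier),
        HasFiniteFreeResolution
          (AdicCompletion (IsLocalRing.maximalIdeal (Localization.AtPrime m.toIdeal))
            (Localization.AtPrime m.toIdeal))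
          (AdicCompletion (IsLocalRing.maximalIdeal (Localization.AtPrime m.toIdeal))
            (LocalizedModule.AtPrime m.toIdeal M.carrier))] := by
  have : Nontrivial R := (Submodule.nontrivial_iff R).1 ⟨⟨_, _, hm.ne_top⟩⟩
  obtain ⟨e⟩ := nonempty_baseChange_equiv_localizedModule m.toIdeal M.carrier
  obtain ⟨e'⟩ := nonempty_baseChange_equiv_adicCompletion
    (maximalIdeal (Localization.AtPrime m.toIdeal)) e
  have : Module.Flat (Localization.AtPrime m.toIdeal)
      (AdicCompletion (maximalIdeal (Localization.AtPrime m.toIdeal))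
        (Localization.AtPrime m.toIdeal)) := AdicCompletion.flat_of_isNoetherian _
  have : Module.Flat R (AdicCompletion (maximalIdeal (Localization.AtPrime m.toIdeal))
        (Localization.AtPrime m.toIdeal)) := Module.Flat.trans R (Localization.AtPrime m.toIdeal) _
  have hloc : m.toIdeal.map (algebraMap R (Localization.AtPrime m.toIdeal)) ≤
      maximalIdeal (Localization.AtPrime m.toIdeal) :=
    (Localization.AtPrime.map_eq_maximalIdeal (I := m.toIdeal)).le
  tfae_have 1 → 2 := DGMod.hasFiniteFreeResolution_of_isSmall m
  tfae_have 2 → 3 := fun h => h.baseChange e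
  tfae_have 3 → 1 := DGMod.isSmall_ofGrMod m hloc e
  tfae_have 2 → 4 := fun h => h.baseChange e'
  tfae_have 4 → 1 := DGMod.isSmall_ofGrMod m (by
    rw [IsScalarTower.algebraMap_eq R (Localization.AtPrime m.toIdeal), ← Ideal.map_map,
      AdicCompletion.maximalIdeal_eq_map]
    exact Ideal.map_mono hloc) e'
  tfae_finish

end

/-! ### Comparison of the notions of regularity -/

section

open IsLocalRing TensorProduct

variable {R : Type u} [CommRing R]

/-- Generators whose relations have all coefficients in the maximal ideal are linearly independent
in the cotangent space. -/
theorem le_spanFinrank_maximalIdeal {A : Type*} [CommRing A] [IsLocalRing A] [IsNoetherianRing A]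
    {n : ℕ} {x : Fin n → A} (hx : Ideal.span (Set.range x) = maximalIdeal A)
    (hmin : ∀ a : Fin n → A, ∑ i, a i * x i = 0 → ∀ i, a i ∈ maximalIdeal A) :
    n ≤ (maximalIdeal A).spanFinrank := by
  have hmem : ∀ i, x i ∈ maximalIdeal A := fun i => hx ▸ Ideal.subset_span ⟨i, rfl⟩
  have hli : LinearIndependent (ResidueField A)
      fun i => ((maximalIdeal A).toCotangent ⟨x i, hmem i⟩ : CotangentSpace A) := by
    rw [Fintype.linearIndependent_iff]
    intro g hg i
    choose a ha using fun i => residue_surjective (g i)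
    obtain rfl : (fun i => residue A (a i)) = g := funext ha
    have h1 : (maximalIdeal A).toCotangent (∑ i, a i • ⟨x i, hmem i⟩) = 0 := by
      rw [map_sum, ← hg]
      exact Finset.sum_congr rfl fun i _ => map_smul _ _ _
    rw [Ideal.toCotangent_eq_zero, pow_two] at h1
    have h1' := (congrArg (maximalIdeal A * ·) hx).ge h1
    rw [← smul_eq_mul, Ideal.span, Submodule.mem_ideal_smul_span_iff_exists_sum] at h1'
    obtain ⟨b, hb, hab⟩ := h1'
    rw [Finsupp.sum_fintype _ _ (by simp)] at hab
    -- The combination lies in the square of the maximal ideal, so it can be rewritten with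
    -- coefficients `b i` in the maximal ideal; the differences are an honest relation.
    have h2 := hmin (fun i => a i - b i) (by
      simp only [sub_mul, Finset.sum_sub_distrib]
      rw [sub_eq_zero]
      simpa using hab.symm) i
    have h3 : a i ∈ maximalIdeal A := (Submodule.sub_mem_iff_left _ (hb i)).1 h2
    exact (residue_eq_zero_iff _).2 h3
  have := hli.fintype_card_le_finrank
  rwa [Fintype.card_fin, ← spanFinrank_maximalIdeal_eq_finrank_cotangentSpace] at this

/-- Minimality of generators survives localization: clear the denominators by `s`, then multiply by
`t` to obtain a relation over `R`; both lie outside `p`. -/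
theorem mem_maximalIdeal_atPrime_of_relation {p : Ideal R} [p.IsPrime] {n : ℕ} {x : Fin n → R}
    (hmin : ∀ a : Fin n → R, ∑ i, a i * x i = 0 → ∀ i, a i ∈ p)
    (c : Fin n → Localization.AtPrime p)
    (hc : ∑ i, c i * algebraMap R (Localization.AtPrime p) (x i) = 0) (i : Fin n) :
    c i ∈ maximalIdeal (Localization.AtPrime p) := by
  classical
  obtain ⟨s, hs⟩ := IsLocalization.exist_integer_multiples_of_finite p.primeCompl c
  choose r hr using hs
  have h1 : algebraMap R (Localization.AtPrime p) (∑ i, r i * x i) = 0 := by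
    rw [map_sum, ← mul_zero (algebraMap R (Localization.AtPrime p) s), ← hc, Finset.mul_sum]
    refine Finset.sum_congr rfl fun i _ => ?_
    rw [map_mul, hr, Algebra.smul_def, mul_assoc]
  rw [IsLocalization.map_eq_zero_iff p.primeCompl] at h1
  obtain ⟨t, ht⟩ := h1
  have h2 := hmin (fun i => t * r i) (by
    rw [← ht, Finset.mul_sum]
    exact Finset.sum_congr rfl fun i _ => mul_assoc _ _ _) i
  have h3 : r i ∈ p := (Ideal.IsPrime.mem_or_mem ‹_› h2).resolve_left t.2
  have h4 : algebraMap R (Localization.AtPrime p) s * c i ∈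
      maximalIdeal (Localization.AtPrime p) := by
    rw [← Algebra.smul_def, ← hr, ← Localization.AtPrime.map_eq_maximalIdeal]
    exact Ideal.mem_map_of_mem _ h3
  exact (Ideal.IsPrime.mem_or_mem inferInstance h4).resolve_left fun h =>
    (mem_maximalIdeal _).1 h (IsLocalization.map_units _ s)

theorem span_algebraMap_atPrime {p : Ideal R} [p.IsPrime] {n : ℕ} {x : Fin n → R}
    (hx : Ideal.span (Set.range x) = p) :
    Ideal.span (Set.range fun i => algebraMap R (Localization.AtPrime p) (x i)) =
      maximalIdeal (Localization.AtPrime p) := by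
  rw [← Localization.AtPrime.map_eq_maximalIdeal]
  refine Eq.trans ?_ (congrArg (Ideal.map (algebraMap R (Localization.AtPrime p))) hx)
  rw [Ideal.map_span, ← Set.range_comp]
  rfl

theorem spanFinrank_span_range_le {A : Type*} [CommRing A] {n : ℕ} (x : Fin n → A) :
    (Ideal.span (Set.range x)).spanFinrank ≤ n := by
  refine (Submodule.spanFinrank_span_le_ncard_of_finite (Set.finite_range x)).trans ?_
  rw [← Set.image_univ]
  refine (Set.ncard_image_le Set.finite_univ).trans ?_
  rw [Set.ncard_univ, Nat.card_fin]

variable {𝒜 : ℤ → AddSubgroup R} [GradedRing 𝒜] (m : HomogeneousIdeal 𝒜)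

theorem finite_quotient : Module.Finite R (GrMod.quotient 𝒜 m).carrier :=
  inferInstanceAs (Module.Finite R (R ⧸ m.toIdeal))

theorem IsRegularDGAlgebra.isRegularAugmented (h : IsRegularDGAlgebra 𝒜) :
    IsRegularAugmented 𝒜 m := by
  obtain ⟨e⟩ := DGMod.nonempty_homology_ofGrMod_equiv (GrMod.quotient 𝒜 m)
  have := finite_quotient m
  exact h _ (Module.Finite.equiv e.symm)

variable [IsNoetherianRing R] [hm : IsLocalGraded 𝒜 m]

theorem IsRegularLocalGraded.isRegularLocalRing (h : IsRegularLocalGraded 𝒜 m) :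
    IsRegularLocalRing (Localization.AtPrime m.toIdeal) := by
  obtain ⟨n, x, -, hx, hn⟩ := h
  refine IsRegularLocalRing.of_spanFinrank_maximalIdeal_le _ ?_
  rw [IsLocalization.AtPrime.ringKrullDim_eq_height m.toIdeal, hn, ← span_algebraMap_atPrime hx]
  exact_mod_cast spanFinrank_span_range_le _

/-- Minimal homogeneous generators of `m` remain minimal in `R_m`, so their number is its embedding
dimension, which by regularity equals its dimension, the height of `m`. -/
theorem isRegularLocalGraded_of_isRegularLocalRing
    (h : IsRegularLocalRing (Localization.AtPrime m.toIdeal)) : IsRegularLocalGraded 𝒜 m := by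
  have hstab : ∀ n, ∀ x ∈ m.toIdeal, (GrMod.ring 𝒜).proj n x ∈ m.toIdeal := by
    intro n x hx
    have := GrMod.proj_coeAddMonoidHom (M := GrMod.ring 𝒜) n (DirectSum.decompose 𝒜 x)
    have hx' : DirectSum.coeAddMonoidHom 𝒜 (DirectSum.decompose 𝒜 x) = x :=
      DirectSum.Decomposition.left_inv x
    rw [hx'] at this
    rw [this]
    exact m.isHomogeneous n hx
  obtain ⟨n, deg, z, hz, hspan, hmin⟩ := GrMod.exists_minimal_generators m
    (M := (GrMod.ring 𝒜).ofSubmodule m.toIdeal hstab) (N := m.toIdeal) LinearMap.id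
    Function.surjective_id fun x hx n => by
      rw [LinearMap.id_apply] at hx ⊢
      rw [hx, map_zero]
  let x : Fin n → R := fun i => (z i).1
  have hx : Ideal.span (Set.range x) = m.toIdeal := by
    have h1 := congrArg (Submodule.map m.toIdeal.subtype) hspan
    rw [Submodule.map_span, ← Set.range_comp, Submodule.map_top, Submodule.range_subtype] at h1
    exact h1
  have hmin' : ∀ a : Fin n → R, ∑ i, a i * x i = 0 → ∀ i, a i ∈ m.toIdeal := by
    intro a ha
    refine hmin a (Subtype.ext ?_)
    refine (map_sum m.toIdeal.subtype _ _).trans ha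
  have hx' := span_algebraMap_atPrime hx
  refine ⟨n, x, fun i => ⟨deg i, hz i⟩, hx, ?_⟩
  have h1 := le_spanFinrank_maximalIdeal hx' (mem_maximalIdeal_atPrime_of_relation hmin')
  have h2 : (maximalIdeal (Localization.AtPrime m.toIdeal)).spanFinrank ≤ n :=
    hx' ▸ spanFinrank_span_range_le _
  have h3 := h.spanFinrank_maximalIdeal
  rw [IsLocalization.AtPrime.ringKrullDim_eq_height m.toIdeal, le_antisymm h2 h1] at h3
  exact_mod_cast h3.symm

theorem isRegularDGAlgebra_of_isRegularLocalRing
    (h : IsRegularLocalRing (Localization.AtPrime m.toIdeal)) : IsRegularDGAlgebra 𝒜 := by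
  intro M hM
  obtain ⟨n, hn⟩ := IsRegularLocalRing.exists_pdLT (A := Localization.AtPrime m.toIdeal)
    (M := Localization.AtPrime m.toIdeal ⊗[R] M.Homology)
  exact DGMod.isSmall_of_pdLT m (Localization.AtPrime.map_eq_maximalIdeal).le hM hn

/-- The localization of `R / m` at `m` is the residue field of `R_m`. Smallness gives it a finite
free resolution, and Serre's theorem applies. -/
theorem IsRegularAugmented.isRegularLocalRing (h : IsRegularAugmented 𝒜 m) :
    IsRegularLocalRing (Localization.AtPrime m.toIdeal) := by
  have h1 := ((isSmall_tfae m (GrMod.quotient 𝒜 m) (finite_quotient m)).out 0 2).1 h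
  obtain ⟨n, hn⟩ := h1.exists_pdLT
  obtain ⟨e⟩ := nonempty_baseChange_equiv_localizedModule m.toIdeal (R ⧸ m.toIdeal)
  let e' : (Localization.AtPrime m.toIdeal ⧸ m.toIdeal.map
      (algebraMap R (Localization.AtPrime m.toIdeal))) ≃ₗ[Localization.AtPrime m.toIdeal]
      Localization.AtPrime m.toIdeal ⊗[R] (R ⧸ m.toIdeal) :=
    Ideal.qoutMapEquivTensorQout (Localization.AtPrime m.toIdeal)
  refine isRegularLocalRing_of_pdLT_residueField _ (n := n) (PdLT.of_equiv hn (e.symm.trans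
    (e'.symm.trans (Submodule.quotEquivOfEq _ _ Localization.AtPrime.map_eq_maximalIdeal))))

end

theorem isRegularLocalRing_of_mvPolynomial_equiv {R : Type u} [CommRing R] {k : Type v}
    [Field k] [Algebra k R] (p : Ideal R) [p.IsPrime] {n : ℕ}
    (e : MvPolynomial (Fin n) k ≃ₐ[k] R) : IsRegularLocalRing (Localization.AtPrime p) :=
  have := IsRegularRing.of_ringEquiv e.toRingEquiv
  inferInstance

/-! ### Graded algebras generated in degrees of one sign -/

section

variable {R : Type u} [CommRing R] {𝒜 : ℤ → AddSubgroup R} [GradedRing 𝒜] {k : Type v} [Field k]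
  [Algebra k R]

/-- The elements with all components in positive degrees, where degrees are measured by `w`. -/
def positivePart (𝒜 : ℤ → AddSubgroup R) (w : ℤ →+ ℤ) : AddSubgroup R :=
  AddSubgroup.closure {x | ∃ n, 0 < w n ∧ x ∈ 𝒜 n}

variable {w : ℤ →+ ℤ}

theorem proj_of_mem_positivePart {x : R} (hx : x ∈ positivePart 𝒜 w) {n : ℤ} (hn : w n ≤ 0) :
    (GrMod.ring 𝒜).proj n x = 0 := by
  induction hx using AddSubgroup.closure_induction with
  | mem x hx =>
    obtain ⟨l, hl, hx⟩ := hx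
    refine GrMod.proj_of_mem_ne (M := GrMod.ring 𝒜) ?_ hx
    rintro rfl
    omega
  | zero => exact map_zero _
  | add x y _ _ hx hy => rw [map_add, hx, hy, add_zero]
  | neg x _ hx => rw [map_neg, hx, neg_zero]

theorem mul_mem_positivePart {x y : R} (hx : x ∈ positivePart 𝒜 w) (hy : y ∈ positivePart 𝒜 w) :
    x * y ∈ positivePart 𝒜 w := by
  induction hx, hy using AddSubgroup.closure_induction₂ with
  | mem x y hx hy =>
    obtain ⟨i, hi, hx⟩ := hx
    obtain ⟨j, hj, hy⟩ := hy
    exact AddSubgroup.subset_closure ⟨i + j, by rw [map_add]; omega, SetLike.mul_mem_graded hx hy⟩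
  | zero_left y => rw [zero_mul]; exact zero_mem _
  | zero_right x => rw [mul_zero]; exact zero_mem _
  | add_left x y z _ _ _ h h' => rw [add_mul]; exact add_mem h h'
  | add_right x y z _ _ _ h h' => rw [mul_add]; exact add_mem h h'
  | neg_left x y _ _ h => rw [neg_mul]; exact neg_mem h
  | neg_right x y _ _ h => rw [mul_neg]; exact neg_mem h

theorem smul_mem_positivePart (h₀ : ∀ a : k, algebraMap k R a ∈ 𝒜 0) (a : k) {x : R}
    (hx : x ∈ positivePart 𝒜 w) : a • x ∈ positivePart 𝒜 w := by
  induction hx using AddSubgroup.closure_induction with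
  | mem x hx =>
    obtain ⟨n, hn, hx⟩ := hx
    refine AddSubgroup.subset_closure ⟨n, hn, ?_⟩
    rw [Algebra.smul_def]
    exact zero_add n ▸ SetLike.mul_mem_graded (h₀ a) hx
  | zero => rw [smul_zero]; exact zero_mem _
  | add x y _ _ hx hy => rw [smul_add]; exact add_mem hx hy
  | neg x _ hx => rw [smul_neg]; exact neg_mem hx

/-- Scalars plus the positive part are closed under multiplication and contain the generators. The
weight `w` will be plus or minus the identity, which treats both signs at once. -/
theorem exists_algebraMap_add_positivePart (h₀ : ∀ a : k, algebraMap k R a ∈ 𝒜 0)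
    (hgen : Algebra.adjoin k {x : R | ∃ n : ℤ, 0 < w n ∧ x ∈ 𝒜 n} = ⊤) (x : R) :
    ∃ a : k, ∃ y ∈ positivePart 𝒜 w, x = algebraMap k R a + y := by
  have hx : x ∈ Algebra.adjoin k {x : R | ∃ n : ℤ, 0 < w n ∧ x ∈ 𝒜 n} := hgen ▸ Algebra.mem_top
  induction hx using Algebra.adjoin_induction with
  | mem x hx => exact ⟨0, x, AddSubgroup.subset_closure hx, by simp⟩
  | algebraMap a => exact ⟨a, 0, zero_mem _, by simp⟩
  | add x y _ _ hx hy =>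
    obtain ⟨a, x, hx, rfl⟩ := hx
    obtain ⟨b, y, hy, rfl⟩ := hy
    exact ⟨a + b, x + y, add_mem hx hy, by rw [map_add]; ring⟩
  | mul x y _ _ hx hy =>
    obtain ⟨a, x, hx, rfl⟩ := hx
    obtain ⟨b, y, hy, rfl⟩ := hy
    refine ⟨a * b, a • y + b • x + x * y, add_mem (add_mem (smul_mem_positivePart h₀ a hy)
      (smul_mem_positivePart h₀ b hx)) (mul_mem_positivePart hx hy), ?_⟩
    rw [map_mul, Algebra.smul_def, Algebra.smul_def]
    ring

variable (m : HomogeneousIdeal 𝒜) [hm : IsLocalGraded 𝒜 m]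
  (h₀ : ∀ a : k, algebraMap k R a ∈ 𝒜 0)
  (hgen : Algebra.adjoin k {x : R | ∃ n : ℤ, 0 < w n ∧ x ∈ 𝒜 n} = ⊤)

include h₀ hgen

theorem eq_zero_of_mem_of_neg {n : ℤ} (hn : w n < 0) {x : R} (hx : x ∈ 𝒜 n) : x = 0 := by
  obtain ⟨a, y, hy, rfl⟩ := exists_algebraMap_add_positivePart h₀ hgen x
  have h1 := GrMod.proj_of_mem (M := GrMod.ring 𝒜) hx
  have hn0 : 0 ≠ n := by
    rintro rfl
    simp at hn
  rw [map_add, proj_of_mem_positivePart hy hn.le, add_zero,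
    GrMod.proj_of_mem_ne (M := GrMod.ring 𝒜) hn0 (h₀ a)] at h1
  exact h1.symm

theorem exists_algebraMap_eq_of_mem_zero {x : R} (hx : x ∈ 𝒜 0) : ∃ a : k, algebraMap k R a = x := by
  obtain ⟨a, y, hy, rfl⟩ := exists_algebraMap_add_positivePart h₀ hgen x
  have h1 := GrMod.proj_of_mem (M := GrMod.ring 𝒜) hx
  rw [map_add, proj_of_mem_positivePart hy (map_zero w).le, add_zero,
    GrMod.proj_of_mem (M := GrMod.ring 𝒜) (h₀ a)] at h1
  exact ⟨a, h1⟩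

-- An invertible `x` of positive weight would put 1 in the positive part, which has no component of
-- degree zero; then `1 = 0`.
include hm in
theorem mem_of_pos {n : ℤ} (hn : 0 < w n) {x : R} (hx : x ∈ 𝒜 n) : x ∈ m.toIdeal := by
  refine GrMod.mem_of_not_isUnit m hx fun hu => hm.ne_top ?_
  obtain ⟨z, hz⟩ := hu.exists_right_inv
  obtain ⟨a, y, hy, rfl⟩ := exists_algebraMap_add_positivePart h₀ hgen z
  have hx' : x ∈ positivePart 𝒜 w := AddSubgroup.subset_closure ⟨n, hn, hx⟩
  have h1 : x * (algebraMap k R a + y) ∈ positivePart 𝒜 w := by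
    rw [mul_add, mul_comm, ← Algebra.smul_def]
    exact add_mem (smul_mem_positivePart h₀ a hx') (mul_mem_positivePart hx' hy)
  rw [hz] at h1
  have h2 := proj_of_mem_positivePart h1 (map_zero w).le
  rw [GrMod.proj_of_mem (M := GrMod.ring 𝒜) SetLike.GradedOne.one_mem] at h2
  rw [Ideal.eq_top_iff_one, h2]
  exact zero_mem _

include hm in
theorem eq_zero_or_pos_of_mem (hw : ∀ n, w n = 0 → n = 0) {n : ℤ} {x : R} (hx : x ∈ 𝒜 n)
    (hxm : x ∈ m.toIdeal) : x = 0 ∨ 0 < w n := by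
  rcases lt_trichotomy (w n) 0 with h | h | h
  · exact Or.inl (eq_zero_of_mem_of_neg h₀ hgen h hx)
  · obtain rfl := hw n h
    obtain ⟨a, rfl⟩ := exists_algebraMap_eq_of_mem_zero h₀ hgen hx
    left
    by_contra ha
    have ha' : a ≠ 0 := by
      rintro rfl
      exact ha (map_zero _)
    exact hm.ne_top (Ideal.eq_top_of_isUnit_mem _ hxm ((IsUnit.mk0 a ha').map (algebraMap k R)))
  · exact Or.inr h

include hm in
/-- Homogeneous generators of the maximal homogeneous ideal generate the algebra. -/
theorem adjoin_range_eq_top (hw : ∀ n, w n = 0 → n = 0) {n : ℕ} {x : Fin n → R}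
    (hx : ∀ i, SetLike.IsHomogeneousElem 𝒜 (x i)) (hspan : Ideal.span (Set.range x) = m.toIdeal) :
    Algebra.adjoin k (Set.range x) = ⊤ := by
  choose deg hdeg using hx
  have hpos : ∀ i, x i = 0 ∨ 0 < w (deg i) := fun i =>
    eq_zero_or_pos_of_mem m h₀ hgen hw (hdeg i) (hspan ▸ Ideal.subset_span ⟨i, rfl⟩)
  -- Graded Nakayama by induction on the weight. In positive weight `y` lies in `m`, so it is a
  -- combination of the `x i` with homogeneous coefficients, of smaller weight wherever `x i` is
  -- nonzero; in weight zero only scalars occur.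
  have key : ∀ (l : ℕ) (d : ℤ), w d ≤ l → ∀ y ∈ 𝒜 d, y ∈ Algebra.adjoin k (Set.range x) := by
    intro l
    induction l with
    | zero =>
      intro d hd y hy
      rcases hd.lt_or_eq with h | h
      · rw [eq_zero_of_mem_of_neg h₀ hgen (by simpa using h) hy]
        exact zero_mem _
      · obtain rfl := hw d (by simpa using h)
        obtain ⟨a, rfl⟩ := exists_algebraMap_eq_of_mem_zero h₀ hgen hy
        exact Subalgebra.algebraMap_mem _ _
    | succ l ih =>
      intro d hd y hy
      by_cases hd' : w d ≤ l
      · exact ih d hd' y hy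
      have hym := mem_of_pos m h₀ hgen (by omega) hy
      rw [← hspan, Ideal.mem_span_range_iff_exists_fun] at hym
      obtain ⟨c, hc⟩ := hym
      have h1 := GrMod.proj_of_mem (M := GrMod.ring 𝒜) hy
      rw [← hc, map_sum] at h1
      rw [← hc, ← h1]
      refine sum_mem fun i _ => ?_
      have h2 := GrMod.map_proj (M := GrMod.ring 𝒜) (N := GrMod.ring 𝒜)
        (f := AddMonoidHom.mulRight (x i)) (k := deg i)
        (fun n y hy => SetLike.mul_mem_graded hy (hdeg i)) (d - deg i) (c i)
      rw [sub_add_cancel] at h2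
      refine h2 ▸ ?_
      change (GrMod.ring 𝒜).proj (d - deg i) (c i) * x i ∈ _
      rcases hpos i with h | h
      · rw [h, mul_zero]
        exact zero_mem _
      · refine mul_mem (ih (d - deg i) ?_ _ (GrMod.proj_mem (M := GrMod.ring 𝒜) _ _))
          (Algebra.subset_adjoin ⟨i, rfl⟩)
        rw [map_sub]
        push_cast at hd
        omega
  rw [eq_top_iff]
  rintro y -
  refine GrMod.mem_of_proj_mem (M := GrMod.ring 𝒜)
    (Algebra.adjoin k (Set.range x)).toSubring.toAddSubgroup fun d => ?_
  exact key (w d).toNat d (Int.self_le_toNat _) _ (GrMod.proj_mem (M := GrMod.ring 𝒜) _ _)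

-- The polynomial ring on the `n` generators of `m` surjects onto `R`. A nonzero element of the
-- kernel is a nonzerodivisor, so it would force `dim R + 1 ≤ n`, whereas `dim R` is at least the
-- height `n` of `m`.
include hm in
theorem IsRegularLocalGraded.isGradedPolynomialRing (hw : ∀ n, w n = 0 → n = 0)
    (h : IsRegularLocalGraded 𝒜 m) : IsGradedPolynomialRing 𝒜 k := by
  obtain ⟨n, x, hx, hspan, hn⟩ := h
  let φ : MvPolynomial (Fin n) k →ₐ[k] R := MvPolynomial.aeval x
  have hsurj : Function.Surjective φ := by
    rw [← AlgHom.range_eq_top, ← Algebra.adjoin_range_eq_range_aeval]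
    exact adjoin_range_eq_top m h₀ hgen hw hx hspan
  have hinj : Function.Injective φ := by
    rw [injective_iff_map_eq_zero]
    intro f hf
    by_contra hf0
    have h1 := ringKrullDim_succ_le_of_surjective φ.toRingHom hsurj
      (mem_nonZeroDivisors_of_ne_zero hf0) hf
    rw [MvPolynomial.ringKrullDim_of_isNoetherianRing, ringKrullDim_eq_zero_of_field, zero_add,
      Nat.card_fin] at h1
    have h2 := Ideal.height_le_ringKrullDim_of_ne_top hm.ne_top
    rw [hn] at h2
    have h3 : ((n : ℕ∞) : WithBot ℕ∞) + 1 ≤ n := (add_le_add_left h2 1).trans h1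
    have h4 : n + 1 ≤ n := by exact_mod_cast h3
    omega
  refine ⟨n, AlgEquiv.ofBijective φ ⟨hinj, hsurj⟩, fun i => ?_⟩
  change SetLike.IsHomogeneousElem 𝒜 (φ (MvPolynomial.X i))
  rw [show φ (MvPolynomial.X i) = x i from MvPolynomial.aeval_X x i]
  exact hx i

end

/-! ### The main theorem -/

theorem corollaryA5 {R : Type u} [CommRing R] [IsNoetherianRing R] (𝒜 : ℤ → AddSubgroup R)
    [GradedRing 𝒜] (m : HomogeneousIdeal 𝒜) [IsLocalGraded 𝒜 m] :
    (∀ M : GrMod 𝒜, Module.Finite R M.carrier →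
      List.TFAE [
        (DGMod.ofGrMod M).IsSmall,
        M.HasFiniteFreeResolution,
        HasFiniteFreeResolution (Localization.AtPrime m.toIdeal)
          (LocalizedModule.AtPrime m.toIdeal M.carrier),
        HasFiniteFreeResolution
          (AdicCompletion (IsLocalRing.maximalIdeal (Localization.AtPrime m.toIdeal))
            (Localization.AtPrime m.toIdeal))
          (AdicCompletion (IsLocalRing.maximalIdeal (Localization.AtPrime m.toIdeal))
            (LocalizedModule.AtPrime m.toIdeal M.carrier))]) ∧
    List.TFAE [
      IsRegularDGAlgebra 𝒜,
      IsRegularLocalGraded 𝒜 m,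
      IsRegularLocalRing (Localization.AtPrime m.toIdeal)] ∧
    (IsField (R ⧸ m.toIdeal) → (IsRegularDGAlgebra 𝒜 ↔ IsRegularAugmented 𝒜 m)) ∧
    (∀ (k : Type v) [Field k] [Algebra k R], IsGeneratedInOneSign 𝒜 k →
      List.TFAE [
        IsRegularDGAlgebra 𝒜,
        IsGradedPolynomialRing 𝒜 k,
        ∃ n : ℕ, Nonempty (MvPolynomial (Fin n) k ≃ₐ[k] R)]) := by
  have hreg : List.TFAE [IsRegularDGAlgebra 𝒜, IsRegularLocalGraded 𝒜 m,
      IsRegularLocalRing (Localization.AtPrime m.toIdeal)] := by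
    -- Testing on the single module `R / m` already suffices, which is also the content of (3).
    tfae_have 1 → 3 := fun h => (h.isRegularAugmented m).isRegularLocalRing m
    tfae_have 3 → 1 := isRegularDGAlgebra_of_isRegularLocalRing m
    tfae_have 2 → 3 := fun h => h.isRegularLocalRing m
    tfae_have 3 → 2 := isRegularLocalGraded_of_isRegularLocalRing m
    tfae_finish
  refine ⟨isSmall_tfae m, hreg, fun _ => ⟨fun h => h.isRegularAugmented m, fun h =>
    isRegularDGAlgebra_of_isRegularLocalRing m (h.isRegularLocalRing m)⟩, ?_⟩
  intro k _ _ hk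
  obtain ⟨h₀, hgen⟩ := hk
  tfae_have 1 → 2 := fun h => by
    have h' := (hreg.out 0 1).1 h
    rcases hgen with hgen | hgen
    · exact h'.isGradedPolynomialRing m h₀ (w := AddMonoidHom.id ℤ) hgen fun n hn => hn
    · exact h'.isGradedPolynomialRing m h₀ (w := -AddMonoidHom.id ℤ)
        (by simpa using hgen) fun n hn => by simpa using hn
  tfae_have 2 → 3 := fun ⟨n, e, _⟩ => ⟨n, ⟨e⟩⟩
  tfae_have 3 → 1 := fun ⟨n, ⟨e⟩⟩ =>
    isRegularDGAlgebra_of_isRegularLocalRing m (isRegularLocalRing_of_mvPolynomial_equiv _ e)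
  tfae_finish
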